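/- Let $n\ge 2$ and let $q(x)=x^{T}Ax$ be a quadratic form on $\mathbb R^{n+1}$ of signature $(-,+,\dots,+)$, with elliptic cone $C=\{q=0\}$. **Definitions.** A unit charge exerts, at distance $r$, a repelling force of norm $1/\sin^{n-1}r$ in $\mathbb S^n$, respectively $1/\sinh^{n-1}r$ in $\mathbb H^n$, directed along the (shortest) geodesic; its potential is $u(r)=\int_r^{\pi/2}\frac{dt}{\sin^{n-1}t}$, respectively $u(r)=\int_r^{\infty}\frac{dt}{\sinh^{n-1}t}$. Field and potential of a measure are obtained by integration. *Spherical ellipsoid.* Let $e$ be a unit eigenvector of $A$ for its negative eigenvalue $-1/b$, and let $E=\{x\in\mathbb S^n: q(x)=0,\ \langle e,x\rangle>0\}$, so that $C\cap\mathbb S^n=E\cup -E$. Its inside is $\{x\in\mathbb S^n: q(x)<0,\ \langle e,x\rangle>0\}$, and the region outside of $E$ and $-E$ is $\{x\in\mathbb S^n: q(x)>0\}$. The confocal ellipsoids are $E_\lambda=\{x\in\mathbb S^n: q_\lambda(x)=0,\ \langle e,x\rangle>0\}$, where $q_\lambda$ has the matrix $(A^{-1}-\lambda I)^{-1}$; that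 is, if $q=\sum_{i=1}^n x_i^2/a_i-x_0^2/b$ in an orthonormal basis, then $q_\lambda=\sum_{i=1}^n x_i^2/(a_i-\lambda)-x_0^2/(b+\lambda)$. *Hyperbolic ellipsoid.* Let $J=\operatorname{diag}(-1,1,\dots,1)$ and $\mathbb H^n=\{x: x^TJx=-1,\ x_0>0\}$. Assume that $x^TJx<0$ for all $x\in C\setminus\{0\}$, and let $E=C\cap\mathbb H^n$. Its inside and outside are the parts of $\mathbb H^n$ where $q<0$ and $q>0$. The confocal ellipsoids are $E_\lambda=\{x\in\mathbb H^n: q_\lambda(x)=0\}$, where $q_\lambda$ has the matrix $(A^{-1}-\lambda J)^{-1}$; that is, if $q=\sum_{i=1}^n x_i^2/a_i-x_0^2/b$ in a Minkowski-orthonormal basis, then $q_\lambda=\sum_{i=1}^n x_i^2/(a_i-\lambda)-x_0^2/(b-\lambda)$. *Homeoidal measure.* The homeoid $\{0\le q\le\varepsilon\}$ around $E$ is taken in the hemisphere $\langle e,x\rangle>0$ of $\mathbb S^n$, respectively in $\mathbb H^n$. A homeoidal measure on $E$ is a finite measure on $E$ which is, up to a positive constant factor, the limit for $\varepsilon\to0^+$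 (tested on continuous functions) of $\varepsilon^{-1}$ times the Riemannian volume restricted to this homeoid. **Theorem.** Homeoidal measures on $E$ exist. Charge $E$ with any homeoidal measure. Then the following integrals converge absolutely, and: 1. The electrostatic field vanishes at every point inside $E$ and, in the spherical case, at every point inside $-E$. 2. Outside, the equipotential surfaces are the confocal ellipsoids. In the hyperbolic case, for every $\lambda<0$ the ellipsoid $E_\lambda$ is exactly a level set of the potential in the region outside $E$, and every point outside $E$ lies on some $E_\lambda$ with $\lambda<0$. In the spherical case, for every $\lambda\in(-b,0)$ there is a constant $c$ such that, in the region outside of $E$ and $-E$, the potential equals $c$ exactly on $E_\lambda$ and $-c$ exactly on $-E_\lambda$; it vanishes exactly on the equator $\{x\in\mathbb S^n:\langle e,x\rangle=0\}$; and every other point of this region lies on $E_\lambda$ or $-E_\lambda$ for some $\lambda\in(-b,0)$. -/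

import Mathlib

open MeasureTheory Filter Topology Set
open scoped Matrix Pointwise

noncomputable section

/-- The ambient space `ℝ^{n+1}` with coordinates `x₀, x₁, …, xₙ`. -/
abbrev Amb (n : ℕ) := EuclideanSpace ℝ (Fin (n + 1))

/-- The bilinear form `xᵀ A y`. -/
def bil {n : ℕ} (A : Matrix (Fin (n + 1)) (Fin (n + 1)) ℝ) (x y : Amb n) : ℝ :=
  x.ofLp ⬝ᵥ (A *ᵥ y.ofLp)

/-- The quadratic form `q(x) = xᵀ A x`. -/
def qf {n : ℕ} (A : Matrix (Fin (n + 1)) (Fin (n + 1)) ℝ) (x : Amb n) : ℝ :=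
  bil A x x

/-- The matrix `diag(-1, 1, …, 1)`; `qf (mink n)` is the Minkowski form
`-x₀² + x₁² + ⋯ + xₙ²`. -/
def mink (n : ℕ) : Matrix (Fin (n + 1)) (Fin (n + 1)) ℝ :=
  Matrix.diagonal (Fin.cons (-1) (fun _ => 1))

/-- `A` is the (symmetric) matrix of a quadratic form of signature `(-, +, …, +)`, that is,
in some linear coordinates the form is `-y₀² + y₁² + ⋯ + yₙ²`. Its zero set is an elliptic cone. -/
def IsElliptic {n : ℕ} (A : Matrix (Fin (n + 1)) (Fin (n + 1)) ℝ) : Prop :=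
  ∃ P : Matrix (Fin (n + 1)) (Fin (n + 1)) ℝ, IsUnit P.det ∧ Pᵀ * A * P = mink n

/-- The confocal family of the quadratic form with matrix `A`, with respect to the ambient form with
matrix `G` (where `G⁻¹ = G`): the dual form of `q_l` is the dual form of `q` minus `l` times the
(dual) ambient form. In coordinates in which `G = diag(σ, 1, …, 1)` and `q` is
`∑ xᵢ² / aᵢ - x₀² / b`, the form `q_l` is `∑ xᵢ² / (aᵢ - l) - x₀² / (b + σ l)`. -/
def confocal {n : ℕ} (G A : Matrix (Fin (n + 1)) (Fin (n + 1)) ℝ) (l : ℝ) :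
    Matrix (Fin (n + 1)) (Fin (n + 1)) ℝ :=
  (A⁻¹ - l • G)⁻¹

/-! ### Homeoidal measures -/

/-- `o` is a homeoidal measure on `E`: a finite measure carried by `E` that is, up to a positive
constant factor, the limit as `ε → 0+` of the uniform mass distributions (with respect to the volume
`vol` of the space form) on the thin shells `shell ε`, divided by `ε`. -/
def IsHomeoidal {n : ℕ} (vol : Measure (Amb n)) (shell : ℝ → Set (Amb n)) (E : Set (Amb n))
    (o : Measure (Amb n)) : Prop :=
  IsFiniteMeasure o ∧ o Eᶜ = 0 ∧
    ∃ c : ℝ, 0 < c ∧ ∀ f : Amb n → ℝ, Continuous f →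
      Tendsto (fun ε : ℝ => c / ε * ∫ x in shell ε, f x ∂vol) (𝓝[>] 0) (𝓝 (∫ x, f x ∂o))

/-! ### The sphere -/

/-- The unit sphere `Sⁿ`. -/
def sph (n : ℕ) : Set (Amb n) := Metric.sphere 0 1

/-- The Riemannian volume of `Sⁿ`, as a measure on the ambient space. -/
def sphVol (n : ℕ) : Measure (Amb n) :=
  ((volume : Measure (Amb n)).toSphere).map Subtype.val

/-- The spherical distance. -/
def sphDist {n : ℕ} (x y : Amb n) : ℝ := Real.arccos (inner ℝ x y)

/-- The potential at distance `r` from a unit charge on `Sⁿ`. -/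
def sphU (n : ℕ) (r : ℝ) : ℝ := ∫ t in r..(Real.pi / 2), 1 / Real.sin t ^ (n - 1)

/-- The force exerted at `p ∈ Sⁿ` by a unit charge at `y ∈ Sⁿ`: it has norm `1 / sin^{n-1} r`, where
`r` is the distance, and is directed along the shortest geodesic. Here `(y - cos r • p) / sin r` is
the unit tangent vector at `p` pointing towards `y`; like charges repel. -/
def sphForce {n : ℕ} (p y : Amb n) : Amb n :=
  -(1 / Real.sin (sphDist p y) ^ (n - 1)) •
    ((1 / Real.sin (sphDist p y)) • (y - Real.cos (sphDist p y) • p))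

/-- The electrostatic field at `p` of the charge distribution `o` on `Sⁿ`. -/
def sphField {n : ℕ} (o : Measure (Amb n)) (p : Amb n) : Amb n := ∫ y, sphForce p y ∂o

/-- The electrostatic potential at `x` of the charge distribution `o` on `Sⁿ`. -/
def sphPot {n : ℕ} (o : Measure (Amb n)) (x : Amb n) : ℝ := ∫ y, sphU n (sphDist x y) ∂o

/-- The spherical ellipsoid cut out by the cone `q = 0` in the hemisphere with centre `e`. -/
def sphEll {n : ℕ} (A : Matrix (Fin (n + 1)) (Fin (n + 1)) ℝ) (e : Amb n) : Set (Amb n) :=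
  {x | x ∈ sph n ∧ qf A x = 0 ∧ 0 < inner ℝ e x}

/-- The region inside the spherical ellipsoid. -/
def sphInside {n : ℕ} (A : Matrix (Fin (n + 1)) (Fin (n + 1)) ℝ) (e : Amb n) : Set (Amb n) :=
  {x | x ∈ sph n ∧ qf A x < 0 ∧ 0 < inner ℝ e x}

/-- The region of the sphere outside of both ellipsoids `E` and `-E`. -/
def sphOutside {n : ℕ} (A : Matrix (Fin (n + 1)) (Fin (n + 1)) ℝ) : Set (Amb n) :=
  {x | x ∈ sph n ∧ 0 < qf A x}

/-- The spherical homeoid `0 ≤ q ≤ ε` around the ellipsoid in the hemisphere with centre `e`. -/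
def sphShell {n : ℕ} (A : Matrix (Fin (n + 1)) (Fin (n + 1)) ℝ) (e : Amb n) (ε : ℝ) :
    Set (Amb n) :=
  {x | x ∈ sph n ∧ 0 ≤ qf A x ∧ qf A x ≤ ε ∧ 0 < inner ℝ e x}

/-! ### The hyperbolic space -/

/-- The hyperbolic space `Hⁿ`: the upper sheet of the hyperboloid. -/
def hyp (n : ℕ) : Set (Amb n) := {x | qf (mink n) x = -1 ∧ 0 < x 0}

/-- The Riemannian volume of `Hⁿ`, as a measure on the ambient space. As `dx = rⁿ dr dvol(y)` in the
Minkowski polar coordinates `x = r y`, `y ∈ Hⁿ`, the volume of a subset of `Hⁿ` is `n + 1` times the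
Lebesgue measure of the cone `{r y | 0 < r < 1}` over it; thus the volume is the image of Lebesgue
measure on the cone over `Hⁿ` under the radial projection, multiplied by `n + 1`. -/
def hypVol (n : ℕ) : Measure (Amb n) :=
  ((n : ENNReal) + 1) •
    ((volume : Measure (Amb n)).restrict
      {x | -1 < qf (mink n) x ∧ qf (mink n) x < 0 ∧ 0 < x 0}).map
        (fun x => (1 / Real.sqrt (-qf (mink n) x)) • x)

/-- The hyperbolic distance. -/
def hypDist {n : ℕ} (x y : Amb n) : ℝ := Real.arcosh (-bil (mink n) x y)

/-- The potential at distance `r` from a unit charge in `Hⁿ`. -/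
def hypU (n : ℕ) (r : ℝ) : ℝ := ∫ t in Ioi r, 1 / Real.sinh t ^ (n - 1)

/-- The force exerted at `p ∈ Hⁿ` by a unit charge at `y ∈ Hⁿ`: it has norm `1 / sinh^{n-1} r`, where
`r` is the distance, and is directed along the geodesic. Here `(y - cosh r • p) / sinh r` is
the unit tangent vector at `p` pointing towards `y`; like charges repel. -/
def hypForce {n : ℕ} (p y : Amb n) : Amb n :=
  -(1 / Real.sinh (hypDist p y) ^ (n - 1)) •
    ((1 / Real.sinh (hypDist p y)) • (y - Real.cosh (hypDist p y) • p))

/-- The electrostatic field at `p` of the charge distribution `o` in `Hⁿ`. -/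
def hypField {n : ℕ} (o : Measure (Amb n)) (p : Amb n) : Amb n := ∫ y, hypForce p y ∂o

/-- The electrostatic potential at `x` of the charge distribution `o` in `Hⁿ`. -/
def hypPot {n : ℕ} (o : Measure (Amb n)) (x : Amb n) : ℝ := ∫ y, hypU n (hypDist x y) ∂o

/-- The hyperbolic ellipsoid cut out by the cone `q = 0`. -/
def hypEll {n : ℕ} (A : Matrix (Fin (n + 1)) (Fin (n + 1)) ℝ) : Set (Amb n) :=
  {x | x ∈ hyp n ∧ qf A x = 0}

/-- The region inside the hyperbolic ellipsoid. -/
def hypInside {n : ℕ} (A : Matrix (Fin (n + 1)) (Fin (n + 1)) ℝ) : Set (Amb n) :=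
  {x | x ∈ hyp n ∧ qf A x < 0}

/-- The region outside the hyperbolic ellipsoid. -/
def hypOutside {n : ℕ} (A : Matrix (Fin (n + 1)) (Fin (n + 1)) ℝ) : Set (Amb n) :=
  {x | x ∈ hyp n ∧ 0 < qf A x}

/-- The hyperbolic homeoid `0 ≤ q ≤ ε`. -/
def hypShell {n : ℕ} (A : Matrix (Fin (n + 1)) (Fin (n + 1)) ℝ) (ε : ℝ) : Set (Amb n) :=
  {x | x ∈ hyp n ∧ 0 ≤ qf A x ∧ qf A x ≤ ε}

end

/-!
The two geometries are treated together, with `σ = 1` for the sphere and `σ = -1` for hyperbolic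
space. In a principal basis (`IsPrincipalBasis`) the ambient form is `σ y₀² + ∑ yᵢ²` and the quadric
is `∑ yᵢ² / aᵢ = y₀² / b`. For the sphere such a basis consists of eigenvectors of `A`. In the
hyperbolic case it exists because the pencil spanned by `A` and the Minkowski form contains a positive
definite form (`exists_posDef_pencil`). Central projection from the hyperplane `y₀ = √b`, with
coordinates `yᵢ = √aᵢ zᵢ`, turns the ellipsoid into the unit sphere `‖z‖ = 1` and the ambient form into
`N(z) = b + σ ∑ aᵢ zᵢ²` (`chartForm`).

In this chart the Riemannian volume has the density `N^(-(n + 1) / 2)` and the homeoid has thickness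
`ε N / 2`, so that the homeoidal measure is `N(ω)^((1 - n) / 2) dω` on the unit sphere, up to a constant
factor (`IsPrincipalBasis.isHomeoidal_exists_and_unique`). The force exerted by this charge at the
point with coordinate `u` becomes the integrand `g(ω - u) dω` with a function `g` that is odd and
homogeneous of degree `1 - n`: the sine of the distance is, up to factors `N`, the square root of a Gram
determinant, which is a quadratic form in `ω - u`. Hence Newton's classical argument, in which the
contributions of opposite chords through an interior point cancel, shows that the field vanishes
inside (`integral_sphere_sub_eq_zero`, `IsPrincipalBasis.integral_force_eq_zero`).

Consequently the potential is constant inside (`integral_weighted_kernel_const`). Outside, Ivory's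
argument applies: the distance from a point of a confocal ellipsoid to a point of the ellipsoid equals
the distance between the corresponding points, with the roles of the ellipsoids exchanged, and
corresponding points carry the same homeoidal density. Therefore the potential on the confocal
ellipsoid is the constant interior potential of the homeoidal measure of that confocal ellipsoid
(`integral_kernel_confocal`, `levelValue`). It is strictly monotone in the parameter
(`levelValue_strictMonoOn`), and a confocal ellipsoid passes through every outer point by the
intermediate value theorem (`IsPrincipalBasis.exists_confocal`); this determines the level sets. On
the sphere the potential of a unit charge is an odd function of the cosine of the distance, so that
the potential is odd and vanishes on the equator by symmetry; off the equator it is nonzero.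
-/

/-! ### Integrals over thin shells -/

section Shell

theorem isCompact_annulus {E : Type*} [NormedAddCommGroup E] [NormedSpace ℝ E]
    [FiniteDimensional ℝ E] (ρ : ℝ) : IsCompact {z : E | 1 ≤ ‖z‖ ∧ ‖z‖ ≤ ρ} := by
  refine Metric.isCompact_of_isClosed_isBounded ?_ ?_
  · have h1 : IsClosed {z : E | 1 ≤ ‖z‖} := isClosed_le continuous_const continuous_norm
    have h2 : IsClosed {z : E | ‖z‖ ≤ ρ} := isClosed_le continuous_norm continuous_const
    exact h1.inter h2
  · exact (Metric.isBounded_closedBall (x := (0 : E)) (r := ρ)).subset fun z hz => by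
      simpa using hz.2

/-- The thin shell `1 ≤ ‖z‖² ≤ 1 + ε N z`. The bound `‖z‖ ≤ ρ` keeps it inside an annulus on which `N`
is under control. -/
def thinShell {E : Type*} [NormedAddCommGroup E] (N : E → ℝ) (ρ ε : ℝ) : Set E :=
  {z | (1 ≤ ‖z‖ ∧ ‖z‖ ≤ ρ) ∧ ‖z‖ ^ 2 - 1 ≤ ε * N z}

theorem isClosed_thinShell {E : Type*} [NormedAddCommGroup E] [NormedSpace ℝ E]
    [FiniteDimensional ℝ E] {N : E → ℝ} {ρ : ℝ}
    (hN : ContinuousOn N {z | 1 ≤ ‖z‖ ∧ ‖z‖ ≤ ρ}) (ε : ℝ) : IsClosed (thinShell N ρ ε) :=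
  (isCompact_annulus ρ).isClosed.isClosed_le (by fun_prop) (continuousOn_const.mul hN)

variable {E F : Type*} [NormedAddCommGroup E] [NormedSpace ℝ E] [MeasurableSpace E] [BorelSpace E]
  [FiniteDimensional ℝ E] [NormedAddCommGroup F] [NormedSpace ℝ F]

/-- Integration in polar coordinates, for vector-valued functions. -/
theorem integral_polar [Nontrivial E] (μ : Measure E) [μ.IsAddHaarMeasure] {f : E → F}
    (hf : Integrable f μ) :
    Integrable (fun ω : Metric.sphere (0 : E) 1 =>
        ∫ r in Ioi (0 : ℝ), r ^ (Module.finrank ℝ E - 1) • f (r • ω.1)) μ.toSphere ∧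
    ∫ x, f x ∂μ = ∫ ω : Metric.sphere (0 : E) 1,
      (∫ r in Ioi (0 : ℝ), r ^ (Module.finrank ℝ E - 1) • f (r • ω.1)) ∂μ.toSphere := by
  have key := μ.measurePreserving_homeomorphUnitSphereProd
  have emb := (homeomorphUnitSphereProd E).measurableEmbedding
  set g : Metric.sphere (0 : E) 1 × Ioi (0 : ℝ) → F := fun p => f (p.2.1 • p.1.1) with hg
  have hcomp : ∀ x : ({0}ᶜ : Set E), g (homeomorphUnitSphereProd E x) = f x.1 := by
    intro x
    simp only [hg]
    congr 1
    have := (homeomorphUnitSphereProd E).symm_apply_apply x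
    conv_rhs => rw [← this]
    rfl
  have hint : Integrable g (μ.toSphere.prod (.volumeIoiPow (Module.finrank ℝ E - 1))) := by
    rw [← key.integrable_comp_emb emb]
    have h1 : IntegrableOn f ({0}ᶜ : Set E) μ := hf.integrableOn
    rw [integrableOn_iff_comap_subtypeVal (measurableSet_singleton _).compl] at h1
    refine h1.congr (Eventually.of_forall fun x => ?_)
    simp [hcomp]
  have hinner : ∀ ω : Metric.sphere (0 : E) 1,
      ∫ r : Ioi (0 : ℝ), g (ω, r) ∂(Measure.volumeIoiPow (Module.finrank ℝ E - 1)) =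
        ∫ r in Ioi (0 : ℝ), r ^ (Module.finrank ℝ E - 1) • f (r • ω.1) := by
    intro ω
    simp only [Measure.volumeIoiPow, ENNReal.ofReal, hg]
    rw [integral_withDensity_eq_integral_smul,
      integral_subtype_comap measurableSet_Ioi
        fun a => Real.toNNReal (a ^ (Module.finrank ℝ E - 1)) • f (a • ω.1),
      setIntegral_congr_fun measurableSet_Ioi fun x hx => ?_]
    · rw [NNReal.smul_def, Real.coe_toNNReal _ (pow_nonneg hx.out.le _)]
    · exact (measurable_subtype_coe.pow_const _).real_toNNReal
  constructor
  · have := hint.integral_prod_left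
    exact this.congr (Eventually.of_forall hinner)
  · calc ∫ x, f x ∂μ = ∫ x : ({(0)}ᶜ : Set E), f x.1 ∂(μ.comap (↑)) := by
          rw [integral_subtype_comap (measurableSet_singleton _).compl f, restrict_compl_singleton]
      _ = ∫ x : ({(0)}ᶜ : Set E), g (homeomorphUnitSphereProd E x) ∂(μ.comap (↑)) := by
          simp only [hcomp]
      _ = ∫ p, g p ∂(μ.toSphere.prod (.volumeIoiPow (Module.finrank ℝ E - 1))) :=
          key.integral_comp emb g
      _ = _ := by
          rw [integral_prod _ hint]
          exact integral_congr_ae (Eventually.of_forall hinner)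

/-- The set `1 ≤ s, s² - 1 ≤ ε N(s)` is contained in the interval `[1, 1 + ε M / 2]`: this dominates the
radial integrals over the thin shells uniformly in `ε`. -/
theorem norm_integral_thin_interval_le {h : ℝ → F} {N : ℝ → ℝ} {ρ M C ε : ℝ} (hε : 0 < ε)
    (hM : ∀ s ∈ Icc 1 ρ, N s ≤ M) (hM0 : 0 ≤ M) (hC : ∀ s ∈ Icc 1 ρ, ‖h s‖ ≤ C) (hC0 : 0 ≤ C) :
    ‖ε⁻¹ • ∫ s, indicator {s | s ∈ Icc 1 ρ ∧ s ^ 2 - 1 ≤ ε * N s} h s‖ ≤ M / 2 * C := by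
  have hle : ‖∫ s, indicator {s | s ∈ Icc 1 ρ ∧ s ^ 2 - 1 ≤ ε * N s} h s‖ ≤ ε * (M / 2) * C := by
    calc _ ≤ ∫ s, indicator (Icc 1 (1 + ε * (M / 2))) (fun _ => C) s := by
          refine norm_integral_le_of_norm_le ?_ (Eventually.of_forall fun s => ?_)
          · exact (integrable_indicator_iff measurableSet_Icc).2 (by simp)
          · by_cases hs : s ∈ {s | s ∈ Icc 1 ρ ∧ s ^ 2 - 1 ≤ ε * N s}
            · rw [indicator_of_mem hs]
              have h1 := hM s hs.1
              have h2 : s ∈ Icc 1 (1 + ε * (M / 2)) := by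
                refine ⟨hs.1.1, ?_⟩
                have h3 := hs.2
                have h4 := hs.1.1
                have h5 : ε * N s ≤ ε * M := by gcongr
                nlinarith [sq_nonneg (s - 1)]
              rw [indicator_of_mem h2]
              exact hC s hs.1
            · rw [indicator_of_notMem hs, norm_zero]
              exact indicator_nonneg (fun _ _ => hC0) _
      _ = _ := by
          rw [integral_indicator measurableSet_Icc]
          simp only [integral_const, MeasurableSet.univ, measureReal_restrict_apply, univ_inter,
            Real.volume_real_Icc, smul_eq_mul]
          rw [max_eq_left (by nlinarith [mul_nonneg hε.le hM0])]
          ring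
  rw [norm_smul, norm_inv, Real.norm_of_nonneg hε.le]
  calc ε⁻¹ * _ ≤ ε⁻¹ * (ε * (M / 2) * C) := by gcongr
    _ = _ := by field_simp

/-- The radial case of `tendsto_integral_thinShell`: at `s = 1` the set `s² - 1 ≤ ε N(s)` has thickness
`ε N(1) / 2` to first order. -/
theorem tendsto_integral_thin_interval [CompleteSpace F] {h : ℝ → F} {N : ℝ → ℝ} {ρ : ℝ} (hρ : 1 < ρ)
    (hh : ContinuousOn h (Icc 1 ρ)) (hN : ContinuousOn N (Icc 1 ρ))
    (hpos : ∀ s ∈ Icc 1 ρ, 0 < N s) :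
    Tendsto (fun ε : ℝ => ε⁻¹ • ∫ s, indicator {s | s ∈ Icc 1 ρ ∧ s ^ 2 - 1 ≤ ε * N s} h s)
      (𝓝[>] 0) (𝓝 ((N 1 / 2) • h 1)) := by
  obtain ⟨C, hC⟩ := isCompact_Icc.exists_bound_of_continuousOn hh
  obtain ⟨M, hM⟩ := isCompact_Icc.exists_bound_of_continuousOn hN
  have hC0 : 0 ≤ C := (norm_nonneg _).trans (hC 1 ⟨le_rfl, hρ.le⟩)
  have hM' : ∀ s ∈ Icc 1 ρ, N s ≤ M := fun s hs => (le_abs_self _).trans (hM s hs)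
  have h1mem : (1 : ℝ) ∈ Icc 1 ρ := ⟨le_rfl, hρ.le⟩
  have hM0 : 0 < M := (hpos 1 h1mem).trans_le (hM' 1 h1mem)
  -- after the substitution `s = 1 + ε t` the integrand converges pointwise
  set T : ℝ → Set ℝ := fun ε => {t | 1 + ε * t ∈ Icc 1 ρ ∧
    (1 + ε * t) ^ 2 - 1 ≤ ε * N (1 + ε * t)} with hT
  have hsub : ∀ ε : ℝ, 0 < ε →
      ε⁻¹ • ∫ s, indicator {s | s ∈ Icc 1 ρ ∧ s ^ 2 - 1 ≤ ε * N s} h s =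
      ∫ t, indicator (T ε) (fun t => h (1 + ε * t)) t := by
    intro ε hε
    rw [← integral_add_left_eq_self _ (1 : ℝ)]
    have := Measure.integral_comp_mul_left
      (fun u => indicator {s | s ∈ Icc 1 ρ ∧ s ^ 2 - 1 ≤ ε * N s} h (1 + u)) ε
    rw [abs_of_pos (inv_pos.2 hε)] at this
    rw [← this]
    rfl
  have hlim : Tendsto (fun ε : ℝ => ∫ t, indicator (T ε) (fun t => h (1 + ε * t)) t) (𝓝[>] 0)
      (𝓝 (∫ t, indicator (Icc 0 (N 1 / 2)) (fun _ => h 1) t)) := by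
    refine tendsto_integral_filter_of_dominated_convergence
      (indicator (Icc 0 (M / 2)) (fun _ => C)) ?_ ?_ ?_ ?_
    · filter_upwards [self_mem_nhdsWithin] with ε hε
      have hcl : IsClosed (T ε) := by
        have h1 : IsClosed {t : ℝ | 1 + ε * t ∈ Icc 1 ρ} :=
          isClosed_Icc.preimage (by fun_prop)
        have hmaps : MapsTo (fun t : ℝ => 1 + ε * t) {t : ℝ | 1 + ε * t ∈ Icc 1 ρ} (Icc 1 ρ) :=
          fun t ht => ht
        have h2 : ContinuousOn (fun t : ℝ => ε * N (1 + ε * t)) {t : ℝ | 1 + ε * t ∈ Icc 1 ρ} :=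
          continuousOn_const.mul (hN.comp (by fun_prop) hmaps)
        exact h1.isClosed_le (by fun_prop) h2
      rw [aestronglyMeasurable_indicator_iff hcl.measurableSet]
      refine ContinuousOn.aestronglyMeasurable ?_ hcl.measurableSet
      exact hh.comp (by fun_prop) fun t ht => ht.1
    · filter_upwards [self_mem_nhdsWithin] with ε hε
      have hε : 0 < ε := hε
      refine Eventually.of_forall fun t => ?_
      by_cases ht : t ∈ T ε
      · rw [indicator_of_mem ht]
        have h0 : 0 ≤ t := by
          have := ht.1.1
          by_contra hneg
          push Not at hneg
          nlinarith [mul_neg_of_pos_of_neg hε hneg]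
        have h2 : t ∈ Icc 0 (M / 2) := by
          refine ⟨h0, ?_⟩
          have h3 := ht.2
          have h4 : ε * N (1 + ε * t) ≤ ε * M := by
            have := hM' _ ht.1
            gcongr
          have h5 : ε * (2 * t) ≤ ε * M := by nlinarith [sq_nonneg (ε * t)]
          have := le_of_mul_le_mul_left h5 hε
          linarith
        rw [indicator_of_mem h2]
        exact hC _ ht.1
      · rw [indicator_of_notMem ht, norm_zero]
        exact indicator_nonneg (fun _ _ => hC0) _
    · exact (integrable_indicator_iff measurableSet_Icc).2 (by simp)
    · have hae : ∀ᵐ t : ℝ, t ∉ ({0, N 1 / 2} : Set ℝ) :=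
        (measure_eq_zero_iff_ae_notMem.1 ((Set.toFinite _).measure_zero volume))
      filter_upwards [hae] with t ht
      simp only [mem_insert_iff, mem_singleton_iff, not_or] at ht
      rcases lt_or_gt_of_ne ht.1 with hneg | hpos'
      · rw [indicator_of_notMem (fun h => absurd h.1 (not_le.2 hneg))]
        refine tendsto_const_nhds.congr' ?_
        filter_upwards [self_mem_nhdsWithin] with ε hε
        have hε : 0 < ε := hε
        rw [indicator_of_notMem]
        intro h
        have := h.1.1
        nlinarith [mul_neg_of_pos_of_neg hε hneg]
      · have hto : Tendsto (fun ε : ℝ => 1 + ε * t) (𝓝[>] 0) (𝓝[Icc 1 ρ] 1) := by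
          refine tendsto_nhdsWithin_iff.2 ⟨?_, ?_⟩
          · have : Tendsto (fun ε : ℝ => 1 + ε * t) (𝓝 0) (𝓝 (1 + 0 * t)) :=
              (Continuous.tendsto (by fun_prop) _)
            simpa using this.mono_left nhdsWithin_le_nhds
          · have : ∀ᶠ ε : ℝ in 𝓝 0, 1 + ε * t < ρ := by
              refine (Continuous.tendsto (f := fun ε : ℝ => 1 + ε * t)
                (by fun_prop) 0).eventually_lt_const ?_
              simpa using hρ
            filter_upwards [self_mem_nhdsWithin, this.filter_mono nhdsWithin_le_nhds] with ε hε h2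
            have hε : 0 < ε := hε
            exact ⟨by nlinarith [mul_pos hε hpos'], h2.le⟩
        have hNt : Tendsto (fun ε : ℝ => N (1 + ε * t) - ε * t ^ 2) (𝓝[>] 0) (𝓝 (N 1)) := by
          have h1 : Tendsto (fun ε : ℝ => N (1 + ε * t)) (𝓝[>] 0) (𝓝 (N 1)) :=
            (hN 1 h1mem).tendsto.comp hto
          have h2 : Tendsto (fun ε : ℝ => ε * t ^ 2) (𝓝[>] 0) (𝓝 0) := by
            have : Tendsto (fun ε : ℝ => ε * t ^ 2) (𝓝 0) (𝓝 (0 * t ^ 2)) :=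
              (Continuous.tendsto (by fun_prop) _)
            simpa using this.mono_left nhdsWithin_le_nhds
          simpa using h1.sub h2
        rcases lt_or_gt_of_ne ht.2 with hlt | hgt
        · rw [indicator_of_mem (show t ∈ Icc 0 (N 1 / 2) from ⟨hpos'.le, hlt.le⟩)]
          refine ((hh 1 h1mem).tendsto.comp hto).congr' ?_
          have h3 := hNt.eventually_const_lt (show 2 * t < N 1 by linarith)
          filter_upwards [self_mem_nhdsWithin, (tendsto_nhdsWithin_iff.1 hto).2, h3] with ε hε h1 h2
          have hε : 0 < ε := hε
          rw [indicator_of_mem]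
          · rfl
          · refine ⟨h1, ?_⟩
            nlinarith [mul_lt_mul_of_pos_left h2 hε]
        · rw [indicator_of_notMem (fun h => absurd h.2 (not_le.2 hgt))]
          refine tendsto_const_nhds.congr' ?_
          have h3 := hNt.eventually_lt_const (show N 1 < 2 * t by linarith)
          filter_upwards [self_mem_nhdsWithin, h3] with ε hε h2
          have hε : 0 < ε := hε
          rw [indicator_of_notMem]
          intro h
          have := h.2
          nlinarith [mul_lt_mul_of_pos_left h2 hε]
  have hval : ∫ t, indicator (Icc 0 (N 1 / 2)) (fun _ => h 1) t = (N 1 / 2) • h 1 := by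
    rw [integral_indicator measurableSet_Icc]
    simp only [integral_const, MeasurableSet.univ, measureReal_restrict_apply, univ_inter,
      Real.volume_real_Icc]
    rw [sub_zero, max_eq_left (by have := hpos 1 h1mem; positivity)]
  rw [hval] at hlim
  refine hlim.congr' ?_
  filter_upwards [self_mem_nhdsWithin] with ε hε
  exact (hsub ε hε).symm

theorem integrableOn_thinShell {E F : Type*} [NormedAddCommGroup E] [NormedSpace ℝ E]
    [MeasurableSpace E] [BorelSpace E] [FiniteDimensional ℝ E] [NormedAddCommGroup F]
    (μ : Measure E) [μ.IsAddHaarMeasure] {g : E → F} {N : E → ℝ} {ρ : ℝ}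
    (hg : ContinuousOn g {z | 1 ≤ ‖z‖ ∧ ‖z‖ ≤ ρ}) (hN : ContinuousOn N {z | 1 ≤ ‖z‖ ∧ ‖z‖ ≤ ρ})
    (ε : ℝ) : IntegrableOn g (thinShell N ρ ε) μ := by
  refine ContinuousOn.integrableOn_compact ?_ (hg.mono fun z hz => hz.1)
  refine Metric.isCompact_of_isClosed_isBounded (isClosed_thinShell hN ε) ?_
  exact (Metric.isBounded_closedBall (x := (0 : E)) (r := ρ)).subset fun z hz => by
    simpa using hz.1.2

/-- The thin shell between `‖z‖² = 1` and `‖z‖² = 1 + ε N z` has thickness `ε N / 2` to first order. -/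
theorem tendsto_integral_thinShell [CompleteSpace F] [Nontrivial E] (μ : Measure E) [μ.IsAddHaarMeasure] {g : E → F}
    {N : E → ℝ} {ρ : ℝ} (hρ : 1 < ρ)
    (hg : ContinuousOn g {z | 1 ≤ ‖z‖ ∧ ‖z‖ ≤ ρ}) (hN : ContinuousOn N {z | 1 ≤ ‖z‖ ∧ ‖z‖ ≤ ρ})
    (hpos : ∀ z, 1 ≤ ‖z‖ → ‖z‖ ≤ ρ → 0 < N z) :
    Tendsto (fun ε : ℝ => ε⁻¹ • ∫ z in thinShell N ρ ε, g z ∂μ) (𝓝[>] 0)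
      (𝓝 (∫ ω : Metric.sphere (0 : E) 1, (N ω.1 / 2) • g ω.1 ∂μ.toSphere)) := by
  set d := Module.finrank ℝ E - 1
  have hcpt := isCompact_annulus (E := E) ρ
  obtain ⟨C, hC⟩ := hcpt.exists_bound_of_continuousOn hg
  obtain ⟨M, hM⟩ := hcpt.exists_bound_of_continuousOn hN
  have hpolar : ∀ ε : ℝ, ∫ z in thinShell N ρ ε, g z ∂μ =
      ∫ ω : Metric.sphere (0 : E) 1, (∫ s, indicator
        {s | s ∈ Icc 1 ρ ∧ s ^ 2 - 1 ≤ ε * N (s • ω.1)}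
        (fun s => s ^ d • g (s • ω.1)) s) ∂μ.toSphere ∧
      Integrable (fun ω : Metric.sphere (0 : E) 1 => ∫ s, indicator
        {s | s ∈ Icc 1 ρ ∧ s ^ 2 - 1 ≤ ε * N (s • ω.1)}
        (fun s => s ^ d • g (s • ω.1)) s) μ.toSphere := by
    intro ε
    have hm := (isClosed_thinShell hN ε).measurableSet
    rw [← integral_indicator hm]
    have hI : Integrable (indicator (thinShell N ρ ε) g) μ :=
      (integrable_indicator_iff hm).2 (integrableOn_thinShell μ hg hN ε)
    have hinner : ∀ ω : Metric.sphere (0 : E) 1,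
        ∫ r in Ioi (0 : ℝ), r ^ d • indicator (thinShell N ρ ε) g (r • ω.1) =
        ∫ s, indicator {s | s ∈ Icc 1 ρ ∧ s ^ 2 - 1 ≤ ε * N (s • ω.1)}
          (fun s => s ^ d • g (s • ω.1)) s := by
      intro ω
      have hω : ‖ω.1‖ = 1 := by simp
      rw [← integral_indicator measurableSet_Ioi]
      congr 1
      ext s
      by_cases hs : 0 < s
      · rw [indicator_of_mem (show s ∈ Ioi (0 : ℝ) from hs)]
        have hn : ‖s • ω.1‖ = s := by rw [norm_smul, hω, mul_one, Real.norm_of_nonneg hs.le]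
        by_cases h : s ∈ {s | s ∈ Icc 1 ρ ∧ s ^ 2 - 1 ≤ ε * N (s • ω.1)}
        · rw [indicator_of_mem h, indicator_of_mem]
          exact ⟨by rw [hn]; exact h.1, by rw [hn]; exact h.2⟩
        · rw [indicator_of_notMem h, indicator_of_notMem, smul_zero]
          intro h'
          exact h ⟨by have := h'.1; rwa [hn] at this, by have := h'.2; rwa [hn] at this⟩
      · rw [indicator_of_notMem (show s ∉ Ioi (0 : ℝ) from hs), indicator_of_notMem]
        intro h
        exact hs (zero_lt_one.trans_le h.1.1)
    obtain ⟨h1, h2⟩ := integral_polar μ hI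
    exact ⟨h2.trans (integral_congr_ae (Eventually.of_forall hinner)),
      h1.congr (Eventually.of_forall hinner)⟩
  have hfun : (fun ε : ℝ => ε⁻¹ • ∫ z in thinShell N ρ ε, g z ∂μ) = fun ε =>
      ∫ ω : Metric.sphere (0 : E) 1, (ε⁻¹ • ∫ s, indicator
        {s | s ∈ Icc 1 ρ ∧ s ^ 2 - 1 ≤ ε * N (s • ω.1)}
        (fun s => s ^ d • g (s • ω.1)) s) ∂μ.toSphere := by
    ext1 ε
    rw [(hpolar ε).1, integral_smul]
  rw [hfun]
  have hmem : ∀ ω : Metric.sphere (0 : E) 1, ∀ s ∈ Icc 1 ρ,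
      s • ω.1 ∈ {z : E | 1 ≤ ‖z‖ ∧ ‖z‖ ≤ ρ} := by
    intro ω s hs
    have : ‖s • ω.1‖ = s := by
      rw [norm_smul, norm_eq_of_mem_sphere, mul_one,
        Real.norm_of_nonneg (zero_le_one.trans hs.1)]
    simpa [this] using hs
  have hC0 : 0 ≤ |C| := abs_nonneg _
  refine tendsto_integral_filter_of_dominated_convergence (fun _ => |M| / 2 * (ρ ^ d * |C|)) ?_ ?_
    (integrable_const _) ?_
  · exact Eventually.of_forall fun ε => ((hpolar ε).2.smul ε⁻¹).aestronglyMeasurable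
  · filter_upwards [self_mem_nhdsWithin] with ε hε
    refine Eventually.of_forall fun ω => ?_
    refine norm_integral_thin_interval_le (N := fun s => N (s • ω.1)) hε ?_ (abs_nonneg _) ?_
      (by positivity)
    · exact fun s hs => (le_abs_self _).trans ((hM _ (hmem ω s hs)).trans (le_abs_self _))
    · intro s hs
      have hs0 : 0 ≤ s := zero_le_one.trans hs.1
      rw [norm_smul, norm_pow, Real.norm_of_nonneg hs0]
      have := (hC _ (hmem ω s hs)).trans (le_abs_self C)
      have h2 : s ≤ ρ := hs.2
      gcongr
  · refine Eventually.of_forall fun ω => ?_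
    have hmaps : MapsTo (fun s : ℝ => s • ω.1) (Icc 1 ρ) {z : E | 1 ≤ ‖z‖ ∧ ‖z‖ ≤ ρ} := hmem ω
    have := tendsto_integral_thin_interval (h := fun s => s ^ d • g (s • ω.1))
      (N := fun s => N (s • ω.1)) hρ
      (ContinuousOn.smul (by fun_prop) (hg.comp (by fun_prop) hmaps))
      (hN.comp (by fun_prop) hmaps) (fun s hs => hpos _ (hmem ω s hs).1 (hmem ω s hs).2)
    simpa using this

end Shell

/-! ### Newton's theorem: opposite chords through an interior point balance -/

section Newton

theorem measurePreserving_neg_toSphere {E : Type*} [NormedAddCommGroup E] [NormedSpace ℝ E]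
    [MeasurableSpace E] [BorelSpace E] [FiniteDimensional ℝ E] (μ : Measure E)
    [μ.IsAddHaarMeasure] :
    MeasurePreserving (fun ω : Metric.sphere (0 : E) 1 => -ω) μ.toSphere μ.toSphere := by
  have hm : Measurable (fun ω : Metric.sphere (0 : E) 1 => -ω) := continuous_neg.measurable
  refine ⟨hm, ?_⟩
  ext s hs
  rw [Measure.map_apply hm hs, Measure.toSphere_apply' _ hs, Measure.toSphere_apply' _ (hm hs)]
  congr 1
  rw [← Measure.measure_neg μ]
  congr 1
  ext x
  simp only [Set.mem_neg, Set.mem_smul, mem_image, mem_preimage]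
  constructor
  · rintro ⟨r, hr, _, ⟨ω, hω, rfl⟩, h⟩
    exact ⟨r, hr, _, ⟨-ω, hω, rfl⟩, by simp [h]⟩
  · rintro ⟨r, hr, _, ⟨ω, hω, rfl⟩, h⟩
    exact ⟨r, hr, _, ⟨-ω, by simpa using hω, rfl⟩, by simp [h]⟩

theorem integral_neg_toSphere {E F : Type*} [NormedAddCommGroup E] [NormedSpace ℝ E]
    [MeasurableSpace E] [BorelSpace E] [FiniteDimensional ℝ E] (μ : Measure E)
    [μ.IsAddHaarMeasure] [NormedAddCommGroup F] [NormedSpace ℝ F]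
    (f : Metric.sphere (0 : E) 1 → F) :
    ∫ ω, f (-ω) ∂μ.toSphere = ∫ ω, f ω ∂μ.toSphere :=
  (measurePreserving_neg_toSphere μ).integral_comp
    (Homeomorph.neg (Metric.sphere (0 : E) 1)).measurableEmbedding f

variable {E F : Type*} [NormedAddCommGroup E] [InnerProductSpace ℝ E] [MeasurableSpace E]
  [BorelSpace E] [FiniteDimensional ℝ E] [NormedAddCommGroup F] [NormedSpace ℝ F] [CompleteSpace F]

/-- A ray from a point `w` of the open unit ball meets the shell `1 ≤ ‖z‖² ≤ 1 + ε` in an interval whose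
length does not change when the direction `θ` is reversed. The condition `ε ≤ 3` makes the cut-off
at radius `2` immaterial. -/
theorem ray_mem_spherical_shell_iff {E : Type*} [NormedAddCommGroup E] [InnerProductSpace ℝ E]
    {w θ : E} (hw : ‖w‖ < 1) (hθ : ‖θ‖ = 1) {ε : ℝ} (hε0 : 0 < ε)
    (hε : ε ≤ 3) (r : ℝ) :
    0 < r ∧ r • θ + w ∈ thinShell (fun _ : E => (1 : ℝ)) 2 ε ↔
      r ∈ Icc (√(1 - ‖w‖ ^ 2 + inner ℝ θ w ^ 2) - inner ℝ θ w)
        (√(1 + ε - ‖w‖ ^ 2 + inner ℝ θ w ^ 2) - inner ℝ θ w) := by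
  set c := inner ℝ θ w
  have hw2 : ‖w‖ ^ 2 < 1 := by nlinarith [norm_nonneg w]
  have hn : ‖r • θ + w‖ ^ 2 = (r + c) ^ 2 - c ^ 2 + ‖w‖ ^ 2 := by
    rw [norm_add_sq_real, norm_smul, hθ, inner_smul_left]
    simp only [Real.norm_eq_abs, mul_one, sq_abs, conj_trivial]
    ring
  have hD : |c| < √(1 - ‖w‖ ^ 2 + c ^ 2) := by
    apply Real.lt_sqrt_of_sq_lt
    rw [sq_abs]; linarith
  have hc := abs_lt.1 (show |c| < √(1 - ‖w‖ ^ 2 + c ^ 2) from hD)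
  simp only [thinShell, mem_ofPred_eq, mul_one, mem_Icc]
  have hnn := norm_nonneg (r • θ + w)
  set m := ‖r • θ + w‖
  constructor
  · rintro ⟨hr, ⟨h1, h2⟩, h3⟩
    have hrc : 0 ≤ r + c := by
      by_contra hneg
      push Not at hneg
      have : (r + c) ^ 2 < c ^ 2 := by nlinarith
      nlinarith
    constructor
    · have : √(1 - ‖w‖ ^ 2 + c ^ 2) ≤ r + c := Real.sqrt_le_iff.2 ⟨hrc, by nlinarith⟩
      linarith
    · have : r + c ≤ √(1 + ε - ‖w‖ ^ 2 + c ^ 2) := Real.le_sqrt_of_sq_le (by nlinarith)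
      linarith
  · rintro ⟨h1, h2⟩
    have hr : 0 < r := by linarith
    have hrc : 0 ≤ r + c := by linarith
    have h3 : 1 - ‖w‖ ^ 2 + c ^ 2 ≤ (r + c) ^ 2 := by
      rw [← Real.sqrt_le_left hrc]; linarith
    have h4 : (r + c) ^ 2 ≤ 1 + ε - ‖w‖ ^ 2 + c ^ 2 := by
      rw [← Real.le_sqrt hrc (by nlinarith [sq_nonneg c])]; linarith
    refine ⟨hr, ⟨?_, ?_⟩, ?_⟩
    · nlinarith
    · nlinarith
    · linarith

/-- Newton's theorem for a homogeneous shell: if `g` is odd and homogeneous of degree `1 - d`, then in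
polar coordinates centred at `w` each direction contributes the length of the chord times `g θ`, and
opposite directions cancel. -/
theorem integral_spherical_shell_eq_zero [Nontrivial E] (μ : Measure E) [μ.IsAddHaarMeasure]
    {g : E → F} (hg : ContinuousOn g {0}ᶜ) (hodd : ∀ z, g (-z) = -g z)
    (hhom : ∀ r : ℝ, 0 < r → ∀ z, g (r • z) = (r ^ (Module.finrank ℝ E - 1))⁻¹ • g z)
    {w : E} (hw : ‖w‖ < 1) {ε : ℝ} (hε0 : 0 < ε) (hε : ε ≤ 3) :
    ∫ z in thinShell (fun _ : E => (1 : ℝ)) 2 ε, g (z - w) ∂μ = 0 := by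
  set T := thinShell (fun _ : E => (1 : ℝ)) 2 ε
  have hT : MeasurableSet T := (isClosed_thinShell continuousOn_const ε).measurableSet
  have hgc : ContinuousOn (fun z => g (z - w)) {z | 1 ≤ ‖z‖ ∧ ‖z‖ ≤ 2} := by
    refine hg.comp (by fun_prop) fun z hz h => ?_
    have : z = w := by simpa [sub_eq_zero] using h
    rw [this] at hz
    linarith [hz.1]
  have hint : Integrable (indicator T fun z => g (z - w)) μ :=
    (integrable_indicator_iff hT).2 (integrableOn_thinShell μ hgc continuousOn_const ε)
  have hint' := hint.comp_add_right w
  rw [← integral_indicator hT, ← integral_add_right_eq_self _ w, (integral_polar μ hint').2]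
  -- the length of the chord in the direction `θ`, an even function
  set L : Metric.sphere (0 : E) 1 → ℝ := fun θ =>
    √(1 + ε - ‖w‖ ^ 2 + inner ℝ θ.1 w ^ 2) - √(1 - ‖w‖ ^ 2 + inner ℝ θ.1 w ^ 2)
  have hinner : ∀ θ : Metric.sphere (0 : E) 1,
      ∫ r in Ioi (0 : ℝ), r ^ (Module.finrank ℝ E - 1) •
        indicator T (fun z => g (z - w)) (r • θ.1 + w) = L θ • g θ.1 := by
    intro θ
    have hθ : ‖θ.1‖ = 1 := norm_eq_of_mem_sphere θ
    have h1 : ∀ r : ℝ, indicator (Ioi (0 : ℝ)) (fun r => r ^ (Module.finrank ℝ E - 1) •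
        indicator T (fun z => g (z - w)) (r • θ.1 + w)) r =
        indicator (Icc (√(1 - ‖w‖ ^ 2 + inner ℝ θ.1 w ^ 2) - inner ℝ θ.1 w)
        (√(1 + ε - ‖w‖ ^ 2 + inner ℝ θ.1 w ^ 2) - inner ℝ θ.1 w)) (fun _ => g θ.1) r := by
      intro r
      by_cases h : 0 < r ∧ r • θ.1 + w ∈ T
      · rw [indicator_of_mem (show r ∈ Ioi (0 : ℝ) from h.1), indicator_of_mem h.2,
          indicator_of_mem ((ray_mem_spherical_shell_iff hw hθ hε0 hε r).1 h), add_sub_cancel_right,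
          hhom r h.1, smul_smul, mul_inv_cancel₀ (pow_pos h.1 _).ne', one_smul]
      · rw [indicator_of_notMem
          (fun h' => h ((ray_mem_spherical_shell_iff hw hθ hε0 hε r).2 h'))]
        by_cases hr : 0 < r
        · rw [indicator_of_mem (show r ∈ Ioi (0 : ℝ) from hr),
            indicator_of_notMem (fun h' => h ⟨hr, h'⟩), smul_zero]
        · rw [indicator_of_notMem (show r ∉ Ioi (0 : ℝ) from hr)]
    rw [← integral_indicator measurableSet_Ioi, integral_congr_ae (Eventually.of_forall h1),
      integral_indicator measurableSet_Icc]
    simp only [integral_const, MeasurableSet.univ, measureReal_restrict_apply, univ_inter,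
      Real.volume_real_Icc, L]
    rw [max_eq_left]
    · congr 1; ring
    · have : √(1 - ‖w‖ ^ 2 + inner ℝ θ.1 w ^ 2) ≤ √(1 + ε - ‖w‖ ^ 2 + inner ℝ θ.1 w ^ 2) :=
        Real.sqrt_le_sqrt (by linarith)
      linarith
  rw [integral_congr_ae (Eventually.of_forall hinner)]
  have hneg := integral_neg_toSphere μ (fun θ : Metric.sphere (0 : E) 1 => L θ • g θ.1)
  have hL : ∀ θ : Metric.sphere (0 : E) 1, L (-θ) • g (-θ).1 = -(L θ • g θ.1) := by
    intro θ
    simp [L, hodd]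
  rw [integral_congr_ae (Eventually.of_forall hL), integral_neg] at hneg
  have : (2 : ℝ) • ∫ θ : Metric.sphere (0 : E) 1, L θ • g θ.1 ∂μ.toSphere = 0 := by
    rw [two_smul]
    nth_rewrite 1 [← hneg]
    exact neg_add_cancel _
  simpa using this

/-- Newton's theorem for the sphere, as the limit of the theorem for thin shells. -/
theorem integral_sphere_sub_eq_zero [Nontrivial E] (μ : Measure E) [μ.IsAddHaarMeasure]
    {g : E → F} (hg : ContinuousOn g {0}ᶜ) (hodd : ∀ z, g (-z) = -g z)
    (hhom : ∀ r : ℝ, 0 < r → ∀ z, g (r • z) = (r ^ (Module.finrank ℝ E - 1))⁻¹ • g z)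
    {w : E} (hw : ‖w‖ < 1) :
    ∫ ω : Metric.sphere (0 : E) 1, g (ω.1 - w) ∂μ.toSphere = 0 := by
  have hgc : ContinuousOn (fun z => g (z - w)) {z | 1 ≤ ‖z‖ ∧ ‖z‖ ≤ 2} := by
    refine hg.comp (by fun_prop) fun z hz h => ?_
    have : z = w := by simpa [sub_eq_zero] using h
    rw [this] at hz
    linarith [hz.1]
  have h1 := tendsto_integral_thinShell μ one_lt_two hgc (N := fun _ => 1) continuousOn_const
    (fun _ _ _ => one_pos)
  have h2 : Tendsto (fun ε : ℝ => ε⁻¹ • ∫ z in thinShell (fun _ : E => (1 : ℝ)) 2 ε, g (z - w) ∂μ)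
      (𝓝[>] 0) (𝓝 0) := by
    refine tendsto_const_nhds.congr' ?_
    filter_upwards [Ioo_mem_nhdsGT (show (0 : ℝ) < 3 by norm_num)] with ε hε
    rw [integral_spherical_shell_eq_zero μ hg hodd hhom hw hε.1 hε.2.le, smul_zero]
  have h3 := tendsto_nhds_unique h1 h2
  rw [integral_smul] at h3
  simpa using h3

end Newton

/-! ### The potential of a unit charge as a function of `cos r` or `cosh r` -/

section Kernel

/-- The values of `cos r` on the sphere (`σ = 1`), and of `cosh r` in hyperbolic space (`σ = -1`),
for `0 < r` (and `r < π` on the sphere). -/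
def kernelDomain (σ : ℝ) : Set ℝ := {c | 0 < σ * (1 - c ^ 2) ∧ -1 < c}

theorem kernelDomain_one : kernelDomain 1 = Ioo (-1) 1 := by
  ext c
  simp only [kernelDomain, mem_ofPred_eq, mem_Ioo, one_mul]
  constructor
  · rintro ⟨h1, h2⟩
    exact ⟨h2, by nlinarith⟩
  · rintro ⟨h1, h2⟩
    exact ⟨by nlinarith, h1⟩

theorem kernelDomain_neg_one : kernelDomain (-1) = Ioi 1 := by
  ext c
  simp only [kernelDomain, mem_ofPred_eq, mem_Ioi]
  constructor
  · rintro ⟨h1, h2⟩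
    nlinarith
  · intro h
    exact ⟨by nlinarith, by linarith⟩

/-- `U` is the potential of a unit charge in the `n`-dimensional space form of curvature `σ`,
as a function of `c = cos r`, respectively `c = cosh r`. Only its derivative matters. -/
structure IsKernel (σ : ℝ) (n : ℕ) (U : ℝ → ℝ) : Prop where
  sign : σ = 1 ∨ σ = -1
  hasDerivAt : ∀ c ∈ kernelDomain σ, HasDerivAt U (σ * (√(σ * (1 - c ^ 2)) ^ n)⁻¹) c

theorem isOpen_kernelDomain (σ : ℝ) : IsOpen (kernelDomain σ) :=
  (isOpen_lt (f := fun _ : ℝ => (0 : ℝ)) (g := fun c : ℝ => σ * (1 - c ^ 2))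
    continuous_const (by fun_prop)).inter (isOpen_lt continuous_const continuous_id)

namespace IsKernel

variable {σ : ℝ} {n : ℕ} {U : ℝ → ℝ}

theorem sq_eq_one (h : IsKernel σ n U) : σ * σ = 1 := by
  rcases h.sign with h | h <;> simp [h]

theorem continuousOn (h : IsKernel σ n U) : ContinuousOn U (kernelDomain σ) :=
  fun c hc => (h.hasDerivAt c hc).continuousAt.continuousWithinAt

theorem convex_domain (h : IsKernel σ n U) : Convex ℝ (kernelDomain σ) := by
  rcases h.sign with h | h
  · rw [h, kernelDomain_one]; exact convex_Ioo _ _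
  · rw [h, kernelDomain_neg_one]; exact convex_Ioi _

theorem strictMonoOn (h : IsKernel σ n U) : StrictMonoOn (fun c => σ * U c) (kernelDomain σ) := by
  refine strictMonoOn_of_deriv_pos h.convex_domain (continuousOn_const.mul h.continuousOn) ?_
  intro c hc
  rw [(isOpen_kernelDomain σ).interior_eq] at hc
  rw [((h.hasDerivAt c hc).const_mul σ).deriv, ← mul_assoc, h.sq_eq_one, one_mul]
  have := Real.sqrt_pos.2 hc.1
  positivity

end IsKernel

end Kernel

/-! ### The ambient form in the projective chart -/

section Coordinates

variable {n : ℕ}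

/-- The form `β + σ ∑ αᵢ zᵢ wᵢ`: up to the factor `σ`, the ambient bilinear form at the points
with affine coordinates `z` and `w` of the projective chart in which the ellipsoid with
semiaxes `β`, `α` is the unit sphere. -/
def chartForm (σ β : ℝ) (α : Fin n → ℝ) (z w : EuclideanSpace ℝ (Fin n)) : ℝ :=
  β + σ * ∑ i, α i * z i * w i

theorem chartForm_self_pos {σ β : ℝ} {α : Fin n → ℝ} (hβ : 0 < β)
    (hαβ : ∀ i, 0 < β + σ * α i) {z : EuclideanSpace ℝ (Fin n)} (hz : ‖z‖ ≤ 1) :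
    0 < chartForm σ β α z z := by
  have hn : ∑ i, z i ^ 2 ≤ 1 := by
    rw [← EuclideanSpace.real_norm_sq_eq]
    nlinarith [norm_nonneg z]
  have heq : chartForm σ β α z z = β * (1 - ∑ i, z i ^ 2) + ∑ i, (β + σ * α i) * z i ^ 2 := by
    simp only [chartForm, mul_sub, Finset.mul_sum, add_mul, Finset.sum_add_distrib]
    have : ∀ i, σ * (α i * z i * z i) = σ * α i * z i ^ 2 := fun i => by ring
    simp only [this]
    ring
  rw [heq]
  by_cases h0 : ∀ i, z i = 0
  · simp [h0, hβ]
  · push Not at h0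
    obtain ⟨i, hi⟩ := h0
    have h1 : 0 < ∑ i, (β + σ * α i) * z i ^ 2 := by
      refine Finset.sum_pos' (fun j _ => mul_nonneg (hαβ j).le (sq_nonneg _)) ⟨i, by simp, ?_⟩
      have := hαβ i
      positivity
    have h2 : 0 ≤ β * (1 - ∑ i, z i ^ 2) := mul_nonneg hβ.le (by linarith)
    linarith

theorem continuous_chartForm_self (σ β : ℝ) (α : Fin n → ℝ) :
    Continuous fun z : EuclideanSpace ℝ (Fin n) => chartForm σ β α z z := by
  unfold chartForm
  fun_prop

/-- The quadratic form `⟨u,u⟩⟨v,v⟩ - ⟨u,v⟩²` in `v = u + ζ`, up to the sign `σ`; here `u` and `v`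
have affine coordinates `u`, `v`, and `u` spans the kernel. -/
def gramForm (σ β : ℝ) (α : Fin n → ℝ) (u ζ : EuclideanSpace ℝ (Fin n)) : ℝ :=
  chartForm σ β α u u * (∑ i, α i * ζ i * ζ i) - σ * (∑ i, α i * u i * ζ i) ^ 2

/-- The Gram determinant of two points of the chart is a quadratic form in their difference. -/
theorem gramForm_sub {σ : ℝ} (hσ : σ * σ = 1) (β : ℝ) (α : Fin n → ℝ)
    (u v : EuclideanSpace ℝ (Fin n)) :
    gramForm σ β α u (v - u) =
      σ * (chartForm σ β α u u * chartForm σ β α v v - chartForm σ β α u v ^ 2) := by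
  have h1 : ∑ i, α i * (v - u) i * (v - u) i = ∑ i, α i * v i * v i - 2 * ∑ i, α i * u i * v i
      + ∑ i, α i * u i * u i := by
    rw [Finset.mul_sum, ← Finset.sum_sub_distrib, ← Finset.sum_add_distrib]
    refine Finset.sum_congr rfl fun i _ => ?_
    simp only [PiLp.sub_apply]
    ring
  have h2 : ∑ i, α i * u i * (v - u) i = ∑ i, α i * u i * v i - ∑ i, α i * u i * u i := by
    rw [← Finset.sum_sub_distrib]
    refine Finset.sum_congr rfl fun i _ => ?_
    simp only [PiLp.sub_apply]
    ring
  rw [gramForm, h1, h2]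
  simp only [chartForm]
  set p := ∑ i, α i * u i * u i
  set q := ∑ i, α i * v i * v i
  set m := ∑ i, α i * u i * v i
  linear_combination (-(β * (q + p - 2 * m)) + σ * (m ^ 2 - p * q)) * hσ

theorem gramForm_pos {σ β : ℝ} {α : Fin n → ℝ} (hσ : σ = 1 ∨ σ = -1) (hβ : 0 < β)
    (hα : ∀ i, 0 < α i) {u ζ : EuclideanSpace ℝ (Fin n)} (hu : 0 < chartForm σ β α u u)
    (hζ : ζ ≠ 0) : 0 < gramForm σ β α u ζ := by
  have hpos : 0 < ∑ i, α i * ζ i * ζ i := by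
    have : ∃ i, ζ i ≠ 0 := by
      by_contra h
      push Not at h
      exact hζ (by ext i; simpa using h i)
    obtain ⟨i, hi⟩ := this
    refine Finset.sum_pos' (fun j _ => ?_) ⟨i, by simp, ?_⟩
    · rw [mul_assoc]; exact mul_nonneg (hα j).le (mul_self_nonneg _)
    · rw [mul_assoc]; exact mul_pos (hα i) (mul_self_pos.2 hi)
  rcases hσ with rfl | rfl
  · have hcs : (∑ i, α i * u i * ζ i) ^ 2 ≤ (∑ i, α i * u i * u i) * ∑ i, α i * ζ i * ζ i := by
      refine Finset.sum_sq_le_sum_mul_sum_of_sq_le_mul _ (fun i _ => ?_) (fun i _ => ?_)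
        (fun i _ => ?_)
      · rw [mul_assoc]; exact mul_nonneg (hα i).le (mul_self_nonneg _)
      · rw [mul_assoc]; exact mul_nonneg (hα i).le (mul_self_nonneg _)
      · exact le_of_eq (by ring)
    simp only [gramForm, chartForm, one_mul]
    nlinarith [mul_pos hβ hpos]
  · simp only [gramForm]
    nlinarith [mul_pos hu hpos, sq_nonneg (∑ i, α i * u i * ζ i)]

/-- In terms of `c`, the (hyperbolic) cosine of the distance of the points with affine coordinates `u` and
`v`, the number `σ (1 - c²)`, the square of its (hyperbolic) sine, is a normalized Gram determinant. -/
theorem chartForm_quotient_mem {σ β : ℝ} {α : Fin n → ℝ} (hσ : σ = 1 ∨ σ = -1) (hβ : 0 < β)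
    (hα : ∀ i, 0 < α i) {u v : EuclideanSpace ℝ (Fin n)} (hu : 0 < chartForm σ β α u u)
    (hv : 0 < chartForm σ β α v v) (huv : v ≠ u) :
    σ * (1 - (chartForm σ β α u v / (√(chartForm σ β α u u) * √(chartForm σ β α v v))) ^ 2) =
      gramForm σ β α u (v - u) / (chartForm σ β α u u * chartForm σ β α v v) ∧
    chartForm σ β α u v / (√(chartForm σ β α u u) * √(chartForm σ β α v v)) ∈ kernelDomain σ := by
  have hσ2 : σ * σ = 1 := by rcases hσ with h | h <;> simp [h]
  have h1 : σ * (1 - (chartForm σ β α u v /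
      (√(chartForm σ β α u u) * √(chartForm σ β α v v))) ^ 2) =
      gramForm σ β α u (v - u) / (chartForm σ β α u u * chartForm σ β α v v) := by
    rw [gramForm_sub hσ2, div_pow, mul_pow, Real.sq_sqrt hu.le, Real.sq_sqrt hv.le]
    field_simp
  have hQ := gramForm_pos hσ hβ hα hu (sub_ne_zero.2 huv)
  have h2 : 0 < σ * (1 - (chartForm σ β α u v /
      (√(chartForm σ β α u u) * √(chartForm σ β α v v))) ^ 2) := by
    rw [h1]; positivity
  refine ⟨h1, h2, ?_⟩
  rcases hσ with rfl | rfl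
  · rw [one_mul] at h2
    nlinarith
  · have h3 : 0 ≤ ∑ i, α i * (v - u) i * (v - u) i := by
      refine Finset.sum_nonneg fun i _ => ?_
      rw [mul_assoc]; exact mul_nonneg (hα i).le (mul_self_nonneg _)
    have h4 : ∑ i, α i * (v - u) i * (v - u) i = ∑ i, α i * v i * v i - 2 * ∑ i, α i * u i * v i
        + ∑ i, α i * u i * u i := by
      rw [Finset.mul_sum, ← Finset.sum_sub_distrib, ← Finset.sum_add_distrib]
      refine Finset.sum_congr rfl fun i _ => ?_
      simp only [PiLp.sub_apply]
      ring
    have h5 : 0 < chartForm (-1) β α u v := by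
      simp only [chartForm] at hu hv ⊢
      linarith
    have := Real.sqrt_pos.2 hu
    have := Real.sqrt_pos.2 hv
    have : 0 < chartForm (-1) β α u v /
      (√(chartForm (-1) β α u u) * √(chartForm (-1) β α v v)) := by positivity
    linarith

/-- Newton's theorem in the chart. The denominator of the force is a power of the Gram determinant,
which is homogeneous in `ω - u`, so that the integrand is homogeneous of degree `1 - n`. -/
theorem integral_gramForm_eq_zero (hn : 2 ≤ n) {F : Type*} [NormedAddCommGroup F] [NormedSpace ℝ F]
    [CompleteSpace F] {σ β : ℝ} {α : Fin n → ℝ}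
    (hσ : σ = 1 ∨ σ = -1) (hβ : 0 < β) (hα : ∀ i, 0 < α i) {u : EuclideanSpace ℝ (Fin n)}
    (hu : 0 < chartForm σ β α u u) (hu1 : ‖u‖ < 1) (L : EuclideanSpace ℝ (Fin n) →L[ℝ] F) :
    ∫ ω : Metric.sphere (0 : EuclideanSpace ℝ (Fin n)) 1,
      (√(gramForm σ β α u (ω.1 - u)) ^ n)⁻¹ • L (ω.1 - u) ∂(volume.toSphere) = 0 := by
  have : Nonempty (Fin n) := ⟨⟨0, by omega⟩⟩
  refine integral_sphere_sub_eq_zero (g := fun ζ => (√(gramForm σ β α u ζ) ^ n)⁻¹ • L ζ)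
    volume ?_ ?_ ?_ hu1
  · refine ContinuousOn.smul (ContinuousOn.inv₀ ?_ ?_) (L.continuous.continuousOn)
    · unfold gramForm
      fun_prop
    · intro ζ hζ
      exact (pow_pos (Real.sqrt_pos.2 (gramForm_pos hσ hβ hα hu hζ)) n).ne'
  · intro ζ
    simp [gramForm]
  · intro r hr ζ
    have h1 : gramForm σ β α u (r • ζ) = r ^ 2 * gramForm σ β α u ζ := by
      have e1 : ∑ i, α i * (r • ζ) i * (r • ζ) i = r ^ 2 * ∑ i, α i * ζ i * ζ i := by
        rw [Finset.mul_sum]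
        refine Finset.sum_congr rfl fun i _ => ?_
        simp only [PiLp.smul_apply, smul_eq_mul]; ring
      have e2 : ∑ i, α i * u i * (r • ζ) i = r * ∑ i, α i * u i * ζ i := by
        rw [Finset.mul_sum]
        refine Finset.sum_congr rfl fun i _ => ?_
        simp only [PiLp.smul_apply, smul_eq_mul]; ring
      rw [gramForm, e1, e2, gramForm]
      ring
    simp only [h1]
    rw [Real.sqrt_mul (sq_nonneg r), Real.sqrt_sq hr.le, mul_pow, mul_inv, map_smul, smul_smul,
      smul_smul, finrank_euclideanSpace_fin]
    congr 1
    obtain ⟨m, rfl⟩ : ∃ m, n = m + 1 := ⟨n - 1, by omega⟩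
    rw [pow_succ r, Nat.add_sub_cancel]
    field_simp

end Coordinates

/-! ### The potential is constant inside -/

section InteriorPotential

variable {n : ℕ}

/-- The bilinear form `∑ αᵢ zᵢ ζᵢ` as a functional of `ζ`. -/
noncomputable def weightedDot (α : Fin n → ℝ) (z : EuclideanSpace ℝ (Fin n)) :
    EuclideanSpace ℝ (Fin n) →L[ℝ] ℝ :=
  ∑ i, (α i * z i) • EuclideanSpace.proj i

theorem weightedDot_apply (α : Fin n → ℝ) (z ζ : EuclideanSpace ℝ (Fin n)) :
    weightedDot α z ζ = ∑ i, α i * z i * ζ i := by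
  simp [weightedDot]

theorem chartForm_smul_self (σ β : ℝ) (α : Fin n → ℝ) (s : ℝ) (z : EuclideanSpace ℝ (Fin n)) :
    chartForm σ β α (s • z) (s • z) = β + σ * (s ^ 2 * ∑ i, α i * z i * z i) := by
  rw [chartForm, Finset.mul_sum (s := Finset.univ) (a := s ^ 2)]
  congr 2
  refine Finset.sum_congr rfl fun i _ => ?_
  simp only [PiLp.smul_apply, smul_eq_mul]; ring

theorem chartForm_smul_left (σ β : ℝ) (α : Fin n → ℝ) (s : ℝ) (z w : EuclideanSpace ℝ (Fin n)) :
    chartForm σ β α (s • z) w = β + σ * (s * ∑ i, α i * z i * w i) := by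
  rw [chartForm, Finset.mul_sum (s := Finset.univ) (a := s)]
  congr 2
  refine Finset.sum_congr rfl fun i _ => ?_
  simp only [PiLp.smul_apply, smul_eq_mul]; ring

/-- Differentiating the potential of the point with coordinate `v`, weighted by its share of the
homeoidal measure, along a ray gives the integrand of Newton's theorem. -/
theorem hasDerivAt_weighted_kernel (hn : 2 ≤ n) {σ : ℝ} {U : ℝ → ℝ} (hU : IsKernel σ n U) {β : ℝ}
    {α : Fin n → ℝ} (hβ : 0 < β) (hα : ∀ i, 0 < α i) {z v : EuclideanSpace ℝ (Fin n)} {s : ℝ}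
    (hz : 0 < chartForm σ β α (s • z) (s • z)) (hv : 0 < chartForm σ β α v v) (hne : v ≠ s • z) :
    HasDerivAt (fun s : ℝ => (√(chartForm σ β α v v) ^ (n - 1))⁻¹ *
        U (chartForm σ β α (s • z) v /
          (√(chartForm σ β α (s • z) (s • z)) * √(chartForm σ β α v v))))
      (β * √(chartForm σ β α (s • z) (s • z)) ^ n / √(chartForm σ β α (s • z) (s • z)) ^ 3 *
        ((√(gramForm σ β α (s • z) (v - s • z)) ^ n)⁻¹ • weightedDot α z (v - s • z))) s := by
  obtain ⟨h1, h2⟩ := chartForm_quotient_mem hU.sign hβ hα hz hv hne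
  have hQ := gramForm_pos hU.sign hβ hα hz (sub_ne_zero.2 hne)
  have hD2 := Real.sq_sqrt hz.le
  have hU' := hU.hasDerivAt _ h2
  rw [h1, Real.sqrt_div hQ.le, Real.sqrt_mul hz.le] at hU'
  have hL : weightedDot α z (v - s • z) = ∑ i, α i * z i * v i - s * ∑ i, α i * z i * z i := by
    rw [map_sub, map_smul, weightedDot_apply, weightedDot_apply, smul_eq_mul]
  have hD := Real.sqrt_pos.2 hz
  have hE := Real.sqrt_pos.2 hv
  have hG := Real.sqrt_pos.2 hQ
  rw [hL]
  set G := √(gramForm σ β α (s • z) (v - s • z))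
  set e := √(chartForm σ β α v v)
  simp only [chartForm_smul_self] at *
  simp only [chartForm_smul_left] at *
  set p := ∑ i, α i * z i * z i
  set m := ∑ i, α i * z i * v i
  set D := √(β + σ * (s ^ 2 * p)) with hDdef
  have d1 : HasDerivAt (fun s : ℝ => β + σ * (s * m)) (σ * m) s := by
    simpa using (((hasDerivAt_id s).mul_const m).const_mul σ).const_add β
  have d2 : HasDerivAt (fun s : ℝ => β + σ * (s ^ 2 * p)) (σ * (2 * s * p)) s := by
    simpa using (((hasDerivAt_pow 2 s).mul_const p).const_mul σ).const_add β
  have d3 : HasDerivAt (fun s : ℝ => √(β + σ * (s ^ 2 * p)) * e)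
      (σ * (2 * s * p) / (2 * D) * e) s := (d2.sqrt hz.ne').mul_const e
  have d4 := d1.div d3 (mul_pos hD hE).ne'
  have d5 := ((hU'.comp s d4).const_mul (e ^ (n - 1))⁻¹)
  refine d5.congr_deriv ?_
  rw [← hDdef]
  obtain ⟨k, rfl⟩ : ∃ k, n = k + 1 := ⟨n - 1, by omega⟩
  rw [Nat.add_sub_cancel, div_pow, mul_pow, smul_eq_mul]
  have hσ := hU.sq_eq_one
  have key : (σ * m * (D * e) - (β + σ * (s * m)) * (σ * (2 * s * p) / (2 * D) * e)) =
      σ * β * (m - s * p) * e / D := by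
    field_simp
    rw [hD2]
    ring
  rw [key]
  have hek : 0 < e ^ k := pow_pos hE k
  field_simp
  rw [pow_succ e]
  linear_combination ((m - s * p) * e ^ k * e) * hσ

theorem continuous_gramForm (σ β : ℝ) (α : Fin n → ℝ) :
    Continuous fun q : EuclideanSpace ℝ (Fin n) × EuclideanSpace ℝ (Fin n) =>
      gramForm σ β α q.1 q.2 := by
  unfold gramForm chartForm
  fun_prop

/-- The potential of the homeoidal measure is constant inside the ellipsoid: its derivative along the
segment from the centre to `z` vanishes by Newton's theorem. -/
theorem integral_weighted_kernel_const (hn : 2 ≤ n) {σ : ℝ} {U : ℝ → ℝ} (hU : IsKernel σ n U)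
    {β : ℝ} {α : Fin n → ℝ} (hβ : 0 < β) (hα : ∀ i, 0 < α i) (hαβ : ∀ i, 0 < β + σ * α i)
    {z : EuclideanSpace ℝ (Fin n)} (hz : ‖z‖ < 1) :
    ∫ ω : Metric.sphere (0 : EuclideanSpace ℝ (Fin n)) 1,
      (√(chartForm σ β α ω.1 ω.1) ^ (n - 1))⁻¹ * U (chartForm σ β α z ω.1 /
          (√(chartForm σ β α z z) * √(chartForm σ β α ω.1 ω.1))) ∂volume.toSphere =
    ∫ ω : Metric.sphere (0 : EuclideanSpace ℝ (Fin n)) 1,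
      (√(chartForm σ β α ω.1 ω.1) ^ (n - 1))⁻¹ *
        U (√β / √(chartForm σ β α ω.1 ω.1)) ∂volume.toSphere := by
  set f : ℝ → Metric.sphere (0 : EuclideanSpace ℝ (Fin n)) 1 → ℝ := fun s ω =>
    (√(chartForm σ β α ω.1 ω.1) ^ (n - 1))⁻¹ * U (chartForm σ β α (s • z) ω.1 /
          (√(chartForm σ β α (s • z) (s • z)) * √(chartForm σ β α ω.1 ω.1))) with hf
  set k : ℝ → Metric.sphere (0 : EuclideanSpace ℝ (Fin n)) 1 → ℝ := fun s ω =>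
    β * √(chartForm σ β α (s • z) (s • z)) ^ n / √(chartForm σ β α (s • z) (s • z)) ^ 3 *
        ((√(gramForm σ β α (s • z) (ω.1 - s • z)) ^ n)⁻¹ • weightedDot α z (ω.1 - s • z)) with hk
  have hsz : ∀ s ∈ Icc (0 : ℝ) 1, ‖s • z‖ < 1 := by
    intro s hs
    rw [norm_smul, Real.norm_of_nonneg hs.1]
    nlinarith [hs.2, norm_nonneg z, hs.1]
  have hNz : ∀ s ∈ Icc (0 : ℝ) 1, 0 < chartForm σ β α (s • z) (s • z) := fun s hs =>
    chartForm_self_pos hβ hαβ (hsz s hs).le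
  have hNω : ∀ ω : Metric.sphere (0 : EuclideanSpace ℝ (Fin n)) 1,
      0 < chartForm σ β α ω.1 ω.1 := fun ω =>
    chartForm_self_pos hβ hαβ (norm_eq_of_mem_sphere ω).le
  have hne : ∀ s ∈ Icc (0 : ℝ) 1, ∀ ω : Metric.sphere (0 : EuclideanSpace ℝ (Fin n)) 1,
      ω.1 ≠ s • z := by
    intro s hs ω h
    have := hsz s hs
    rw [← h, norm_eq_of_mem_sphere ω] at this
    exact lt_irrefl _ this
  have hderiv : ∀ ω, ∀ s ∈ Icc (0 : ℝ) 1, HasDerivAt (fun s => f s ω) (k s ω) s :=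
    fun ω s hs => hasDerivAt_weighted_kernel hn hU hβ hα (hNz s hs) (hNω ω) (hne s hs ω)
  have hkc : ContinuousOn (fun q : ℝ × Metric.sphere (0 : EuclideanSpace ℝ (Fin n)) 1 => k q.1 q.2)
      (Icc 0 1 ×ˢ univ) := by
    have c1 : Continuous fun q : ℝ × Metric.sphere (0 : EuclideanSpace ℝ (Fin n)) 1 =>
        √(chartForm σ β α (q.1 • z) (q.1 • z)) := by
      refine Real.continuous_sqrt.comp
        ((continuous_chartForm_self σ β α).comp (f := fun q : ℝ × _ => q.1 • z) (by fun_prop))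
    have c2 : Continuous fun q : ℝ × Metric.sphere (0 : EuclideanSpace ℝ (Fin n)) 1 =>
        √(gramForm σ β α (q.1 • z) (q.2.1 - q.1 • z)) :=
      Real.continuous_sqrt.comp ((continuous_gramForm σ β α).comp
        (f := fun q : ℝ × Metric.sphere (0 : EuclideanSpace ℝ (Fin n)) 1 =>
          (q.1 • z, q.2.1 - q.1 • z)) (by fun_prop))
    refine ContinuousOn.mul (ContinuousOn.div
      (continuous_const.mul (c1.pow n)).continuousOn (c1.pow 3).continuousOn ?_)
      (ContinuousOn.smul (ContinuousOn.inv₀ (c2.pow n).continuousOn ?_) ?_)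
    · rintro ⟨s, ω⟩ ⟨hs, -⟩
      exact (pow_pos (Real.sqrt_pos.2 (hNz s hs)) 3).ne'
    · rintro ⟨s, ω⟩ ⟨hs, -⟩
      exact (pow_pos (Real.sqrt_pos.2 (gramForm_pos hU.sign hβ hα (hNz s hs)
        (sub_ne_zero.2 (hne s hs ω)))) n).ne'
    · exact ((weightedDot α z).continuous.comp (by fun_prop)).continuousOn
  have hfc : ∀ s ∈ Icc (0 : ℝ) 1, Continuous (f s) := by
    intro s hs
    have c1 : Continuous fun ω : Metric.sphere (0 : EuclideanSpace ℝ (Fin n)) 1 =>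
        √(chartForm σ β α ω.1 ω.1) :=
      Real.continuous_sqrt.comp ((continuous_chartForm_self σ β α).comp continuous_subtype_val)
    have c2 : Continuous fun ω : Metric.sphere (0 : EuclideanSpace ℝ (Fin n)) 1 =>
        chartForm σ β α (s • z) ω.1 := by
      unfold chartForm
      fun_prop
    refine Continuous.mul (Continuous.inv₀ (by fun_prop) fun ω =>
      (pow_pos (Real.sqrt_pos.2 (hNω ω)) _).ne') ?_
    refine hU.continuousOn.comp_continuous ?_ fun ω =>
      (chartForm_quotient_mem hU.sign hβ hα (hNz s hs) (hNω ω) (hne s hs ω)).2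
    exact c2.div (by fun_prop) fun ω =>
      (mul_pos (Real.sqrt_pos.2 (hNz s hs)) (Real.sqrt_pos.2 (hNω ω))).ne'
  have hfi : ∀ s ∈ Icc (0 : ℝ) 1, Integrable (f s) volume.toSphere := fun s hs =>
    (hfc s hs).integrable_of_hasCompactSupport (HasCompactSupport.of_compactSpace _)
  have hftc : ∀ ω, ∫ s in Icc (0 : ℝ) 1, k s ω = f 1 ω - f 0 ω := by
    intro ω
    rw [integral_Icc_eq_integral_Ioc, ← intervalIntegral.integral_of_le zero_le_one]
    refine intervalIntegral.integral_eq_sub_of_hasDerivAt (f := fun s => f s ω) ?_ ?_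
    · intro s hs
      rw [uIcc_of_le zero_le_one] at hs
      exact hderiv ω s hs
    · refine ContinuousOn.intervalIntegrable ?_
      rw [uIcc_of_le zero_le_one]
      exact hkc.comp (f := fun s : ℝ => (s, ω)) (by fun_prop) fun s hs => ⟨hs, mem_univ _⟩
  have hint : Integrable (Function.uncurry k)
      ((volume.restrict (Icc (0 : ℝ) 1)).prod volume.toSphere) := by
    have := hkc.integrableOn_compact (μ := (volume : Measure ℝ).prod
      (volume : Measure (EuclideanSpace ℝ (Fin n))).toSphere) (isCompact_Icc.prod isCompact_univ)
    rwa [IntegrableOn, ← Measure.prod_restrict, Measure.restrict_univ] at this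
  have hzero : ∫ ω, (f 1 ω - f 0 ω) ∂volume.toSphere = 0 := by
    simp only [← hftc]
    rw [← integral_integral_swap hint]
    refine setIntegral_eq_zero_of_forall_eq_zero fun s hs => ?_
    simp only [hk]
    rw [integral_const_mul,
      integral_gramForm_eq_zero hn hU.sign hβ hα (hNz s hs) (hsz s hs), mul_zero]
  rw [integral_sub (hfi 1 (by simp)) (hfi 0 (by simp)), sub_eq_zero] at hzero
  simp only [hf, one_smul, zero_smul] at hzero
  rw [hzero]
  refine integral_congr_ae (Eventually.of_forall fun ω => ?_)
  have h0 : ∀ w : EuclideanSpace ℝ (Fin n), chartForm σ β α 0 w = β := by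
    intro w; simp [chartForm]
  have hb := Real.sqrt_pos.2 hβ
  have hw := Real.sqrt_pos.2 (hNω ω)
  simp only [h0]
  congr 2
  rw [div_eq_div_iff (by positivity) hw.ne']
  rw [← mul_assoc, Real.mul_self_sqrt hβ.le]

end InteriorPotential

/-! ### Ivory's theorem and the values of the potential -/

section Confocal

variable {n : ℕ}

/-- The value, on the confocal ellipsoid with parameter `l`, of the potential of the homeoidal measure
of the ellipsoid with squared semiaxes `b`, `a`. By Ivory's theorem it is the potential at the centre
of the homeoidal measure of the confocal ellipsoid. -/
noncomputable def levelValue (σ b : ℝ) (a : Fin n → ℝ) (U : ℝ → ℝ) (l : ℝ) : ℝ :=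
  ∫ ω : Metric.sphere (0 : EuclideanSpace ℝ (Fin n)) 1,
    (√(chartForm σ b a ω.1 ω.1) ^ (n - 1))⁻¹ *
      U (√(b + σ * l) / √(chartForm σ b a ω.1 ω.1)) ∂volume.toSphere

/-- Confocal ellipsoids have the same homeoidal density on the unit sphere of the chart. -/
theorem chartForm_confocal_self {σ b l : ℝ} {a : Fin n → ℝ}
    (ω : Metric.sphere (0 : EuclideanSpace ℝ (Fin n)) 1) :
    chartForm σ (b + σ * l) (fun i => a i - l) ω.1 ω.1 = chartForm σ b a ω.1 ω.1 := by
  have h : ∑ i, ω.1 i ^ 2 = 1 := by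
    rw [← EuclideanSpace.real_norm_sq_eq, norm_eq_of_mem_sphere ω, one_pow]
  simp only [chartForm, sub_mul, Finset.sum_sub_distrib]
  have h2 : ∑ i, l * ω.1 i * ω.1 i = l := by
    calc ∑ i, l * ω.1 i * ω.1 i = l * ∑ i, ω.1 i ^ 2 := by
          rw [Finset.mul_sum]
          exact Finset.sum_congr rfl fun i _ => by ring
      _ = l := by rw [h, mul_one]
  rw [h2]
  ring

/-- Ivory's theorem: the potential at a point of a confocal ellipsoid equals the potential of the
homeoidal measure of that confocal ellipsoid at the corresponding point of the original one, which
lies inside. -/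
theorem integral_kernel_confocal (hn : 2 ≤ n) {σ : ℝ} {U : ℝ → ℝ} (hU : IsKernel σ n U) {b l : ℝ}
    {a : Fin n → ℝ} (hb : 0 < b) (ha : ∀ i, 0 < a i) (hab : ∀ i, 0 < b + σ * a i) (hl : l < 0)
    (hbl : 0 < b + σ * l) (η : Metric.sphere (0 : EuclideanSpace ℝ (Fin n)) 1) :
    ∫ ω : Metric.sphere (0 : EuclideanSpace ℝ (Fin n)) 1,
      (√(chartForm σ b a ω.1 ω.1) ^ (n - 1))⁻¹ *
        U ((√(b + σ * l) * √b + σ * ∑ i, √(a i - l) * √(a i) * η.1 i * ω.1 i) /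
          (√(chartForm σ b a η.1 η.1) * √(chartForm σ b a ω.1 ω.1))) ∂volume.toSphere =
    levelValue σ b a U l := by
  have hal : ∀ i, 0 < a i - l := fun i => by linarith [ha i]
  have hsb := Real.sqrt_pos.2 hb
  have hsbl := Real.sqrt_pos.2 hbl
  have hsa : ∀ i, 0 < √(a i) := fun i => Real.sqrt_pos.2 (ha i)
  have hsal : ∀ i, 0 < √(a i - l) := fun i => Real.sqrt_pos.2 (hal i)
  -- the point of the original ellipsoid corresponding to `η`, in the chart of the confocal one
  set z : EuclideanSpace ℝ (Fin n) :=
    WithLp.toLp 2 fun i => √(a i) * η.1 i * √(b + σ * l) / (√b * √(a i - l)) with hz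
  have hzi : ∀ i, z i = √(a i) * η.1 i * √(b + σ * l) / (√b * √(a i - l)) := fun i => rfl
  have hη : ∑ i, η.1 i ^ 2 = 1 := by
    rw [← EuclideanSpace.real_norm_sq_eq, norm_eq_of_mem_sphere η, one_pow]
  have hzsq : ∀ i, z i ^ 2 = a i * (b + σ * l) / (b * (a i - l)) * η.1 i ^ 2 := by
    intro i
    rw [hzi, div_pow, mul_pow, mul_pow, mul_pow, Real.sq_sqrt (ha i).le, Real.sq_sqrt hbl.le,
      Real.sq_sqrt hb.le, Real.sq_sqrt (hal i).le]
    ring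
  have hratio : ∀ i, a i * (b + σ * l) / (b * (a i - l)) < 1 := by
    intro i
    rw [div_lt_one (mul_pos hb (hal i))]
    nlinarith [mul_pos_of_neg_of_neg hl (neg_neg_of_pos (hab i))]
  have hz1 : ‖z‖ < 1 := by
    have : ‖z‖ ^ 2 < 1 := by
      rw [EuclideanSpace.real_norm_sq_eq, ← hη]
      have hex : ∃ i, η.1 i ≠ 0 := by
        by_contra h
        push Not at h
        simp [h] at hη
      obtain ⟨i, hi⟩ := hex
      refine Finset.sum_lt_sum (fun j _ => ?_) ⟨i, Finset.mem_univ _, ?_⟩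
      · rw [hzsq]
        exact mul_le_of_le_one_left (sq_nonneg _) (hratio j).le
      · rw [hzsq]
        exact mul_lt_of_lt_one_left (by positivity) (hratio i)
    nlinarith [norm_nonneg z]
  have key := integral_weighted_kernel_const hn hU hbl hal
    (fun i => by have := hab i; nlinarith) hz1
  simp only [chartForm_confocal_self] at key
  rw [levelValue, ← key]
  refine integral_congr_ae (Eventually.of_forall fun ω => ?_)
  have hNη : 0 < chartForm σ b a η.1 η.1 :=
    chartForm_self_pos hb hab (norm_eq_of_mem_sphere η).le
  have hNω : 0 < chartForm σ b a ω.1 ω.1 :=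
    chartForm_self_pos hb hab (norm_eq_of_mem_sphere ω).le
  have hM : chartForm σ (b + σ * l) (fun i => a i - l) z ω.1 = √(b + σ * l) / √b *
      (√(b + σ * l) * √b + σ * ∑ i, √(a i - l) * √(a i) * η.1 i * ω.1 i) := by
    have e1 : ∀ i, (a i - l) * z i * ω.1 i =
        √(b + σ * l) / √b * (√(a i - l) * √(a i) * η.1 i * ω.1 i) := by
      intro i
      rw [hzi]
      nth_rewrite 1 [← Real.mul_self_sqrt (hal i).le]
      have := hsal i
      field_simp
    rw [chartForm, Finset.sum_congr rfl fun i _ => e1 i, ← Finset.mul_sum]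
    nth_rewrite 1 [← Real.mul_self_sqrt hbl.le]
    field_simp
  have hN : chartForm σ (b + σ * l) (fun i => a i - l) z z =
      (√(b + σ * l) / √b) ^ 2 * chartForm σ b a η.1 η.1 := by
    have e1 : ∀ i, (a i - l) * z i * z i = (b + σ * l) / b * (a i * η.1 i * η.1 i) := by
      intro i
      rw [mul_assoc, ← sq, hzsq]
      have := hal i
      field_simp
    rw [chartForm, Finset.sum_congr rfl fun i _ => e1 i, ← Finset.mul_sum, div_pow,
      Real.sq_sqrt hbl.le, Real.sq_sqrt hb.le, chartForm]
    field_simp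
  have hq : 0 < √(b + σ * l) / √b := div_pos hsbl hsb
  beta_reduce
  rw [hM, hN, Real.sqrt_mul (sq_nonneg _), Real.sqrt_sq hq.le]
  congr 2
  rw [mul_assoc, mul_div_mul_left _ _ hq.ne']

theorem continuous_weight {σ b : ℝ} {a : Fin n → ℝ} (hb : 0 < b) (hab : ∀ i, 0 < b + σ * a i)
    (k : ℕ) :
    Continuous fun ω : Metric.sphere (0 : EuclideanSpace ℝ (Fin n)) 1 =>
      (√(chartForm σ b a ω.1 ω.1) ^ k)⁻¹ := by
  have c1 : Continuous fun ω : Metric.sphere (0 : EuclideanSpace ℝ (Fin n)) 1 =>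
      √(chartForm σ b a ω.1 ω.1) :=
    Real.continuous_sqrt.comp ((continuous_chartForm_self σ b a).comp continuous_subtype_val)
  exact (c1.pow _).inv₀ fun ω => (pow_pos (Real.sqrt_pos.2
    (chartForm_self_pos hb hab (norm_eq_of_mem_sphere ω).le)) _).ne'

theorem levelArgument_mem {σ : ℝ} (hσ : σ = 1 ∨ σ = -1) {b l : ℝ} {a : Fin n → ℝ} (hb : 0 < b)
    (ha : ∀ i, 0 < a i) (hab : ∀ i, 0 < b + σ * a i) (hl : l < 0) (hbl : 0 < b + σ * l)
    (ω : Metric.sphere (0 : EuclideanSpace ℝ (Fin n)) 1) :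
    √(b + σ * l) / √(chartForm σ b a ω.1 ω.1) ∈ kernelDomain σ := by
  have hN := chartForm_self_pos hb hab (norm_eq_of_mem_sphere ω).le
  have hσ2 : σ * σ = 1 := by rcases hσ with h | h <;> simp [h]
  constructor
  · rw [div_pow, Real.sq_sqrt hbl.le, Real.sq_sqrt hN.le]
    have h1 : σ * (1 - (b + σ * l) / chartForm σ b a ω.1 ω.1) =
        (∑ i, a i * ω.1 i * ω.1 i - l) / chartForm σ b a ω.1 ω.1 := by
      rw [eq_div_iff hN.ne', mul_assoc, sub_mul, div_mul_cancel₀ _ hN.ne', chartForm]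
      linear_combination (∑ i, a i * ω.1 i * ω.1 i - l) * hσ2
    rw [h1]
    refine div_pos ?_ hN
    have : 0 ≤ ∑ i, a i * ω.1 i * ω.1 i := Finset.sum_nonneg fun i _ => by
      rw [mul_assoc]; exact mul_nonneg (ha i).le (mul_self_nonneg _)
    linarith
  · have : 0 < √(b + σ * l) / √(chartForm σ b a ω.1 ω.1) :=
      div_pos (Real.sqrt_pos.2 hbl) (Real.sqrt_pos.2 hN)
    linarith

theorem integral_toSphere_lt {f g : Metric.sphere (0 : EuclideanSpace ℝ (Fin n)) 1 → ℝ}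
    (hn : 2 ≤ n) (hf : Continuous f) (hg : Continuous g) (hfg : ∀ ω, f ω < g ω) :
    ∫ ω, f ω ∂(volume : Measure (EuclideanSpace ℝ (Fin n))).toSphere <
      ∫ ω, g ω ∂(volume : Measure (EuclideanSpace ℝ (Fin n))).toSphere := by
  have : Nonempty (Fin n) := ⟨⟨0, by omega⟩⟩
  have hf' : Integrable f (volume : Measure (EuclideanSpace ℝ (Fin n))).toSphere :=
    hf.integrable_of_hasCompactSupport (HasCompactSupport.of_compactSpace _)
  have hg' : Integrable g (volume : Measure (EuclideanSpace ℝ (Fin n))).toSphere :=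
    hg.integrable_of_hasCompactSupport (HasCompactSupport.of_compactSpace _)
  rw [← sub_pos, ← integral_sub hg' hf']
  rw [integral_pos_iff_support_of_nonneg (fun ω => (sub_pos.2 (hfg ω)).le) (hg'.sub hf')]
  have : Function.support (fun ω => g ω - f ω) = univ := by
    ext ω
    simpa using (sub_pos.2 (hfg ω)).ne'
  rw [this, pos_iff_ne_zero, Measure.measure_univ_ne_zero]
  exact Measure.toSphere_ne_zero _

theorem continuous_levelIntegrand {σ : ℝ} {U : ℝ → ℝ} (hU : IsKernel σ n U) {b l : ℝ}
    {a : Fin n → ℝ} (hb : 0 < b) (ha : ∀ i, 0 < a i) (hab : ∀ i, 0 < b + σ * a i) (hl : l < 0)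
    (hbl : 0 < b + σ * l) :
    Continuous fun ω : Metric.sphere (0 : EuclideanSpace ℝ (Fin n)) 1 =>
      (√(chartForm σ b a ω.1 ω.1) ^ (n - 1))⁻¹ *
        U (√(b + σ * l) / √(chartForm σ b a ω.1 ω.1)) := by
  refine (continuous_weight hb hab _).mul (hU.continuousOn.comp_continuous ?_
    (levelArgument_mem hU.sign hb ha hab hl hbl))
  have := (continuous_const (y := √(b + σ * l))).mul (continuous_weight (n := n) hb hab 1)
  simp only [pow_one] at this
  exact this

/-- The potential is strictly monotone in the confocal parameter, as the kernel is monotone in the distance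
from the centre. -/
theorem levelValue_strictMonoOn (hn : 2 ≤ n) {σ : ℝ} {U : ℝ → ℝ} (hU : IsKernel σ n U) {b : ℝ}
    {a : Fin n → ℝ} (hb : 0 < b) (ha : ∀ i, 0 < a i) (hab : ∀ i, 0 < b + σ * a i) :
    StrictMonoOn (levelValue σ b a U) {l | l < 0 ∧ 0 < b + σ * l} := by
  rintro l ⟨hl, hbl⟩ m ⟨hm, hbm⟩ hlm
  refine integral_toSphere_lt hn (continuous_levelIntegrand hU hb ha hab hl hbl)
    (continuous_levelIntegrand hU hb ha hab hm hbm) fun ω => ?_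
  have hN := Real.sqrt_pos.2 (chartForm_self_pos hb hab (norm_eq_of_mem_sphere ω).le)
  refine mul_lt_mul_of_pos_left ?_ (by positivity)
  have h1 := levelArgument_mem hU.sign hb ha hab hl hbl ω
  have h2 := levelArgument_mem hU.sign hb ha hab hm hbm ω
  have hmono := hU.strictMonoOn
  rcases hU.sign with rfl | rfl
  · have := hmono h1 h2 (div_lt_div_of_pos_right
      (Real.sqrt_lt_sqrt hbl.le (by linarith)) hN)
    simpa using this
  · have := hmono h2 h1 (div_lt_div_of_pos_right
      (Real.sqrt_lt_sqrt hbm.le (by linarith)) hN)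
    simpa using this

theorem levelValue_pos (hn : 2 ≤ n) {U : ℝ → ℝ} (hU : IsKernel 1 n U) (hU0 : U 0 = 0) {b l : ℝ}
    {a : Fin n → ℝ} (hb : 0 < b) (ha : ∀ i, 0 < a i) (hl : l < 0) (hbl : 0 < b + l) :
    0 < levelValue 1 b a U l := by
  have hab : ∀ i, 0 < b + 1 * a i := fun i => by linarith [ha i]
  have hbl' : 0 < b + 1 * l := by linarith
  have := integral_toSphere_lt hn (f := fun _ => (0 : ℝ)) continuous_const
    (continuous_levelIntegrand hU hb ha hab hl hbl') fun ω => ?_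
  · simpa [levelValue] using this
  · have hN := Real.sqrt_pos.2 (chartForm_self_pos hb hab (norm_eq_of_mem_sphere ω).le)
    refine mul_pos (by positivity) ?_
    have := hU.strictMonoOn (by simp [kernelDomain] : (0 : ℝ) ∈ kernelDomain 1)
      (levelArgument_mem hU.sign hb ha hab hl hbl' ω) (div_pos (Real.sqrt_pos.2 hbl') hN)
    simpa [hU0] using this

end Confocal

/-! ### Diagonalization of a pair of quadratic forms -/

section Diagonalization

theorem dotProduct_congruence_mulVec {m : Type*} [Fintype m] (Q M : Matrix m m ℝ) (x y : m → ℝ) :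
    x ⬝ᵥ ((Qᵀ * M * Q) *ᵥ y) = (Q *ᵥ x) ⬝ᵥ (M *ᵥ (Q *ᵥ y)) := by
  rw [← Matrix.mulVec_mulVec, ← Matrix.mulVec_mulVec, Matrix.dotProduct_mulVec,
    Matrix.vecMul_transpose]

variable {m : Type*} [Fintype m] [DecidableEq m]

theorem exists_orthogonal_diagonalization {S : Matrix m m ℝ} (hS : Sᵀ = S) :
    ∃ (O : Matrix m m ℝ) (d : m → ℝ), Oᵀ * O = 1 ∧ Oᵀ * S * O = Matrix.diagonal d := by
  have hH : S.IsHermitian := by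
    rwa [Matrix.IsHermitian, Matrix.conjTranspose_eq_transpose_of_trivial]
  refine ⟨hH.eigenvectorUnitary, hH.eigenvalues, ?_, ?_⟩
  · have := Matrix.UnitaryGroup.star_mul_self hH.eigenvectorUnitary
    rwa [Matrix.star_eq_conjTranspose, Matrix.conjTranspose_eq_transpose_of_trivial] at this
  · have := hH.conjStarAlgAut_star_eigenvectorUnitary
    rw [Unitary.conjStarAlgAut_apply] at this
    simpa [Matrix.star_eq_conjTranspose, Matrix.conjTranspose_eq_transpose_of_trivial] using this

theorem exists_simultaneous_diagonalization {D K : Matrix m m ℝ} (hD : D.PosDef) (hK : Kᵀ = K) :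
    ∃ (R : Matrix m m ℝ) (k : m → ℝ), Rᵀ * D * R = 1 ∧ Rᵀ * K * R = Matrix.diagonal k := by
  have hDs : Dᵀ = D := by
    have := hD.isHermitian
    rwa [Matrix.IsHermitian, Matrix.conjTranspose_eq_transpose_of_trivial] at this
  obtain ⟨O, d, hO, hd⟩ := exists_orthogonal_diagonalization hDs
  have hdpos : ∀ i, 0 < d i := by
    intro i
    have h1 : O *ᵥ Pi.single i 1 ≠ 0 := by
      intro h
      have h2 : Oᵀ *ᵥ (O *ᵥ Pi.single i 1) = 0 := by rw [h, Matrix.mulVec_zero]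
      rw [Matrix.mulVec_mulVec, hO, Matrix.one_mulVec] at h2
      have := congrFun h2 i
      simp at this
    have h2 := hD.dotProduct_mulVec_pos h1
    rw [star_trivial, ← dotProduct_congruence_mulVec, hd] at h2
    simpa [Matrix.mulVec_diagonal] using h2
  set B := O * Matrix.diagonal (fun i => (√(d i))⁻¹) with hB
  have hBD : Bᵀ * D * B = 1 := by
    rw [hB, Matrix.transpose_mul, Matrix.diagonal_transpose]
    calc _ = Matrix.diagonal (fun i => (√(d i))⁻¹) * (Oᵀ * D * O) *
          Matrix.diagonal (fun i => (√(d i))⁻¹) := by simp only [Matrix.mul_assoc]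
      _ = 1 := by
          rw [hd, Matrix.diagonal_mul_diagonal, Matrix.diagonal_mul_diagonal, ← Matrix.diagonal_one]
          congr 1
          ext i
          have := Real.sqrt_pos.2 (hdpos i)
          nth_rewrite 2 [← Real.mul_self_sqrt (hdpos i).le]
          field_simp
  have hS : (Bᵀ * K * B)ᵀ = Bᵀ * K * B := by
    simp only [Matrix.transpose_mul, Matrix.transpose_transpose, hK, Matrix.mul_assoc]
  obtain ⟨V, k, hV, hk⟩ := exists_orthogonal_diagonalization hS
  refine ⟨B * V, k, ?_, ?_⟩
  · calc (B * V)ᵀ * D * (B * V) = Vᵀ * (Bᵀ * D * B) * V := by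
          simp only [Matrix.transpose_mul, Matrix.mul_assoc]
      _ = 1 := by rw [hBD, Matrix.mul_one, hV]
  · rw [← hk]
    simp only [Matrix.transpose_mul, Matrix.mul_assoc]

end Diagonalization

/-! ### Forms of signature `(-, +, …, +)` -/

section Signature

variable {n : ℕ}

theorem dotProduct_mink_mulVec (x y : Fin (n + 1) → ℝ) :
    x ⬝ᵥ (mink n *ᵥ y) = -(x 0 * y 0) + ∑ i : Fin n, x i.succ * y i.succ := by
  simp [mink, dotProduct, Matrix.mulVec_diagonal, Fin.sum_univ_succ]

theorem mink_mul_mink : mink n * mink n = 1 := by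
  rw [mink, Matrix.diagonal_mul_diagonal, ← Matrix.diagonal_one]
  congr 1
  ext i
  refine Fin.cases ?_ (fun j => ?_) i <;> simp

theorem IsElliptic.exists_congruence {A : Matrix (Fin (n + 1)) (Fin (n + 1)) ℝ}
    (hA : IsElliptic A) :
    ∃ Q : Matrix (Fin (n + 1)) (Fin (n + 1)) ℝ, IsUnit Q.det ∧ A = Qᵀ * mink n * Q := by
  obtain ⟨P, hP, h⟩ := hA
  refine ⟨P⁻¹, by rwa [Matrix.isUnit_nonsing_inv_det_iff], ?_⟩
  have hPt : IsUnit Pᵀ.det := by rwa [Matrix.det_transpose]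
  rw [← h, Matrix.transpose_nonsing_inv]
  simp only [Matrix.mul_assoc, Matrix.mul_nonsing_inv _ hP, Matrix.mul_one]
  rw [← Matrix.mul_assoc, Matrix.nonsing_inv_mul _ hPt, Matrix.one_mul]

theorem IsElliptic.transpose_eq {A : Matrix (Fin (n + 1)) (Fin (n + 1)) ℝ}
    (hA : IsElliptic A) : Aᵀ = A := by
  obtain ⟨Q, -, rfl⟩ := hA.exists_congruence
  simp [Matrix.transpose_mul, Matrix.mul_assoc, mink]

theorem isElliptic_mink : IsElliptic (mink n) :=
  ⟨1, by simp, by simp⟩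

theorem mulVec_ne_zero_of_isUnit_det {Q : Matrix (Fin (n + 1)) (Fin (n + 1)) ℝ}
    (hQ : IsUnit Q.det) {w : Fin (n + 1) → ℝ} (hw : w ≠ 0) : Q *ᵥ w ≠ 0 := by
  intro h
  apply hw
  rw [← Matrix.one_mulVec w, ← Matrix.nonsing_inv_mul Q hQ, ← Matrix.mulVec_mulVec, h,
    Matrix.mulVec_zero]

/-- A form of signature `(-, +, …, +)` takes a positive value on every coordinate plane. -/
theorem exists_supported_pos {Q : Matrix (Fin (n + 1)) (Fin (n + 1)) ℝ} (hQ : IsUnit Q.det)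
    {i j : Fin (n + 1)} (hij : i ≠ j) :
    ∃ w : Fin (n + 1) → ℝ, (∀ k, k ≠ i → k ≠ j → w k = 0) ∧
      0 < w ⬝ᵥ ((Qᵀ * mink n * Q) *ᵥ w) := by
  have key : ∃ w : Fin (n + 1) → ℝ, (∀ k, k ≠ i → k ≠ j → w k = 0) ∧ w ≠ 0 ∧ (Q *ᵥ w) 0 = 0 := by
    by_cases h : Q 0 i = 0
    · refine ⟨Pi.single i 1, fun k hk _ => by simp [hk], ?_, ?_⟩
      · intro h'
        have := congrFun h' i
        simp at this
      · simp [h]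
    · refine ⟨Pi.single i (-Q 0 j) + Pi.single j (Q 0 i), fun k hk hk' => by simp [hk, hk'], ?_, ?_⟩
      · intro h'
        have := congrFun h' j
        simp [hij.symm, h] at this
      · rw [Matrix.mulVec_add]
        simp
        ring
  obtain ⟨w, hw, hw0, hQw⟩ := key
  refine ⟨w, hw, ?_⟩
  rw [dotProduct_congruence_mulVec, dotProduct_mink_mulVec, hQw]
  have hne := mulVec_ne_zero_of_isUnit_det hQ hw0
  have : ∃ l : Fin n, (Q *ᵥ w) l.succ ≠ 0 := by
    by_contra hcon
    push Not at hcon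
    exact hne (funext fun l => Fin.cases hQw hcon l)
  obtain ⟨l, hl⟩ := this
  have : 0 < ∑ i : Fin n, (Q *ᵥ w) i.succ * (Q *ᵥ w) i.succ :=
    Finset.sum_pos' (fun _ _ => mul_self_nonneg _) ⟨l, Finset.mem_univ _, mul_self_pos.2 hl⟩
  linarith

/-- Sylvester's law of inertia for a diagonal form of signature `(-, +, …, +)`. -/
theorem exists_unique_neg_of_diagonal {Q : Matrix (Fin (n + 1)) (Fin (n + 1)) ℝ}
    (hQ : IsUnit Q.det) {k : Fin (n + 1) → ℝ} (h : Matrix.diagonal k = Qᵀ * mink n * Q) :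
    ∃ i, k i < 0 ∧ ∀ j, j ≠ i → 0 < k j := by
  have hquad : ∀ x : Fin (n + 1) → ℝ, x ⬝ᵥ ((Qᵀ * mink n * Q) *ᵥ x) = ∑ i, k i * x i ^ 2 := by
    intro x
    rw [← h]
    simp only [dotProduct, Matrix.mulVec_diagonal]
    exact Finset.sum_congr rfl fun i _ => by ring
  have hne : ∀ i, k i ≠ 0 := by
    have hdet : IsUnit (Matrix.diagonal k).det := by
      rw [h, Matrix.det_mul, Matrix.det_mul, Matrix.det_transpose]
      have : IsUnit (mink n).det := (Matrix.isUnit_iff_isUnit_det _).1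
        (IsUnit.of_mul_eq_one _ mink_mul_mink)
      exact (hQ.mul this).mul hQ
    rw [Matrix.det_diagonal, isUnit_iff_ne_zero, Finset.prod_ne_zero_iff] at hdet
    exact fun i => hdet i (Finset.mem_univ i)
  have hexists : ∃ i, k i < 0 := by
    by_contra hcon
    push Not at hcon
    have h1 := hquad (Q⁻¹ *ᵥ Pi.single 0 1)
    rw [dotProduct_congruence_mulVec, Matrix.mulVec_mulVec, Matrix.mul_nonsing_inv _ hQ,
      Matrix.one_mulVec, dotProduct_mink_mulVec] at h1
    simp at h1
    have h2 : 0 ≤ ∑ i, k i * (Q⁻¹ *ᵥ Pi.single 0 1) i ^ 2 :=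
      Finset.sum_nonneg fun i _ => mul_nonneg (hcon i) (sq_nonneg _)
    simp at h2
    linarith
  obtain ⟨i, hi⟩ := hexists
  refine ⟨i, hi, fun j hj => ?_⟩
  by_contra hcon
  obtain ⟨w, hw, hpos⟩ := exists_supported_pos hQ hj.symm
  rw [hquad] at hpos
  have : ∑ l, k l * w l ^ 2 ≤ 0 := by
    refine Finset.sum_nonpos fun l _ => ?_
    by_cases h1 : l = i
    · subst h1
      exact mul_nonpos_of_nonpos_of_nonneg hi.le (sq_nonneg _)
    by_cases h2 : l = j
    · subst h2
      exact mul_nonpos_of_nonpos_of_nonneg (not_lt.1 hcon) (sq_nonneg _)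
    simp [hw l h1 h2]
  linarith

theorem exists_diagonalization_of_isElliptic {D K : Matrix (Fin (n + 1)) (Fin (n + 1)) ℝ}
    (hD : D.PosDef) (hK : IsElliptic K) :
    ∃ (R : Matrix (Fin (n + 1)) (Fin (n + 1)) ℝ) (k : Fin (n + 1) → ℝ),
      Rᵀ * D * R = 1 ∧ Rᵀ * K * R = Matrix.diagonal k ∧ k 0 < 0 ∧ ∀ i : Fin n, 0 < k i.succ := by
  obtain ⟨R, k, hRD, hRK⟩ := exists_simultaneous_diagonalization hD hK.transpose_eq
  obtain ⟨Q, hQ, rfl⟩ := hK.exists_congruence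
  have hR : IsUnit R.det := by
    have := congrArg Matrix.det hRD
    rw [Matrix.det_mul, Matrix.det_one] at this
    exact IsUnit.of_mul_eq_one_right _ this
  obtain ⟨i, hi, hpos⟩ := exists_unique_neg_of_diagonal (Q := Q * R) (k := k)
    (by rw [Matrix.det_mul]; exact hQ.mul hR)
    (by rw [← hRK]; simp only [Matrix.transpose_mul, Matrix.mul_assoc])
  -- move the negative entry to the first place
  set e := Equiv.swap 0 i
  have hsub : ∀ M : Matrix (Fin (n + 1)) (Fin (n + 1)) ℝ,
      (R.submatrix id e)ᵀ * M * R.submatrix id e = (Rᵀ * M * R).submatrix e e := by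
    intro M
    ext a b
    simp [Matrix.mul_apply, Matrix.submatrix_apply]
  refine ⟨R.submatrix id e, k ∘ e, ?_, ?_, ?_, ?_⟩
  · rw [hsub, hRD, Matrix.submatrix_one_equiv]
  · rw [hsub, hRK, Matrix.submatrix_diagonal_equiv]
  · simpa [e] using hi
  · intro j
    refine hpos _ fun h => ?_
    have h2 : e j.succ = e 0 := by rw [h]; simp [e]
    exact Fin.succ_ne_zero j (e.injective h2)

end Signature

/-! ### Principal bases -/

section AdaptedBasis

variable {n : ℕ}

/-- If the Minkowski form is negative on the null cone of `A`, then, by compactness, it is negative there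
by a uniform margin. -/
theorem exists_uniform_cone_bound {A : Matrix (Fin (n + 1)) (Fin (n + 1)) ℝ}
    (hcone : ∀ x : Fin (n + 1) → ℝ, x ≠ 0 → x ⬝ᵥ (A *ᵥ x) = 0 → x ⬝ᵥ (mink n *ᵥ x) < 0) :
    ∃ δ > 0, ∀ x : Fin (n + 1) → ℝ, x ⬝ᵥ (A *ᵥ x) = 0 → x ⬝ᵥ (mink n *ᵥ x) ≤ -(δ * (x ⬝ᵥ x)) := by
  set K : Set (Fin (n + 1) → ℝ) := {x | x ⬝ᵥ x = 1 ∧ x ⬝ᵥ (A *ᵥ x) = 0}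
  have hcA : ∀ M : Matrix (Fin (n + 1)) (Fin (n + 1)) ℝ,
      Continuous fun x : Fin (n + 1) → ℝ => x ⬝ᵥ (M *ᵥ x) := fun M => by fun_prop
  have hK : IsCompact K := by
    refine Metric.isCompact_of_isClosed_isBounded ?_ ?_
    · exact (isClosed_eq (by fun_prop) continuous_const).inter
        (isClosed_eq (hcA A) continuous_const)
    · refine (Metric.isBounded_closedBall (x := (0 : Fin (n + 1) → ℝ)) (r := 1)).subset
        fun x hx => ?_
      rw [mem_closedBall_zero_iff, pi_norm_le_iff_of_nonneg zero_le_one]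
      intro i
      have h1 : x i * x i ≤ x ⬝ᵥ x :=
        Finset.single_le_sum (f := fun i => x i * x i) (fun j _ => mul_self_nonneg _)
          (Finset.mem_univ i)
      rw [hx.1] at h1
      rw [Real.norm_eq_abs, abs_le]
      constructor <;> nlinarith
  have hbound : ∃ δ > 0, ∀ x ∈ K, x ⬝ᵥ (mink n *ᵥ x) ≤ -δ := by
    by_cases hne : K.Nonempty
    · obtain ⟨x, hx, hmax⟩ := hK.exists_isMaxOn hne (hcA (mink n)).continuousOn
      have hx0 : x ≠ 0 := by
        rintro rfl
        simpa using hx.1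
      exact ⟨-(x ⬝ᵥ (mink n *ᵥ x)), neg_pos.2 (hcone x hx0 hx.2), fun y hy => by
        rw [neg_neg]; exact hmax hy⟩
    · rw [not_nonempty_iff_eq_empty] at hne
      exact ⟨1, one_pos, fun x hx => by simp [hne] at hx⟩
  obtain ⟨δ, hδ, hb⟩ := hbound
  refine ⟨δ, hδ, fun x hx => ?_⟩
  by_cases h0 : x = 0
  · simp [h0]
  have hpos : 0 < x ⬝ᵥ x := by
    have := Matrix.dotProduct_star_self_pos_iff.2 h0
    simpa using this
  have hs := Real.sqrt_pos.2 hpos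
  have hsq := Real.mul_self_sqrt hpos.le
  have h1 := hb ((√(x ⬝ᵥ x))⁻¹ • x) ⟨by
    rw [smul_dotProduct, dotProduct_smul, smul_eq_mul, smul_eq_mul]
    nth_rewrite 3 [← hsq]
    field_simp, by
    rw [Matrix.mulVec_smul, smul_dotProduct, dotProduct_smul, hx]; simp⟩
  rw [Matrix.mulVec_smul, smul_dotProduct, dotProduct_smul, smul_eq_mul, smul_eq_mul] at h1
  have h2 := mul_le_mul_of_nonneg_left h1 hpos.le
  nth_rewrite 1 [← hsq] at h2
  have h3 : √(x ⬝ᵥ x) * √(x ⬝ᵥ x) * ((√(x ⬝ᵥ x))⁻¹ * ((√(x ⬝ᵥ x))⁻¹ * x ⬝ᵥ mink n *ᵥ x)) =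
    x ⬝ᵥ mink n *ᵥ x := by field_simp
  rw [h3] at h2
  linarith

theorem quadratic_add_smul {M : Matrix (Fin (n + 1)) (Fin (n + 1)) ℝ} (hM : Mᵀ = M)
    (r : ℝ) (y z : Fin (n + 1) → ℝ) :
    (r • y + z) ⬝ᵥ (M *ᵥ (r • y + z)) =
      r ^ 2 * (y ⬝ᵥ (M *ᵥ y)) + 2 * r * (y ⬝ᵥ (M *ᵥ z)) + z ⬝ᵥ (M *ᵥ z) := by
  have h : z ⬝ᵥ (M *ᵥ y) = y ⬝ᵥ (M *ᵥ z) := by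
    rw [Matrix.dotProduct_mulVec, ← Matrix.mulVec_transpose, hM, dotProduct_comm]
  rw [Matrix.mulVec_add, Matrix.mulVec_smul]
  simp only [add_dotProduct, dotProduct_add, smul_dotProduct, dotProduct_smul, smul_eq_mul, h]
  ring

/-- If `S` is nonnegative on the null cone of `A`, then its values at a unit positive and a unit
negative vector of `A` have a nonnegative sum: the plane they span contains two null vectors of `A`,
a suitable combination of whose `S`-values is this sum. -/
theorem add_nonneg_of_nonneg_on_cone {A S : Matrix (Fin (n + 1)) (Fin (n + 1)) ℝ} (hA : Aᵀ = A)
    (hS : Sᵀ = S) (hcone : ∀ x : Fin (n + 1) → ℝ, x ⬝ᵥ (A *ᵥ x) = 0 → 0 ≤ x ⬝ᵥ (S *ᵥ x))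
    {y z : Fin (n + 1) → ℝ} (hy : y ⬝ᵥ (A *ᵥ y) = 1) (hz : z ⬝ᵥ (A *ᵥ z) = -1) :
    0 ≤ y ⬝ᵥ (S *ᵥ y) + z ⬝ᵥ (S *ᵥ z) := by
  set c := y ⬝ᵥ (A *ᵥ z)
  set w := √(c ^ 2 + 1)
  have hw : w ^ 2 = c ^ 2 + 1 := Real.sq_sqrt (by positivity)
  have hw0 : 0 < w := Real.sqrt_pos.2 (by positivity)
  have hcw : |c| < w := Real.lt_sqrt_of_sq_lt (by rw [sq_abs]; linarith)
  obtain ⟨hc1, hc2⟩ := abs_lt.1 hcw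
  have h1 := hcone ((-c + w) • y + z) (by
    rw [quadratic_add_smul hA, hy, hz]; change _ + 2 * _ * c + _ = _; nlinarith)
  have h2 := hcone ((-c - w) • y + z) (by
    rw [quadratic_add_smul hA, hy, hz]; change _ + 2 * _ * c + _ = _; nlinarith)
  rw [quadratic_add_smul hS] at h1 h2
  have h3 := mul_nonneg (show 0 ≤ c + w by linarith) h1
  have h4 := mul_nonneg (show 0 ≤ -c + w by linarith) h2
  have h5 : (c + w) * ((-c + w) ^ 2 * y ⬝ᵥ S *ᵥ y + 2 * (-c + w) * y ⬝ᵥ S *ᵥ z + z ⬝ᵥ S *ᵥ z) +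
      (-c + w) * ((-c - w) ^ 2 * y ⬝ᵥ S *ᵥ y + 2 * (-c - w) * y ⬝ᵥ S *ᵥ z + z ⬝ᵥ S *ᵥ z) =
      2 * w * (y ⬝ᵥ (S *ᵥ y) + z ⬝ᵥ (S *ᵥ z)) := by
    linear_combination (2 * w * y ⬝ᵥ S *ᵥ y) * hw
  have h6 : 0 ≤ 2 * w * (y ⬝ᵥ (S *ᵥ y) + z ⬝ᵥ (S *ᵥ z)) := by
    rw [← h5]; exact add_nonneg h3 h4
  exact nonneg_of_mul_nonneg_right h6 (by positivity)

theorem smul_quadratic (M : Matrix (Fin (n + 1)) (Fin (n + 1)) ℝ) (r : ℝ)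
    (x : Fin (n + 1) → ℝ) : (r • x) ⬝ᵥ (M *ᵥ (r • x)) = r ^ 2 * (x ⬝ᵥ (M *ᵥ x)) := by
  rw [Matrix.mulVec_smul, smul_dotProduct, dotProduct_smul, smul_eq_mul, smul_eq_mul]
  ring

/-- If the null cone of `A` lies inside the light cone, then the pencil spanned by `A` and the
Minkowski form contains a positive definite form. -/
theorem exists_posDef_pencil (hn : 2 ≤ n) {A : Matrix (Fin (n + 1)) (Fin (n + 1)) ℝ}
    (hA : IsElliptic A)
    (hcone : ∀ x : Fin (n + 1) → ℝ, x ≠ 0 → x ⬝ᵥ (A *ᵥ x) = 0 → x ⬝ᵥ (mink n *ᵥ x) < 0) :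
    ∃ μ : ℝ, 0 < μ ∧ (μ • A - mink n).PosDef := by
  -- with `S = -J - δ` still nonnegative on the null cone of `A`, it suffices to find `μ` such that
  -- `S + μ A` is positive semidefinite; `μ` is the infimum of `S` over the vectors with `A`-value `-1`
  obtain ⟨δ, hδ, hbound⟩ := exists_uniform_cone_bound hcone
  have hAt := hA.transpose_eq
  obtain ⟨Q, hQ, hAQ⟩ := hA.exists_congruence
  have hJt := (isElliptic_mink (n := n)).transpose_eq
  set S := -mink n - δ • (1 : Matrix (Fin (n + 1)) (Fin (n + 1)) ℝ) with hS
  have hSt : Sᵀ = S := by simp [hS, hJt]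
  have hSx : ∀ x : Fin (n + 1) → ℝ, x ⬝ᵥ (S *ᵥ x) = -(x ⬝ᵥ (mink n *ᵥ x)) - δ * (x ⬝ᵥ x) := by
    intro x
    simp [hS, Matrix.sub_mulVec, Matrix.neg_mulVec, Matrix.smul_mulVec]
  have hScone : ∀ x : Fin (n + 1) → ℝ, x ⬝ᵥ (A *ᵥ x) = 0 → 0 ≤ x ⬝ᵥ (S *ᵥ x) := by
    intro x hx
    rw [hSx]
    linarith [hbound x hx]
  have hval : ∀ i j : Fin (n + 1), (Q⁻¹ *ᵥ Pi.single i 1) ⬝ᵥ (A *ᵥ (Q⁻¹ *ᵥ Pi.single j 1)) =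
      mink n i j := by
    intro i j
    have hv : ∀ v, Q *ᵥ (Q⁻¹ *ᵥ v) = v := fun v => by
      rw [Matrix.mulVec_mulVec, Matrix.mul_nonsing_inv _ hQ, Matrix.one_mulVec]
    rw [hAQ, dotProduct_congruence_mulVec, hv, hv]
    simp
  obtain ⟨i1, i2, h01, h02, h12⟩ : ∃ i1 i2 : Fin (n + 1), i1 ≠ 0 ∧ i2 ≠ 0 ∧ i1 ≠ i2 := by
    refine ⟨⟨1, by omega⟩, ⟨2, by omega⟩, ?_, ?_, ?_⟩ <;> simp [Fin.ext_iff]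
  set T : Set ℝ := {s | ∃ z : Fin (n + 1) → ℝ, z ⬝ᵥ (A *ᵥ z) = -1 ∧ s = z ⬝ᵥ (S *ᵥ z)}
  have hTne : T.Nonempty := ⟨_, Q⁻¹ *ᵥ Pi.single 0 1, by rw [hval]; simp [mink], rfl⟩
  have hTb : ∀ y : Fin (n + 1) → ℝ, y ⬝ᵥ (A *ᵥ y) = 1 → ∀ s ∈ T, -(y ⬝ᵥ (S *ᵥ y)) ≤ s := by
    rintro y hy _ ⟨z, hz, rfl⟩
    linarith [add_nonneg_of_nonneg_on_cone hAt hSt hScone hy hz]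
  have hTbdd : BddBelow T := by
    refine ⟨_, fun s hs => hTb (Q⁻¹ *ᵥ Pi.single i1 1) ?_ s hs⟩
    rw [hval]
    obtain ⟨j, rfl⟩ := Fin.exists_succ_eq.2 h01
    simp [mink]
  set μ := sInf T
  have hnonneg : ∀ x : Fin (n + 1) → ℝ, 0 ≤ x ⬝ᵥ (S *ᵥ x) + μ * (x ⬝ᵥ (A *ᵥ x)) := by
    intro x
    rcases lt_trichotomy (x ⬝ᵥ (A *ᵥ x)) 0 with h | h | h
    · set t := -(x ⬝ᵥ (A *ᵥ x)) with ht
      have ht0 : 0 < t := by linarith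
      have hinv : ((√t)⁻¹) ^ 2 = t⁻¹ := by rw [inv_pow, Real.sq_sqrt ht0.le]
      have h1 : μ ≤ ((√t)⁻¹ • x) ⬝ᵥ (S *ᵥ ((√t)⁻¹ • x)) := by
        refine csInf_le hTbdd ⟨_, ?_, rfl⟩
        rw [smul_quadratic, hinv, show x ⬝ᵥ (A *ᵥ x) = -t by rw [ht]; ring]
        field_simp
      rw [smul_quadratic, hinv, inv_mul_eq_div, le_div_iff₀ ht0] at h1
      linarith
    · rw [h, mul_zero, add_zero]
      exact hScone x h
    · set t := x ⬝ᵥ (A *ᵥ x) with ht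
      have hinv : ((√t)⁻¹) ^ 2 = t⁻¹ := by rw [inv_pow, Real.sq_sqrt h.le]
      have h1 : -(((√t)⁻¹ • x) ⬝ᵥ (S *ᵥ ((√t)⁻¹ • x))) ≤ μ := by
        refine le_csInf hTne (hTb _ ?_)
        rw [smul_quadratic, hinv, ← ht]
        field_simp
      rw [smul_quadratic, hinv, inv_mul_eq_div, neg_le, le_div_iff₀ h] at h1
      linarith
  have hpos : ∀ x : Fin (n + 1) → ℝ, x ≠ 0 →
      x ⬝ᵥ (mink n *ᵥ x) < μ * (x ⬝ᵥ (A *ᵥ x)) := by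
    intro x hx
    have h1 := hnonneg x
    rw [hSx] at h1
    have h2 : 0 < x ⬝ᵥ x := by
      have := Matrix.dotProduct_star_self_pos_iff.2 hx
      simpa using this
    nlinarith [mul_pos hδ h2]
  refine ⟨μ, ?_, Matrix.PosDef.of_dotProduct_mulVec_pos ?_ fun x hx => ?_⟩
  · -- some spacelike vector is positive for `A`
    obtain ⟨w, hw, hwpos⟩ := exists_supported_pos hQ h12
    rw [← hAQ] at hwpos
    have hw0 : w ≠ 0 := by
      rintro rfl
      simp at hwpos
    have h1 := hpos w hw0
    have h2 : 0 ≤ w ⬝ᵥ (mink n *ᵥ w) := by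
      rw [dotProduct_mink_mulVec, hw 0 h01.symm h02.symm]
      have : 0 ≤ ∑ i : Fin n, w i.succ * w i.succ := Finset.sum_nonneg fun _ _ => mul_self_nonneg _
      linarith
    exact pos_of_mul_pos_left (h2.trans_lt h1) hwpos.le
  · rw [Matrix.IsHermitian, Matrix.conjTranspose_eq_transpose_of_trivial]
    simp [hAt, hJt]
  · rw [star_trivial, Matrix.sub_mulVec, Matrix.smul_mulVec, dotProduct_sub, dotProduct_smul,
      smul_eq_mul]
    linarith [hpos x hx]

/-- The matrix `diag(σ, 1, …, 1)` of the ambient form of the space form of curvature `σ = ±1`. -/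
def formMatrix (σ : ℝ) (n : ℕ) : Matrix (Fin (n + 1)) (Fin (n + 1)) ℝ :=
  Matrix.diagonal (Fin.cons σ fun _ => 1)

theorem formMatrix_one (n : ℕ) : formMatrix 1 n = 1 := by
  rw [formMatrix, ← Matrix.diagonal_one]
  congr 1
  ext i
  refine Fin.cases ?_ (fun j => ?_) i <;> simp

theorem formMatrix_neg_one (n : ℕ) : formMatrix (-1) n = mink n := rfl

/-- The columns of `R` are a basis which is orthonormal for the ambient form, and in which the form
with matrix `A` becomes `∑ yᵢ² / aᵢ - y₀² / b`. The condition `0 < b + σ aᵢ` says that the ellipsoid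
lies in the space form; it is automatic for `σ = 1`. -/
structure IsPrincipalBasis (σ b : ℝ) (a : Fin n → ℝ)
    (A R : Matrix (Fin (n + 1)) (Fin (n + 1)) ℝ) : Prop where
  sign : σ = 1 ∨ σ = -1
  b_pos : 0 < b
  a_pos : ∀ i, 0 < a i
  add_pos : ∀ i, 0 < b + σ * a i
  form : Rᵀ * formMatrix σ n * R = formMatrix σ n
  quadric : Rᵀ * A * R = Matrix.diagonal (Fin.cons (-(1 / b)) fun i => 1 / a i)

theorem congruence_mul_diagonal {R M : Matrix (Fin (n + 1)) (Fin (n + 1)) ℝ}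
    {d : Fin (n + 1) → ℝ} (h : Rᵀ * M * R = Matrix.diagonal d) (s : Fin (n + 1) → ℝ) :
    (R * Matrix.diagonal s)ᵀ * M * (R * Matrix.diagonal s) =
      Matrix.diagonal fun i => s i ^ 2 * d i := by
  calc _ = Matrix.diagonal s * (Rᵀ * M * R) * Matrix.diagonal s := by
        simp only [Matrix.transpose_mul, Matrix.diagonal_transpose, Matrix.mul_assoc]
    _ = _ := by
        rw [h, Matrix.diagonal_mul_diagonal, Matrix.diagonal_mul_diagonal]
        congr 1
        ext i
        ring

theorem exists_principalBasis_sphere {A : Matrix (Fin (n + 1)) (Fin (n + 1)) ℝ}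
    (hA : IsElliptic A) {e : Amb n} {b : ℝ} (he : ‖e‖ = 1) (hb : 0 < b)
    (hAe : A *ᵥ e.ofLp = -(1 / b) • e.ofLp) :
    ∃ R a, IsPrincipalBasis 1 b a A R ∧ R *ᵥ Pi.single 0 1 = e.ofLp := by
  obtain ⟨R, k, hR1, hRA, hk0, hk⟩ := exists_diagonalization_of_isElliptic Matrix.PosDef.one hA
  rw [Matrix.mul_one] at hR1
  have hR2 : R * Rᵀ = 1 := mul_eq_one_comm.1 hR1
  set y := Rᵀ *ᵥ e.ofLp with hy
  have hRy : R *ᵥ y = e.ofLp := by rw [hy, Matrix.mulVec_mulVec, hR2, Matrix.one_mulVec]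
  have heig : ∀ i, k i * y i = -(1 / b) * y i := by
    intro i
    have h1 : Matrix.diagonal k *ᵥ y = -(1 / b) • y := by
      rw [← hRA, ← Matrix.mulVec_mulVec, hRy, ← Matrix.mulVec_mulVec, hAe, Matrix.mulVec_smul]
    have := congrFun h1 i
    simpa [Matrix.mulVec_diagonal] using this
  have hbinv : 0 < 1 / b := by positivity
  have hysucc : ∀ i : Fin n, y i.succ = 0 := by
    intro i
    have h1 := heig i.succ
    have h2 : (k i.succ + 1 / b) * y i.succ = 0 := by linarith
    exact (mul_eq_zero.1 h2).resolve_left (by linarith [hk i])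
  have hy0 : y 0 ^ 2 = 1 := by
    have h1 : y ⬝ᵥ y = 1 := by
      have h2 : e.ofLp ⬝ᵥ e.ofLp = 1 := by
        have h3 := EuclideanSpace.real_norm_sq_eq e
        rw [he] at h3
        simp only [dotProduct, ← sq]
        linarith
      rw [hy, Matrix.dotProduct_mulVec, Matrix.vecMul_transpose, Matrix.mulVec_mulVec, hR2,
        Matrix.one_mulVec, h2]
    rw [dotProduct, Fin.sum_univ_succ] at h1
    simp only [hysucc, mul_zero, Finset.sum_const_zero, add_zero] at h1
    rw [sq, h1]
  have hk0b : k 0 = -(1 / b) := by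
    have h1 := heig 0
    exact mul_right_cancel₀ (fun h => by simp [h] at hy0) h1
  -- change the sign of the first column so that it becomes `e`
  set s : Fin (n + 1) → ℝ := Fin.cons (y 0) fun _ => 1 with hs
  have hs2 : ∀ i, s i ^ 2 = 1 := fun i => Fin.cases (by simpa [hs] using hy0) (by simp [hs]) i
  have hform : Rᵀ * 1 * R = Matrix.diagonal fun _ => (1 : ℝ) := by
    rw [Matrix.mul_one, hR1, ← Matrix.diagonal_one]
  refine ⟨R * Matrix.diagonal s, fun i => (k i.succ)⁻¹, ⟨Or.inl rfl, hb,
    fun i => inv_pos.2 (hk i), fun i => ?_, ?_, ?_⟩, ?_⟩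
  · have := inv_pos.2 (hk i)
    linarith
  · rw [formMatrix_one, congruence_mul_diagonal hform, ← Matrix.diagonal_one]
    congr 1
    ext i
    rw [hs2, one_mul]
  · rw [congruence_mul_diagonal hRA]
    congr 1
    ext i
    rw [hs2, one_mul]
    refine Fin.cases ?_ (fun j => ?_) i
    · simpa using hk0b
    · simp
  · rw [← Matrix.mulVec_mulVec, ← hRy]
    congr 1
    ext i
    rw [Matrix.mulVec_diagonal]
    refine Fin.cases ?_ (fun j => ?_) i
    · simp [hs]
    · simp [hysucc]

/-- A principal basis in the hyperbolic case, from the simultaneous diagonalization of a positive definite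
form of the pencil and the Minkowski form. -/
theorem exists_principalBasis_hyperbolic (hn : 2 ≤ n)
    {A : Matrix (Fin (n + 1)) (Fin (n + 1)) ℝ} (hA : IsElliptic A)
    (hcone : ∀ x : Amb n, x ≠ 0 → qf A x = 0 → qf (mink n) x < 0) :
    ∃ R a b, IsPrincipalBasis (-1) b a A R ∧ 0 < R 0 0 := by
  obtain ⟨μ, hμ, hpd⟩ := exists_posDef_pencil hn hA (fun x hx h => hcone (WithLp.toLp 2 x)
    (by simpa using hx) h)
  obtain ⟨R, k, hR1, hRJ, hk0, hk⟩ := exists_diagonalization_of_isElliptic hpd isElliptic_mink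
  have hRA : Rᵀ * A * R = Matrix.diagonal fun i => (1 + k i) / μ := by
    have h1 : Rᵀ * (μ • A - mink n) * R = μ • (Rᵀ * A * R) - Rᵀ * mink n * R := by
      simp [Matrix.mul_sub, Matrix.sub_mul]
    rw [hR1, hRJ, eq_sub_iff_add_eq] at h1
    have h2 : Rᵀ * A * R = μ⁻¹ • (1 + Matrix.diagonal k) := by
      rw [h1, smul_smul, inv_mul_cancel₀ hμ.ne', one_smul]
    rw [h2, ← Matrix.diagonal_one, Matrix.diagonal_add, ← Matrix.diagonal_smul]
    congr 1
    ext i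
    simp [div_eq_inv_mul]
  have hR : IsUnit R.det := by
    have := congrArg Matrix.det hR1
    rw [Matrix.det_mul, Matrix.det_one] at this
    exact IsUnit.of_mul_eq_one_right _ this
  have hk1 : 1 + k 0 < 0 := by
    obtain ⟨Q, hQ, hAQ⟩ := hA.exists_congruence
    have hQR : IsUnit (Q * R).det := by rw [Matrix.det_mul]; exact hQ.mul hR
    obtain ⟨i, hi, -⟩ := exists_unique_neg_of_diagonal (Q := Q * R)
      (k := fun i => (1 + k i) / μ) hQR
      (by rw [← hRA, hAQ]; simp only [Matrix.transpose_mul, Matrix.mul_assoc])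
    have hi' : 1 + k i < 0 := by
      by_contra h
      exact absurd hi (not_lt.2 (div_nonneg (not_lt.1 h) hμ.le))
    by_cases h0 : i = 0
    · rwa [h0] at hi'
    · obtain ⟨j, rfl⟩ := Fin.exists_succ_eq.2 h0
      linarith [hk j]
  have hcol : R 0 0 ≠ 0 := by
    intro h
    have h1 : (Rᵀ * mink n * R) 0 0 = k 0 := by rw [hRJ]; simp
    have h2 : (Rᵀ * mink n * R) 0 0 = ∑ i : Fin n, R i.succ 0 * R i.succ 0 := by
      have h3 := dotProduct_congruence_mulVec R (mink n) (Pi.single 0 1) (Pi.single 0 1)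
      rw [dotProduct_mink_mulVec] at h3
      simpa [h] using h3
    have h4 : 0 ≤ ∑ i : Fin n, R i.succ 0 * R i.succ 0 :=
      Finset.sum_nonneg fun _ _ => mul_self_nonneg _
    linarith
  have hkabs : ∀ i, 0 < |k i| := fun i => by
    refine abs_pos.2 (Fin.cases hk0.ne (fun j => (hk j).ne') i)
  -- the sign `ε` makes the first basis vector future-directed
  obtain ⟨ε, hε2, hεR⟩ : ∃ ε : ℝ, ε ^ 2 = 1 ∧ 0 < R 0 0 * ε := by
    rcases lt_or_gt_of_ne hcol with h | h
    · exact ⟨-1, by norm_num, by linarith⟩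
    · exact ⟨1, by norm_num, by linarith⟩
  set s : Fin (n + 1) → ℝ := fun i => ε * (√|k i|)⁻¹ with hs
  have hs2 : ∀ i, s i ^ 2 = |k i|⁻¹ := by
    intro i
    rw [hs, mul_pow, hε2, one_mul, inv_pow, Real.sq_sqrt (hkabs i).le]
  refine ⟨R * Matrix.diagonal s, fun i => μ * k i.succ / (1 + k i.succ),
    μ * k 0 / (1 + k 0), ⟨Or.inr rfl, ?_, fun i => ?_, fun i => ?_, ?_, ?_⟩, ?_⟩
  · exact div_pos_of_neg_of_neg (mul_neg_of_pos_of_neg hμ hk0) hk1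
  · have := hk i
    positivity
  · have h1 := hk i
    have h2 : μ * k i.succ / (1 + k i.succ) < μ := by
      rw [div_lt_iff₀ (by linarith)]; linarith
    have h3 : μ < μ * k 0 / (1 + k 0) := by
      rw [lt_div_iff_of_neg hk1]; linarith
    linarith
  · rw [formMatrix_neg_one, congruence_mul_diagonal hRJ, mink]
    congr 1
    ext i
    rw [hs2]
    refine Fin.cases ?_ (fun j => ?_) i
    · have := hk0.ne
      rw [abs_of_neg hk0, Fin.cons_zero]
      field_simp
    · rw [abs_of_pos (hk j), Fin.cons_succ, inv_mul_cancel₀ (hk j).ne']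
  · rw [congruence_mul_diagonal hRA]
    congr 1
    ext i
    rw [hs2]
    refine Fin.cases ?_ (fun j => ?_) i
    · rw [abs_of_neg hk0, Fin.cons_zero]
      field_simp
    · rw [abs_of_pos (hk j), Fin.cons_succ]
      have := hk j
      field_simp
  · rw [Matrix.mul_diagonal, hs, ← mul_assoc]
    exact mul_pos hεR (inv_pos.2 (Real.sqrt_pos.2 (hkabs 0)))

end AdaptedBasis

/-! ### Coordinates and the projective chart -/

section Coordinates

variable {n : ℕ}

/-- The vector with coordinates `y` in the basis formed by the columns of `R`. -/
def fromCoords (R : Matrix (Fin (n + 1)) (Fin (n + 1)) ℝ) (y : Fin (n + 1) → ℝ) : Amb n :=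
  WithLp.toLp 2 (R *ᵥ y)

/-- The coordinates of a vector in the basis formed by the columns of `R`, provided that this basis
is orthonormal for the ambient form (so that `G Rᵀ G` is the inverse of `R`). -/
def coords (σ : ℝ) (R : Matrix (Fin (n + 1)) (Fin (n + 1)) ℝ) (x : Amb n) : Fin (n + 1) → ℝ :=
  (formMatrix σ n * Rᵀ * formMatrix σ n) *ᵥ x.ofLp

/-- The points of the affine hyperplane `y₀ = √b`, in the coordinates `yᵢ = √aᵢ zᵢ` that make the
ellipsoid the unit sphere. -/
noncomputable def chartPoint (R : Matrix (Fin (n + 1)) (Fin (n + 1)) ℝ) (b : ℝ) (a : Fin n → ℝ)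
    (z : EuclideanSpace ℝ (Fin n)) : Amb n :=
  fromCoords R (Fin.cons √b fun i => √(a i) * z i)

/-- The central projection of `chartPoint` to the space form. -/
noncomputable def chartProj (σ : ℝ) (R : Matrix (Fin (n + 1)) (Fin (n + 1)) ℝ) (b : ℝ)
    (a : Fin n → ℝ) (z : EuclideanSpace ℝ (Fin n)) : Amb n :=
  (1 / √(chartForm σ b a z z)) • chartPoint R b a z

theorem formMatrix_mul_self {σ : ℝ} (hσ : σ * σ = 1) : formMatrix σ n * formMatrix σ n = 1 := by
  rw [formMatrix, Matrix.diagonal_mul_diagonal, ← Matrix.diagonal_one]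
  congr 1
  ext i
  refine Fin.cases ?_ (fun j => ?_) i <;> simp [hσ]

theorem bil_diagonal_cons (s : ℝ) (d : Fin n → ℝ) (x y : Fin (n + 1) → ℝ) :
    x ⬝ᵥ (Matrix.diagonal (Fin.cons s d : Fin (n + 1) → ℝ) *ᵥ y) =
      s * (x 0 * y 0) + ∑ i : Fin n, d i * (x i.succ * y i.succ) := by
  simp only [dotProduct, Matrix.mulVec_diagonal, Fin.sum_univ_succ, Fin.cons_zero, Fin.cons_succ]
  congr 1
  · ring
  · exact Finset.sum_congr rfl fun i _ => by ring

theorem bil_smul_left (M : Matrix (Fin (n + 1)) (Fin (n + 1)) ℝ) (r : ℝ) (x y : Amb n) :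
    bil M (r • x) y = r * bil M x y := by
  simp [bil, smul_dotProduct]

theorem bil_smul_right (M : Matrix (Fin (n + 1)) (Fin (n + 1)) ℝ) (r : ℝ) (x y : Amb n) :
    bil M x (r • y) = r * bil M x y := by
  simp [bil, Matrix.mulVec_smul, dotProduct_smul]

theorem qf_smul (M : Matrix (Fin (n + 1)) (Fin (n + 1)) ℝ) (r : ℝ) (x : Amb n) :
    qf M (r • x) = r ^ 2 * qf M x := by
  rw [qf, bil_smul_left, bil_smul_right, qf]; ring

theorem continuous_bil_left (M : Matrix (Fin (n + 1)) (Fin (n + 1)) ℝ) (x : Amb n) :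
    Continuous (bil M x) := by
  unfold bil
  fun_prop

theorem continuous_qf (M : Matrix (Fin (n + 1)) (Fin (n + 1)) ℝ) :
    Continuous (qf M : Amb n → ℝ) := by
  unfold qf bil
  fun_prop

theorem coords_smul (σ : ℝ) (R : Matrix (Fin (n + 1)) (Fin (n + 1)) ℝ) (r : ℝ) (x : Amb n) :
    coords σ R (r • x) = r • coords σ R x := by
  simp [coords, Matrix.mulVec_smul]

theorem continuous_coords (σ : ℝ) (R : Matrix (Fin (n + 1)) (Fin (n + 1)) ℝ) :
    Continuous (coords σ R) := by
  unfold coords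
  fun_prop

theorem continuous_chartPoint (R : Matrix (Fin (n + 1)) (Fin (n + 1)) ℝ) (b : ℝ) (a : Fin n → ℝ) :
    Continuous (chartPoint R b a) := by
  have h : Continuous fun z : EuclideanSpace ℝ (Fin n) =>
      (Fin.cons √b fun i => √(a i) * z i : Fin (n + 1) → ℝ) := by
    refine continuous_pi fun i => ?_
    refine Fin.cases ?_ (fun j => ?_) i
    · simpa using continuous_const
    · simp only [Fin.cons_succ]; fun_prop
  unfold chartPoint fromCoords
  have h2 := Continuous.matrix_mulVec (continuous_const (y := R)) h
  fun_prop

theorem continuousOn_chartProj (σ : ℝ) (R : Matrix (Fin (n + 1)) (Fin (n + 1)) ℝ) (b : ℝ)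
    (a : Fin n → ℝ) : ContinuousOn (chartProj σ R b a) {z | 0 < chartForm σ b a z z} := by
  refine ContinuousOn.smul (ContinuousOn.div (continuousOn_const (c := (1 : ℝ))) ?_ ?_)
    (continuous_chartPoint R b a).continuousOn
  · exact (Real.continuous_sqrt.comp (continuous_chartForm_self σ b a)).continuousOn
  · exact fun z hz => (Real.sqrt_pos.2 hz).ne'

theorem measurable_chartProj (σ : ℝ) (R : Matrix (Fin (n + 1)) (Fin (n + 1)) ℝ) (b : ℝ)
    (a : Fin n → ℝ) : Measurable (chartProj σ R b a) := by
  have h1 := (continuous_chartPoint R b a).measurable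
  have h2 := (Real.continuous_sqrt.comp (continuous_chartForm_self σ b a)).measurable
  exact (measurable_const.div h2).smul h1

namespace IsPrincipalBasis

variable {σ b : ℝ} {a : Fin n → ℝ} {A R : Matrix (Fin (n + 1)) (Fin (n + 1)) ℝ}

theorem sq_eq_one (h : IsPrincipalBasis σ b a A R) : σ * σ = 1 := by
  rcases h.sign with h | h <;> simp [h]

theorem left_inv (h : IsPrincipalBasis σ b a A R) :
    formMatrix σ n * Rᵀ * formMatrix σ n * R = 1 := by
  rw [Matrix.mul_assoc, Matrix.mul_assoc, ← Matrix.mul_assoc Rᵀ, h.form,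
    formMatrix_mul_self h.sq_eq_one]

theorem coords_fromCoords (h : IsPrincipalBasis σ b a A R) (y : Fin (n + 1) → ℝ) :
    coords σ R (fromCoords R y) = y := by
  rw [coords, fromCoords, Matrix.mulVec_mulVec, h.left_inv, Matrix.one_mulVec]

theorem fromCoords_coords (h : IsPrincipalBasis σ b a A R) (x : Amb n) :
    fromCoords R (coords σ R x) = x := by
  rw [coords, fromCoords, Matrix.mulVec_mulVec, mul_eq_one_comm.1 h.left_inv, Matrix.one_mulVec]

theorem bil_form (h : IsPrincipalBasis σ b a A R) (x y : Amb n) :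
    bil (formMatrix σ n) x y = σ * (coords σ R x 0 * coords σ R y 0) +
      ∑ i : Fin n, coords σ R x i.succ * coords σ R y i.succ := by
  conv_lhs => rw [← h.fromCoords_coords x, ← h.fromCoords_coords y]
  rw [bil, fromCoords, fromCoords, ← dotProduct_congruence_mulVec, h.form, formMatrix,
    bil_diagonal_cons]
  simp

theorem qf_quadric (h : IsPrincipalBasis σ b a A R) (x : Amb n) :
    qf A x = ∑ i : Fin n, coords σ R x i.succ ^ 2 / a i - coords σ R x 0 ^ 2 / b := by
  conv_lhs => rw [← h.fromCoords_coords x]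
  rw [qf, bil, fromCoords, ← dotProduct_congruence_mulVec, h.quadric, bil_diagonal_cons]
  rw [add_comm, sub_eq_add_neg]
  congr 1
  · exact Finset.sum_congr rfl fun i _ => by ring
  · ring

theorem coords_chartPoint_zero (h : IsPrincipalBasis σ b a A R) (z : EuclideanSpace ℝ (Fin n)) :
    coords σ R (chartPoint R b a z) 0 = √b := by
  rw [chartPoint, h.coords_fromCoords]; rfl

theorem coords_chartPoint_succ (h : IsPrincipalBasis σ b a A R) (z : EuclideanSpace ℝ (Fin n))
    (i : Fin n) : coords σ R (chartPoint R b a z) i.succ = √(a i) * z i := by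
  rw [chartPoint, h.coords_fromCoords]; rfl

theorem bil_chartPoint (h : IsPrincipalBasis σ b a A R) (z w : EuclideanSpace ℝ (Fin n)) :
    bil (formMatrix σ n) (chartPoint R b a z) (chartPoint R b a w) = σ * chartForm σ b a z w := by
  rw [h.bil_form]
  simp only [h.coords_chartPoint_zero, h.coords_chartPoint_succ]
  rw [Real.mul_self_sqrt h.b_pos.le, chartForm, mul_add, ← mul_assoc σ σ, h.sq_eq_one, one_mul]
  congr 1
  refine Finset.sum_congr rfl fun i _ => ?_
  nth_rewrite 3 [← Real.mul_self_sqrt (h.a_pos i).le]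
  ring

theorem qf_form_chartPoint (h : IsPrincipalBasis σ b a A R) (z : EuclideanSpace ℝ (Fin n)) :
    σ * qf (formMatrix σ n) (chartPoint R b a z) = chartForm σ b a z z := by
  rw [qf, h.bil_chartPoint, ← mul_assoc, h.sq_eq_one, one_mul]

theorem qf_quadric_chartPoint (h : IsPrincipalBasis σ b a A R) (z : EuclideanSpace ℝ (Fin n)) :
    qf A (chartPoint R b a z) = ‖z‖ ^ 2 - 1 := by
  rw [h.qf_quadric, EuclideanSpace.real_norm_sq_eq, h.coords_chartPoint_zero,
    Real.sq_sqrt h.b_pos.le, div_self h.b_pos.ne']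
  congr 1
  refine Finset.sum_congr rfl fun i _ => ?_
  rw [h.coords_chartPoint_succ, mul_pow, Real.sq_sqrt (h.a_pos i).le,
    mul_div_cancel_left₀ _ (h.a_pos i).ne']

theorem chartForm_self_pos (h : IsPrincipalBasis σ b a A R) {z : EuclideanSpace ℝ (Fin n)}
    (hz : ‖z‖ ≤ 1) : 0 < chartForm σ b a z z :=
  _root_.chartForm_self_pos h.b_pos h.add_pos hz

theorem qf_form_chartProj (h : IsPrincipalBasis σ b a A R) {z : EuclideanSpace ℝ (Fin n)}
    (hz : 0 < chartForm σ b a z z) : qf (formMatrix σ n) (chartProj σ R b a z) = σ := by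
  rw [chartProj, qf_smul, div_pow, Real.sq_sqrt hz.le, qf, h.bil_chartPoint]
  field_simp

theorem qf_quadric_chartProj (h : IsPrincipalBasis σ b a A R) {z : EuclideanSpace ℝ (Fin n)}
    (hz : 0 < chartForm σ b a z z) :
    qf A (chartProj σ R b a z) = (‖z‖ ^ 2 - 1) / chartForm σ b a z z := by
  rw [chartProj, qf_smul, div_pow, Real.sq_sqrt hz.le, h.qf_quadric_chartPoint]
  ring

theorem coords_chartProj_zero_pos (h : IsPrincipalBasis σ b a A R)
    {z : EuclideanSpace ℝ (Fin n)} (hz : 0 < chartForm σ b a z z) :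
    0 < coords σ R (chartProj σ R b a z) 0 := by
  rw [chartProj, coords_smul, Pi.smul_apply, h.coords_chartPoint_zero, smul_eq_mul]
  have := Real.sqrt_pos.2 hz
  have := Real.sqrt_pos.2 h.b_pos
  positivity

/-- The linear parametrization `(t, w) ↦ (√b t, √aᵢ wᵢ)` of the ambient space. -/
noncomputable def linearChart (h : IsPrincipalBasis σ b a A R) :
    (ℝ × EuclideanSpace ℝ (Fin n)) ≃ₗ[ℝ] Amb n where
  toFun p := fromCoords R (Fin.cons (√b * p.1) fun i => √(a i) * p.2 i)
  map_add' p q := by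
    rw [fromCoords, fromCoords, fromCoords, ← WithLp.toLp_add, ← Matrix.mulVec_add]
    congr 2
    ext i
    refine Fin.cases ?_ (fun j => ?_) i <;> simp [mul_add]
  map_smul' r p := by
    rw [fromCoords, fromCoords, RingHom.id_apply, ← WithLp.toLp_smul, ← Matrix.mulVec_smul]
    congr 2
    ext i
    refine Fin.cases ?_ (fun j => ?_) i <;> simp <;> ring
  invFun x := (coords σ R x 0 / √b, WithLp.toLp 2 fun i => coords σ R x i.succ / √(a i))
  left_inv p := by
    have hb := (Real.sqrt_pos.2 h.b_pos).ne'
    have ha := fun i => (Real.sqrt_pos.2 (h.a_pos i)).ne'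
    beta_reduce
    rw [h.coords_fromCoords]
    ext
    · simp [hb]
    · simp [ha]
  right_inv x := by
    have hb := (Real.sqrt_pos.2 h.b_pos).ne'
    have ha := fun i => (Real.sqrt_pos.2 (h.a_pos i)).ne'
    conv_rhs => rw [← h.fromCoords_coords x]
    refine congrArg (fromCoords R) (funext fun i => ?_)
    refine Fin.cases ?_ (fun j => ?_) i
    · simp only [Fin.cons_zero]; field_simp
    · have := ha j
      simp only [Fin.cons_succ]; field_simp

theorem linearChart_smul (h : IsPrincipalBasis σ b a A R) (t : ℝ) (z : EuclideanSpace ℝ (Fin n)) :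
    h.linearChart (t, t • z) = t • chartPoint R b a z := by
  refine congrArg (WithLp.toLp 2) (?_ : R *ᵥ _ = t • (R *ᵥ _))
  rw [← Matrix.mulVec_smul]
  congr 1
  ext i
  refine Fin.cases ?_ (fun j => ?_) i <;> simp <;> ring

/-- Integration over a half-space in homogeneous coordinates. -/
theorem exists_lintegral_eq (h : IsPrincipalBasis σ b a A R) :
    ∃ c : NNReal, 0 < c ∧ ∀ f : Amb n → ENNReal, Measurable f →
      ∫⁻ x in {x | 0 < coords σ R x 0}, f x =
        c * ∫⁻ z : EuclideanSpace ℝ (Fin n), ∫⁻ t in Ioi (0 : ℝ),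
          ENNReal.ofReal (t ^ n) * f (t • chartPoint R b a z) := by
  set L := h.linearChart.toContinuousLinearEquiv
  have hLt : ∀ p, coords σ R (L p) 0 = √b * p.1 := by
    intro p
    change coords σ R (fromCoords R _) 0 = _
    rw [h.coords_fromCoords]; rfl
  set ν := ((volume : Measure ℝ).prod (volume : Measure (EuclideanSpace ℝ (Fin n)))).map L
  have hν : ν.IsAddHaarMeasure := ContinuousLinearEquiv.isAddHaarMeasure_map L _
  refine ⟨(volume : Measure (Amb n)).addHaarScalarFactor ν,
    Measure.addHaarScalarFactor_pos_of_isAddHaarMeasure _ _, fun f hf => ?_⟩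
  have hvol : (volume : Measure (Amb n)) =
      (volume : Measure (Amb n)).addHaarScalarFactor ν • ν :=
    Measure.isAddLeftInvariant_eq_smul _ _
  set c := (volume : Measure (Amb n)).addHaarScalarFactor ν
  have hH : MeasurableSet {x : Amb n | 0 < coords σ R x 0} :=
    (isOpen_lt continuous_const ((continuous_apply 0).comp (continuous_coords σ R))).measurableSet
  have hV := (continuous_chartPoint R b a).measurable
  rw [hvol, Measure.restrict_smul, lintegral_smul_measure, ENNReal.smul_def, smul_eq_mul]
  congr 1
  rw [← lintegral_indicator hH, lintegral_map (hf.indicator hH) L.continuous.measurable,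
    lintegral_prod (fun p => indicator _ f (L p))
      ((hf.indicator hH).comp L.continuous.measurable).aemeasurable]
  have hswap : ∫⁻ z : EuclideanSpace ℝ (Fin n), ∫⁻ t in Ioi (0 : ℝ),
      ENNReal.ofReal (t ^ n) * f (t • chartPoint R b a z) = ∫⁻ t in Ioi (0 : ℝ),
      ∫⁻ z : EuclideanSpace ℝ (Fin n), ENNReal.ofReal (t ^ n) * f (t • chartPoint R b a z) := by
    refine lintegral_lintegral_swap ?_
    refine (Measurable.mul ?_ ?_).aemeasurable
    · exact (measurable_snd.pow_const n).ennreal_ofReal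
    · exact hf.comp (measurable_snd.smul (hV.comp measurable_fst))
  rw [hswap, ← lintegral_indicator measurableSet_Ioi]
  refine lintegral_congr fun t => ?_
  by_cases ht : 0 < t
  · rw [indicator_of_mem (show t ∈ Ioi (0 : ℝ) from ht)]
    have hind : ∀ w, indicator {x : Amb n | 0 < coords σ R x 0} f (L (t, w)) = f (L (t, w)) := by
      intro w
      refine indicator_of_mem ?_ _
      rw [mem_ofPred_eq, hLt]
      exact mul_pos (Real.sqrt_pos.2 h.b_pos) ht
    simp only [hind]
    have hm := Measure.map_addHaar_smul (volume : Measure (EuclideanSpace ℝ (Fin n))) ht.ne'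
    have hpow : 0 < t ^ n := pow_pos ht n
    have hfm : Measurable fun w => f (L (t, w)) :=
      hf.comp (L.continuous.measurable.comp measurable_prodMk_left)
    rw [lintegral_const_mul (f := fun z => f (t • chartPoint R b a z)) _
      (hf.comp (hV.const_smul t))]
    have h2 : ∫⁻ z, f (t • chartPoint R b a z) =
        ENNReal.ofReal |(t ^ n)⁻¹| * ∫⁻ w, f (L (t, w)) := by
      rw [finrank_euclideanSpace_fin] at hm
      rw [← smul_eq_mul, ← lintegral_smul_measure, ← hm,
        lintegral_map hfm (measurable_const_smul t)]
      refine lintegral_congr fun z => ?_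
      rw [← h.linearChart_smul]
      rfl
    rw [h2, ← mul_assoc, ← ENNReal.ofReal_mul hpow.le, abs_of_pos (inv_pos.2 hpow),
      mul_inv_cancel₀ hpow.ne', ENNReal.ofReal_one, one_mul]
  · rw [indicator_of_notMem (show t ∉ Ioi (0 : ℝ) from ht)]
    refine (lintegral_congr fun w => ?_).trans lintegral_zero
    refine indicator_of_notMem ?_ _
    rw [mem_ofPred_eq, hLt]
    exact fun h' => ht (pos_of_mul_pos_right h' (Real.sqrt_nonneg b))

end IsPrincipalBasis

end Coordinates

/-! ### The volume of the space form in the projective chart -/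

section Homeoid

variable {n : ℕ}

theorem lintegral_pow_Ioo (n : ℕ) {T : ℝ} (hT : 0 ≤ T) :
    ((n : ENNReal) + 1) * ∫⁻ t in Ioo 0 T, ENNReal.ofReal (t ^ n) =
      ENNReal.ofReal (T ^ (n + 1)) := by
  rw [Measure.restrict_congr_set Ioo_ae_eq_Ioc,
    ← ofReal_integral_eq_lintegral_ofReal (intervalIntegral.intervalIntegrable_pow _).1,
    ← intervalIntegral.integral_of_le hT]
  · rw [integral_pow, show (n : ENNReal) + 1 = ENNReal.ofReal ((n : ℝ) + 1) by
      rw [ENNReal.ofReal_add (by positivity) zero_le_one]; simp,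
      ← ENNReal.ofReal_mul (by positivity)]
    congr 1
    field_simp
    simp
  · filter_upwards [ae_restrict_mem measurableSet_Ioc] with y hy
    exact pow_nonneg hy.1.le _

namespace IsPrincipalBasis

variable {σ b : ℝ} {a : Fin n → ℝ} {A R : Matrix (Fin (n + 1)) (Fin (n + 1)) ℝ}

theorem measurableSet_half (σ : ℝ) (R : Matrix (Fin (n + 1)) (Fin (n + 1)) ℝ) :
    MeasurableSet {x : Amb n | 0 < coords σ R x 0} :=
  (isOpen_lt continuous_const ((continuous_apply 0).comp (continuous_coords σ R))).measurableSet

/-- The Riemannian volume of the space form in the affine coordinates of the projective chart. It is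
given as the measure of cones; integrating `tⁿ dt` along the rays of a cone yields the density
`N^(-(n + 1) / 2)`. -/
theorem exists_restrict_eq_map (h : IsPrincipalBasis σ b a A R) {vol : Measure (Amb n)}
    {C : Set (Amb n)} (hC : MeasurableSet C)
    (hvol : vol = ((n : ENNReal) + 1) • ((volume : Measure (Amb n)).restrict C).map
      fun x => (1 / √(σ * qf (formMatrix σ n) x)) • x)
    (hCH : ∀ x, 0 < coords σ R x 0 →
      (x ∈ C ↔ 0 < σ * qf (formMatrix σ n) x ∧ σ * qf (formMatrix σ n) x < 1)) :
    ∃ c : NNReal, 0 < c ∧ vol.restrict {x | 0 < coords σ R x 0} =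
      c • (((volume : Measure (EuclideanSpace ℝ (Fin n))).restrict
        {z | 0 < chartForm σ b a z z}).withDensity
          fun z => ENNReal.ofReal ((1 / √(chartForm σ b a z z)) ^ (n + 1))).map
            (chartProj σ R b a) := by
  obtain ⟨c, hc, hcf⟩ := h.exists_lintegral_eq
  refine ⟨c, hc, ?_⟩
  set π : Amb n → Amb n := fun x => (1 / √(σ * qf (formMatrix σ n) x)) • x with hπ
  have hπm : Measurable π := by
    have h1 : Measurable fun x : Amb n => √(σ * qf (formMatrix σ n) x) :=
      (Real.continuous_sqrt.comp (continuous_const.mul (continuous_qf _))).measurable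
    exact (measurable_const.div h1).smul measurable_id
  have hNc := continuous_chartForm_self σ b a
  have hN : MeasurableSet {z : EuclideanSpace ℝ (Fin n) | 0 < chartForm σ b a z z} :=
    (isOpen_lt continuous_const hNc).measurableSet
  have hv := measurable_chartProj σ R b a
  ext s hs
  have hH := measurableSet_half σ R
  rw [Measure.restrict_apply hs, hvol, Measure.smul_apply, Measure.map_apply hπm (hs.inter hH),
    Measure.restrict_apply (hπm (hs.inter hH))]
  have hset : π ⁻¹' (s ∩ {x | 0 < coords σ R x 0}) ∩ C =
      (C ∩ π ⁻¹' s) ∩ {x | 0 < coords σ R x 0} := by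
    ext x
    simp only [mem_inter_iff, mem_preimage, mem_ofPred_eq, hπ, coords_smul, Pi.smul_apply,
      smul_eq_mul]
    constructor
    · rintro ⟨⟨h1, h2⟩, h3⟩
      exact ⟨⟨h3, h1⟩, pos_of_mul_pos_right h2 (by positivity)⟩
    · rintro ⟨⟨h1, h2⟩, h3⟩
      have := Real.sqrt_pos.2 ((hCH x h3).1 h1).1
      exact ⟨⟨h2, by positivity⟩, h1⟩
  have hCs : MeasurableSet (C ∩ π ⁻¹' s) := hC.inter (hπm hs)
  rw [hset, ← Measure.restrict_apply hCs, ← lintegral_indicator_one hCs,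
    hcf _ (measurable_one.indicator hCs), Measure.smul_apply, Measure.map_apply hv hs,
    withDensity_apply _ (hv hs), Measure.restrict_restrict (hv hs), smul_eq_mul, ENNReal.smul_def,
    smul_eq_mul, mul_left_comm, ← lintegral_const_mul _ ?_]
  · rw [← lintegral_indicator ((hv hs).inter hN)]
    congr 1
    refine lintegral_congr fun z => ?_
    have hqf : ∀ t : ℝ, σ * qf (formMatrix σ n) (t • chartPoint R b a z) =
        t ^ 2 * chartForm σ b a z z := by
      intro t
      rw [qf_smul, mul_left_comm, h.qf_form_chartPoint]
    have hhalf : ∀ t : ℝ, 0 < t → 0 < coords σ R (t • chartPoint R b a z) 0 := by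
      intro t ht
      rw [coords_smul, Pi.smul_apply, h.coords_chartPoint_zero, smul_eq_mul]
      exact mul_pos ht (Real.sqrt_pos.2 h.b_pos)
    by_cases hz : z ∈ chartProj σ R b a ⁻¹' s ∩ {z | 0 < chartForm σ b a z z}
    · rw [indicator_of_mem hz]
      obtain ⟨hzs, hzN⟩ := hz
      have hzN : 0 < chartForm σ b a z z := hzN
      have hsN := Real.sqrt_pos.2 hzN
      rw [← lintegral_pow_Ioo n (by positivity), ← lintegral_indicator measurableSet_Ioi,
        ← lintegral_indicator measurableSet_Ioo]
      congr 1
      refine lintegral_congr fun t => ?_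
      by_cases ht : 0 < t
      · rw [indicator_of_mem (show t ∈ Ioi (0 : ℝ) from ht)]
        have hiff : t • chartPoint R b a z ∈ C ∩ π ⁻¹' s ↔
            t ∈ Ioo 0 (1 / √(chartForm σ b a z z)) := by
          have h1 : π (t • chartPoint R b a z) = chartProj σ R b a z := by
            simp only [hπ, hqf, chartProj]
            rw [Real.sqrt_mul (sq_nonneg t), Real.sqrt_sq ht.le, smul_smul]
            congr 1
            field_simp
          rw [mem_inter_iff, mem_preimage, h1, hCH _ (hhalf t ht), hqf, mem_Ioo,
            lt_div_iff₀ hsN]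
          have h2 : t ^ 2 * chartForm σ b a z z = (t * √(chartForm σ b a z z)) ^ 2 := by
            rw [mul_pow, Real.sq_sqrt hzN.le]
          rw [h2, sq_lt_one_iff₀ (by positivity)]
          constructor
          · rintro ⟨⟨-, h3⟩, -⟩
            exact ⟨ht, h3⟩
          · rintro ⟨-, h3⟩
            exact ⟨⟨by positivity, h3⟩, hzs⟩
        by_cases hmem : t ∈ Ioo 0 (1 / √(chartForm σ b a z z))
        · rw [indicator_of_mem hmem, indicator_of_mem (hiff.2 hmem), Pi.one_apply, mul_one]
        · rw [indicator_of_notMem hmem, indicator_of_notMem (fun h' => hmem (hiff.1 h')), mul_zero]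
      · rw [indicator_of_notMem (show t ∉ Ioi (0 : ℝ) from ht),
          indicator_of_notMem (fun h' => ht h'.1)]
    · rw [indicator_of_notMem hz]
      have : ∫⁻ t in Ioi (0 : ℝ), ENNReal.ofReal (t ^ n) *
          (C ∩ π ⁻¹' s).indicator 1 (t • chartPoint R b a z) = 0 := by
        rw [← lintegral_indicator measurableSet_Ioi]
        refine (lintegral_congr fun t => ?_).trans lintegral_zero
        by_cases ht : 0 < t
        · rw [indicator_of_mem (show t ∈ Ioi (0 : ℝ) from ht), indicator_of_notMem, mul_zero]
          rintro ⟨h1, h2⟩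
          rw [hCH _ (hhalf t ht), hqf] at h1
          have hzN : 0 < chartForm σ b a z z := pos_of_mul_pos_right h1.1 (sq_nonneg t)
          have hsN := Real.sqrt_pos.2 hzN
          refine hz ⟨?_, hzN⟩
          have h3 : π (t • chartPoint R b a z) = chartProj σ R b a z := by
            simp only [hπ, hqf, chartProj]
            rw [Real.sqrt_mul (sq_nonneg t), Real.sqrt_sq ht.le, smul_smul]
            congr 1
            field_simp
          rw [mem_preimage, ← h3]
          exact h2
        · rw [indicator_of_notMem (show t ∉ Ioi (0 : ℝ) from ht)]
      rw [this, mul_zero]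
  · have hm : Measurable fun p : EuclideanSpace ℝ (Fin n) × ℝ => ENNReal.ofReal (p.2 ^ n) *
        (C ∩ π ⁻¹' s).indicator 1 (p.2 • chartPoint R b a p.1) := by
      refine Measurable.mul (measurable_snd.pow_const n).ennreal_ofReal ?_
      exact (measurable_one.indicator hCs).comp
        (measurable_snd.smul ((continuous_chartPoint R b a).measurable.comp measurable_fst))
    exact hm.lintegral_prod_right'

end IsPrincipalBasis

end Homeoid

/-! ### Existence and uniqueness of homeoidal measures -/

section HomeoidalMeasure

variable {n : ℕ}

/-- The homeoidal measure: the image under central projection of the measure `N(ω)^((1 - n) / 2) dω` on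
the unit sphere, where `N` is the ambient form at the chart point. The exponent is the sum of
`-(n + 1) / 2` from the volume and `1` from the thickness of the homeoid. -/
noncomputable def homeoidalMeasure (σ : ℝ) (R : Matrix (Fin (n + 1)) (Fin (n + 1)) ℝ) (b : ℝ)
    (a : Fin n → ℝ) : Measure (Amb n) :=
  ((volume : Measure (EuclideanSpace ℝ (Fin n))).toSphere.withDensity fun ω =>
    ENNReal.ofReal ((√(chartForm σ b a ω.1 ω.1) ^ (n - 1))⁻¹)).map
      fun ω => chartProj σ R b a ω.1

namespace IsPrincipalBasis

variable {σ b : ℝ} {a : Fin n → ℝ} {A R : Matrix (Fin (n + 1)) (Fin (n + 1)) ℝ}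

/-- In the chart, the homeoids are relatively compact for small `ε`, in a ball that lies in the chart. -/
theorem exists_radius (h : IsPrincipalBasis σ b a A R) :
    ∃ ρ > 1, (∀ z : EuclideanSpace ℝ (Fin n), ‖z‖ ≤ ρ → 0 < chartForm σ b a z z) ∧
      ∀ᶠ ε in 𝓝[>] (0 : ℝ), ∀ z : EuclideanSpace ℝ (Fin n), 0 < chartForm σ b a z z →
        ‖z‖ ^ 2 - 1 ≤ ε * chartForm σ b a z z → ‖z‖ ≤ ρ := by
  have hc := continuous_chartForm_self σ b a
  have hopen : IsOpen {z : EuclideanSpace ℝ (Fin n) | 0 < chartForm σ b a z z} :=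
    isOpen_lt continuous_const hc
  obtain ⟨δ, hδ, hsub⟩ := (isCompact_closedBall
    (0 : EuclideanSpace ℝ (Fin n)) 1).exists_cthickening_subset_open hopen fun z hz => h.chartForm_self_pos (by simpa using hz)
  refine ⟨1 + δ, by linarith, fun z hz => ?_, ?_⟩
  · refine hsub ?_
    rw [cthickening_closedBall hδ.le zero_le_one]
    simpa [add_comm] using hz
  · set α := ∑ i, a i
    have hα : 0 ≤ α := Finset.sum_nonneg fun i _ => (h.a_pos i).le
    have hb := h.b_pos
    have hN : ∀ z : EuclideanSpace ℝ (Fin n), chartForm σ b a z z ≤ b + α * ‖z‖ ^ 2 := by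
      intro z
      have h1 : 0 ≤ ∑ i, a i * z i * z i := Finset.sum_nonneg fun i _ => by
        rw [mul_assoc]; exact mul_nonneg (h.a_pos i).le (mul_self_nonneg _)
      have h2 : ∑ i, a i * z i * z i ≤ α * ‖z‖ ^ 2 := by
        rw [Finset.sum_mul]
        refine Finset.sum_le_sum fun i _ => ?_
        rw [mul_assoc, ← sq]
        refine mul_le_mul_of_nonneg_left ?_ (h.a_pos i).le
        rw [EuclideanSpace.real_norm_sq_eq]
        exact Finset.single_le_sum (f := fun i => z i ^ 2) (fun j _ => sq_nonneg _)
          (Finset.mem_univ i)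
      rw [chartForm]
      rcases h.sign with rfl | rfl <;> linarith
    have hρ : (0 : ℝ) < (1 + δ) ^ 2 - 1 := by nlinarith
    have hden : 0 < b + α * (1 + δ) ^ 2 := by positivity
    filter_upwards [Ioo_mem_nhdsGT (div_pos hρ hden)] with ε hε z hz hle
    obtain ⟨hε0, hε1⟩ := hε
    rw [lt_div_iff₀ hden] at hε1
    by_contra hcon
    push Not at hcon
    have h1 : (1 + δ) ^ 2 < ‖z‖ ^ 2 := by gcongr
    have h2 := hle.trans (mul_le_mul_of_nonneg_left (hN z) hε0.le)
    set s := ‖z‖ ^ 2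
    have h3 : ε * α < 1 := by
      have h4 : ε * α * (1 + δ) ^ 2 < (1 + δ) ^ 2 := by nlinarith [mul_pos hε0 hb]
      by_contra h5
      push Not at h5
      nlinarith [sq_nonneg (1 + δ)]
    nlinarith [mul_pos (sub_pos.2 h3) (sub_pos.2 h1)]

theorem chartForm_sphere_pos (h : IsPrincipalBasis σ b a A R)
    (ω : Metric.sphere (0 : EuclideanSpace ℝ (Fin n)) 1) : 0 < chartForm σ b a ω.1 ω.1 :=
  h.chartForm_self_pos (norm_eq_of_mem_sphere ω).le

theorem continuous_chartProj_sphere (h : IsPrincipalBasis σ b a A R) :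
    Continuous fun ω : Metric.sphere (0 : EuclideanSpace ℝ (Fin n)) 1 => chartProj σ R b a ω.1 :=
  (continuousOn_chartProj σ R b a).comp_continuous continuous_subtype_val h.chartForm_sphere_pos

theorem chartProj_injective (h : IsPrincipalBasis σ b a A R) :
    Function.Injective fun ω : Metric.sphere (0 : EuclideanSpace ℝ (Fin n)) 1 =>
      chartProj σ R b a ω.1 := by
  intro ω η heq
  have hb := Real.sqrt_pos.2 h.b_pos
  have hω := Real.sqrt_pos.2 (h.chartForm_sphere_pos ω)
  have hη := Real.sqrt_pos.2 (h.chartForm_sphere_pos η)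
  have h1 : ∀ i, coords σ R (chartProj σ R b a ω.1) i = coords σ R (chartProj σ R b a η.1) i :=
    fun i => congrFun (congrArg _ heq) i
  simp only [chartProj, coords_smul, Pi.smul_apply, smul_eq_mul] at h1
  have h2 := h1 0
  rw [h.coords_chartPoint_zero, h.coords_chartPoint_zero] at h2
  have h3 := mul_right_cancel₀ hb.ne' h2
  ext i
  have h4 := h1 i.succ
  rw [h.coords_chartPoint_succ, h.coords_chartPoint_succ, h3] at h4
  have h5 := mul_left_cancel₀ (one_div_pos.2 hη).ne' h4
  exact mul_left_cancel₀ (Real.sqrt_pos.2 (h.a_pos i)).ne' h5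

theorem measurableEmbedding_chartProj (h : IsPrincipalBasis σ b a A R) :
    MeasurableEmbedding fun ω : Metric.sphere (0 : EuclideanSpace ℝ (Fin n)) 1 =>
      chartProj σ R b a ω.1 :=
  (h.continuous_chartProj_sphere.isClosedEmbedding h.chartProj_injective).measurableEmbedding

theorem continuous_sphere_weight (h : IsPrincipalBasis σ b a A R) :
    Continuous fun ω : Metric.sphere (0 : EuclideanSpace ℝ (Fin n)) 1 =>
      (√(chartForm σ b a ω.1 ω.1) ^ (n - 1))⁻¹ :=
  continuous_weight h.b_pos h.add_pos _

theorem integral_homeoidalMeasure (h : IsPrincipalBasis σ b a A R) {F : Type*}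
    [NormedAddCommGroup F] [NormedSpace ℝ F] (f : Amb n → F) :
    ∫ x, f x ∂homeoidalMeasure σ R b a =
      ∫ ω : Metric.sphere (0 : EuclideanSpace ℝ (Fin n)) 1,
        (√(chartForm σ b a ω.1 ω.1) ^ (n - 1))⁻¹ • f (chartProj σ R b a ω.1)
          ∂volume.toSphere := by
  rw [homeoidalMeasure, h.measurableEmbedding_chartProj.integral_map,
    integral_withDensity_eq_integral_toReal_smul
      h.continuous_sphere_weight.measurable.ennreal_ofReal (by simp)]
  refine integral_congr_ae (Eventually.of_forall fun ω => ?_)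
  beta_reduce
  rw [ENNReal.toReal_ofReal (by positivity)]

theorem isFiniteMeasure_homeoidalMeasure (h : IsPrincipalBasis σ b a A R) :
    IsFiniteMeasure (homeoidalMeasure σ R b a) := by
  have h1 : Integrable (fun ω : Metric.sphere (0 : EuclideanSpace ℝ (Fin n)) 1 =>
      (√(chartForm σ b a ω.1 ω.1) ^ (n - 1))⁻¹)
      (volume : Measure (EuclideanSpace ℝ (Fin n))).toSphere :=
    h.continuous_sphere_weight.integrable_of_hasCompactSupport
      (HasCompactSupport.of_compactSpace _)
  have := isFiniteMeasure_withDensity_ofReal h1.2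
  exact Measure.isFiniteMeasure_map _ _

theorem integrable_homeoidalMeasure (h : IsPrincipalBasis σ b a A R) {F : Type*}
    [NormedAddCommGroup F] {f : Amb n → F}
    (hf : Continuous fun ω : Metric.sphere (0 : EuclideanSpace ℝ (Fin n)) 1 =>
      f (chartProj σ R b a ω.1)) : Integrable f (homeoidalMeasure σ R b a) := by
  rw [homeoidalMeasure, h.measurableEmbedding_chartProj.integrable_map_iff]
  have h1 : Integrable (fun ω : Metric.sphere (0 : EuclideanSpace ℝ (Fin n)) 1 =>
      (√(chartForm σ b a ω.1 ω.1) ^ (n - 1))⁻¹)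
      (volume : Measure (EuclideanSpace ℝ (Fin n))).toSphere :=
    h.continuous_sphere_weight.integrable_of_hasCompactSupport
      (HasCompactSupport.of_compactSpace _)
  have := isFiniteMeasure_withDensity_ofReal h1.2
  exact hf.integrable_of_hasCompactSupport (HasCompactSupport.of_compactSpace _)

theorem homeoidalMeasure_compl (h : IsPrincipalBasis σ b a A R) {S : Set (Amb n)}
    (hS : ∀ ω : Metric.sphere (0 : EuclideanSpace ℝ (Fin n)) 1, chartProj σ R b a ω.1 ∈ S) :
    homeoidalMeasure σ R b a Sᶜ = 0 := by
  rw [homeoidalMeasure, h.measurableEmbedding_chartProj.map_apply]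
  have : (fun ω : Metric.sphere (0 : EuclideanSpace ℝ (Fin n)) 1 => chartProj σ R b a ω.1) ⁻¹' Sᶜ
      = ∅ := by
    ext ω
    simpa using hS ω
  rw [this, measure_empty]

/-- The uniform mass distributions on the thin shells converge to the homeoidal measure. -/
theorem tendsto_integral_shell (hn : 2 ≤ n) (h : IsPrincipalBasis σ b a A R) {vol : Measure (Amb n)}
    {c : NNReal} (hvol : vol.restrict {x | 0 < coords σ R x 0} =
      c • (((volume : Measure (EuclideanSpace ℝ (Fin n))).restrict
        {z | 0 < chartForm σ b a z z}).withDensity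
          fun z => ENNReal.ofReal ((1 / √(chartForm σ b a z z)) ^ (n + 1))).map
            (chartProj σ R b a))
    {shell : ℝ → Set (Amb n)} (hmeas : ∀ ε, MeasurableSet (shell ε))
    (hsub : ∀ ε, shell ε ⊆ {x | 0 < coords σ R x 0})
    (hmem : ∀ ε z, 0 < chartForm σ b a z z → (chartProj σ R b a z ∈ shell ε ↔
      0 ≤ qf A (chartProj σ R b a z) ∧ qf A (chartProj σ R b a z) ≤ ε))
    {f : Amb n → ℝ} (hf : Continuous f) :
    Tendsto (fun ε : ℝ => ε⁻¹ * ∫ x in shell ε, f x ∂vol) (𝓝[>] 0)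
      (𝓝 (c / 2 * ∫ x, f x ∂homeoidalMeasure σ R b a)) := by
  have : Nonempty (Fin n) := ⟨⟨0, by omega⟩⟩
  obtain ⟨ρ, hρ, hpos, hev⟩ := h.exists_radius
  have hNc := continuous_chartForm_self σ b a
  have hNm : MeasurableSet {z : EuclideanSpace ℝ (Fin n) | 0 < chartForm σ b a z z} :=
    (isOpen_lt continuous_const hNc).measurableSet
  have hv := measurable_chartProj σ R b a
  set W : EuclideanSpace ℝ (Fin n) → ℝ := fun z => (1 / √(chartForm σ b a z z)) ^ (n + 1) with hW
  have hWm : Measurable W :=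
    (measurable_const.div (Real.continuous_sqrt.comp hNc).measurable).pow_const _
  have hann : {z : EuclideanSpace ℝ (Fin n) | 1 ≤ ‖z‖ ∧ ‖z‖ ≤ ρ} ⊆
      {z | 0 < chartForm σ b a z z} := fun z hz => hpos z hz.2
  have hgc : ContinuousOn (fun z => W z * f (chartProj σ R b a z))
      {z : EuclideanSpace ℝ (Fin n) | 1 ≤ ‖z‖ ∧ ‖z‖ ≤ ρ} := by
    refine ContinuousOn.mul (ContinuousOn.pow (ContinuousOn.div continuousOn_const
      (Real.continuous_sqrt.comp hNc).continuousOn ?_) _)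
      (hf.comp_continuousOn ((continuousOn_chartProj σ R b a).mono hann))
    exact fun z hz => (Real.sqrt_pos.2 (hann hz)).ne'
  have hlim := tendsto_integral_thinShell (volume : Measure (EuclideanSpace ℝ (Fin n))) hρ hgc
    hNc.continuousOn (fun z _ hz => hpos z hz)
  have hval : ∫ ω : Metric.sphere (0 : EuclideanSpace ℝ (Fin n)) 1,
      (chartForm σ b a ω.1 ω.1 / 2) • (W ω.1 * f (chartProj σ R b a ω.1)) ∂volume.toSphere =
      1 / 2 * ∫ x, f x ∂homeoidalMeasure σ R b a := by
    rw [h.integral_homeoidalMeasure, ← integral_const_mul]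
    refine integral_congr_ae (Eventually.of_forall fun ω => ?_)
    have hN := h.chartForm_sphere_pos ω
    have hs := Real.sqrt_pos.2 hN
    simp only [hW, smul_eq_mul]
    nth_rewrite 1 [← Real.sq_sqrt hN.le]
    obtain ⟨m, rfl⟩ : ∃ m, n = m + 1 := ⟨n - 1, by omega⟩
    rw [Nat.add_sub_cancel, div_pow, one_pow]
    field_simp
    ring
  rw [hval] at hlim
  have hlim2 := hlim.const_mul (c : ℝ)
  rw [show (c : ℝ) * (1 / 2 * ∫ x, f x ∂homeoidalMeasure σ R b a) =
    c / 2 * ∫ x, f x ∂homeoidalMeasure σ R b a by ring] at hlim2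
  refine hlim2.congr' ?_
  filter_upwards [hev, self_mem_nhdsWithin] with ε hε hε0
  have hε0 : 0 < ε := hε0
  have hset : chartProj σ R b a ⁻¹' shell ε ∩ {z | 0 < chartForm σ b a z z} =
      thinShell (fun z => chartForm σ b a z z) ρ ε := by
    ext z
    simp only [thinShell, mem_inter_iff, mem_preimage, mem_ofPred_eq]
    constructor
    · rintro ⟨h1, h2⟩
      rw [hmem ε z h2, h.qf_quadric_chartProj h2, div_le_iff₀ h2] at h1
      have h3 : 0 ≤ ‖z‖ ^ 2 - 1 := by
        by_contra hneg
        exact absurd h1.1 (not_le.2 (div_neg_of_neg_of_pos (not_le.1 hneg) h2))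
      exact ⟨⟨by nlinarith [norm_nonneg z], hε z h2 h1.2⟩, h1.2⟩
    · rintro ⟨⟨h1, h2⟩, h3⟩
      have h4 := hpos z h2
      refine ⟨?_, h4⟩
      rw [hmem ε z h4, h.qf_quadric_chartProj h4, div_le_iff₀ h4]
      exact ⟨div_nonneg (by nlinarith) h4.le, h3⟩
  have h1 : vol.restrict (shell ε) = (vol.restrict {x | 0 < coords σ R x 0}).restrict (shell ε) := by
    rw [Measure.restrict_restrict (hmeas ε), inter_eq_left.2 (hsub ε)]
  rw [h1, hvol, Measure.restrict_smul, Measure.restrict_map hv (hmeas ε),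
    restrict_withDensity (hv (hmeas ε)), Measure.restrict_restrict (hv (hmeas ε)), hset,
    integral_smul_nnreal_measure, integral_map hv.aemeasurable hf.aestronglyMeasurable,
    integral_withDensity_eq_integral_toReal_smul hWm.ennreal_ofReal (by simp), NNReal.smul_def,
    smul_eq_mul, smul_eq_mul]
  have h2 : ∀ z, (ENNReal.ofReal (W z)).toReal = W z := fun z =>
    ENNReal.toReal_ofReal (by positivity)
  simp only [h2, smul_eq_mul]
  ring

/-- Homeoidal measures exist, and are unique up to a positive constant factor. -/
theorem isHomeoidal_exists_and_unique (hn : 2 ≤ n) (h : IsPrincipalBasis σ b a A R)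
    {vol : Measure (Amb n)}
    {c : NNReal} (hc : 0 < c) (hvol : vol.restrict {x | 0 < coords σ R x 0} =
      c • (((volume : Measure (EuclideanSpace ℝ (Fin n))).restrict
        {z | 0 < chartForm σ b a z z}).withDensity
          fun z => ENNReal.ofReal ((1 / √(chartForm σ b a z z)) ^ (n + 1))).map
            (chartProj σ R b a))
    {shell : ℝ → Set (Amb n)} (hmeas : ∀ ε, MeasurableSet (shell ε))
    (hsub : ∀ ε, shell ε ⊆ {x | 0 < coords σ R x 0})
    (hmem : ∀ ε z, 0 < chartForm σ b a z z → (chartProj σ R b a z ∈ shell ε ↔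
      0 ≤ qf A (chartProj σ R b a z) ∧ qf A (chartProj σ R b a z) ≤ ε))
    {S : Set (Amb n)}
    (hS : ∀ ω : Metric.sphere (0 : EuclideanSpace ℝ (Fin n)) 1, chartProj σ R b a ω.1 ∈ S) :
    (∃ o, IsHomeoidal vol shell S o) ∧
      ∀ o, IsHomeoidal vol shell S o →
        ∃ κ : NNReal, 0 < κ ∧ o = κ • homeoidalMeasure σ R b a := by
  have hfin := h.isFiniteMeasure_homeoidalMeasure
  have hlim := fun f (hf : Continuous f) => h.tendsto_integral_shell hn hvol hmeas hsub hmem hf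
  have hc' : (0 : ℝ) < c := hc
  constructor
  · refine ⟨homeoidalMeasure σ R b a, hfin, h.homeoidalMeasure_compl hS, 2 / c, by positivity,
      fun f hf => ?_⟩
    have h1 := (hlim f hf).const_mul (2 / (c : ℝ))
    rw [← mul_assoc, show 2 / (c : ℝ) * (c / 2) = 1 by field_simp, one_mul] at h1
    refine h1.congr fun ε => ?_
    ring
  · rintro o ⟨ho, -, d, hd, hto⟩
    have hκ : 0 < d * (c / 2) := by positivity
    refine ⟨⟨d * (c / 2), hκ.le⟩, hκ, ?_⟩
    set κ : NNReal := ⟨d * (c / 2), hκ.le⟩ with hκ'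
    have : IsFiniteMeasure (κ • homeoidalMeasure σ R b a) := inferInstance
    refine ext_of_forall_integral_eq_of_IsFiniteMeasure fun f => ?_
    have h1 := (hlim f f.continuous).const_mul d
    have h2 := hto f f.continuous
    have h3 : Tendsto (fun ε : ℝ => d / ε * ∫ x in shell ε, f x ∂vol) (𝓝[>] 0)
        (𝓝 (d * (c / 2 * ∫ x, f x ∂homeoidalMeasure σ R b a))) :=
      h1.congr fun ε => by ring
    rw [tendsto_nhds_unique h2 h3, integral_smul_nnreal_measure, NNReal.smul_def, smul_eq_mul,
      ← mul_assoc]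
    rfl

end IsPrincipalBasis

end HomeoidalMeasure

/-! ### The kernels of the sphere and of hyperbolic space -/

section Kernels

/-- On the sphere the potential of a unit charge is an odd function of the cosine of the distance,
because the sine is symmetric about `π / 2`. -/
theorem sphU_arccos_neg (n : ℕ) (c : ℝ) :
    sphU n (Real.arccos (-c)) = -sphU n (Real.arccos c) := by
  rw [sphU, sphU, Real.arccos_neg, ← intervalIntegral.integral_symm]
  have h := intervalIntegral.integral_comp_sub_left (a := Real.pi - Real.arccos c)
    (b := Real.pi / 2) (fun t => 1 / Real.sin t ^ (n - 1)) Real.pi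
  simp only [Real.sin_pi_sub] at h
  rw [h]
  congr 1 <;> ring

theorem sphU_arccos_zero (n : ℕ) : sphU n (Real.arccos 0) = 0 := by
  rw [sphU, Real.arccos_zero, intervalIntegral.integral_same]

theorem isKernel_sphU {n : ℕ} (hn : 1 ≤ n) : IsKernel 1 n fun c => sphU n (Real.arccos c) where
  sign := Or.inl rfl
  hasDerivAt := by
    intro c hc
    rw [kernelDomain_one] at hc
    have hs : ∀ t ∈ Ioo 0 Real.pi, 0 < Real.sin t := fun t ht => Real.sin_pos_of_mem_Ioo ht
    have hcont : ContinuousOn (fun t => 1 / Real.sin t ^ (n - 1)) (Ioo 0 Real.pi) :=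
      continuousOn_const.div (Real.continuous_sin.continuousOn.pow _)
        fun t ht => (pow_pos (hs t ht) _).ne'
    have hr : Real.arccos c ∈ Ioo 0 Real.pi :=
      ⟨Real.arccos_pos.2 hc.2, (Real.arccos_le_pi c).lt_of_ne fun h => by
        rw [Real.arccos_eq_pi] at h; linarith [hc.1]⟩
    have hmid : Real.pi / 2 ∈ Ioo 0 Real.pi := by constructor <;> linarith [Real.pi_pos]
    have hsub : uIcc (Real.arccos c) (Real.pi / 2) ⊆ Ioo 0 Real.pi :=
      ordConnected_Ioo.uIcc_subset hr hmid
    have h1 : HasDerivAt (sphU n) (-(1 / Real.sin (Real.arccos c) ^ (n - 1))) (Real.arccos c) :=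
      intervalIntegral.integral_hasDerivAt_left ((hcont.mono hsub).intervalIntegrable)
        (hcont.stronglyMeasurableAtFilter isOpen_Ioo _ hr)
        (hcont.continuousAt (isOpen_Ioo.mem_nhds hr))
    have h2 := h1.comp c (Real.hasDerivAt_arccos (by linarith [hc.1]) (by linarith [hc.2]))
    refine h2.congr_deriv ?_
    rw [Real.sin_arccos]
    have h3 : 0 < √(1 - c ^ 2) := Real.sqrt_pos.2 (by nlinarith [hc.1, hc.2])
    obtain ⟨m, rfl⟩ : ∃ m, n = m + 1 := ⟨n - 1, by omega⟩
    simp only [one_mul, Nat.add_sub_cancel]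
    field_simp
    rw [pow_succ]

theorem integrableOn_inv_sinh_pow {m : ℕ} (hm : 1 ≤ m) {r : ℝ} (hr : 0 < r) :
    IntegrableOn (fun t => 1 / Real.sinh t ^ m) (Ioi r) := by
  have hsr : 0 < Real.sinh r := Real.sinh_pos_iff.2 hr
  have hdom : IntegrableOn (fun t => (Real.sinh r ^ m)⁻¹ * Real.exp r * Real.exp (-t)) (Ioi r) :=
    (integrableOn_exp_neg_Ioi r).const_mul _
  refine Integrable.mono' hdom ?_ ?_
  · refine ContinuousOn.aestronglyMeasurable (continuousOn_const.div
      (Real.continuous_sinh.continuousOn.pow _) fun t ht => ?_) measurableSet_Ioi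
    exact (pow_pos (Real.sinh_pos_iff.2 (hr.trans ht)) _).ne'
  · filter_upwards [ae_restrict_mem measurableSet_Ioi] with t ht
    have ht : r < t := ht
    have hst : 0 < Real.sinh t := Real.sinh_pos_iff.2 (hr.trans ht)
    have hle : Real.sinh r ≤ Real.sinh t := Real.sinh_le_sinh.2 ht.le
    -- `sinh t / sinh r ≥ exp (t - r)` for `r ≤ t`
    have hkey : Real.sinh r * Real.exp (t - r) ≤ Real.sinh t := by
      rw [Real.sinh_eq, Real.sinh_eq]
      have e1 : Real.exp r * Real.exp (t - r) = Real.exp t := by rw [← Real.exp_add]; ring_nf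
      have e2 : Real.exp (-t) ≤ Real.exp (-r) * Real.exp (t - r) := by
        rw [← Real.exp_add]; exact Real.exp_le_exp.2 (by linarith)
      linarith
    rw [Real.norm_of_nonneg (by positivity), one_div, mul_assoc, ← Real.exp_add,
      ← div_eq_inv_mul, inv_eq_one_div, div_le_div_iff₀ (by positivity) (by positivity), one_mul]
    have hexp : Real.exp (r + -t) * Real.exp (t - r) = 1 := by
      rw [← Real.exp_add]; ring_nf; exact Real.exp_zero
    obtain ⟨k, rfl⟩ : ∃ k, m = k + 1 := ⟨m - 1, by omega⟩
    calc Real.sinh r ^ (k + 1)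
        = Real.exp (r + -t) * (Real.sinh r ^ k * (Real.sinh r * Real.exp (t - r))) := by
          rw [pow_succ]; linear_combination (-Real.sinh r ^ k * Real.sinh r) * hexp
      _ ≤ Real.exp (r + -t) * (Real.sinh t ^ k * Real.sinh t) := by
          gcongr
      _ = _ := by rw [pow_succ]

theorem isKernel_hypU {n : ℕ} (hn : 2 ≤ n) :
    IsKernel (-1) n fun c => hypU n (Real.arcosh c) where
  sign := Or.inr rfl
  hasDerivAt := by
    intro c hc
    rw [kernelDomain_neg_one] at hc
    have hc : 1 < c := hc
    have hcont : ContinuousOn (fun t => 1 / Real.sinh t ^ (n - 1)) (Ioi 0) :=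
      continuousOn_const.div (Real.continuous_sinh.continuousOn.pow _)
        fun t ht => (pow_pos (Real.sinh_pos_iff.2 ht) _).ne'
    have hr : Real.arcosh c ∈ Ioi (0 : ℝ) := Real.arcosh_pos hc
    have h1 : HasDerivAt (hypU n) (-(1 / Real.sinh (Real.arcosh c) ^ (n - 1))) (Real.arcosh c) := by
      have hr0 : (0 : ℝ) < Real.arcosh c / 2 := half_pos hr
      set s := Real.arcosh c
      have hint : ∀ x ∈ Ioi (s / 2), hypU n x =
          hypU n (s / 2) - ∫ t in (s / 2)..x, 1 / Real.sinh t ^ (n - 1) := by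
        intro x hx
        rw [hypU, hypU, ← intervalIntegral.integral_interval_add_Ioi
          (integrableOn_inv_sinh_pow (by omega) hr0)
          (integrableOn_inv_sinh_pow (by omega) (hr0.trans hx))]
        ring
      have hsub : uIcc (s / 2) s ⊆ Ioi 0 := ordConnected_Ioi.uIcc_subset hr0 hr
      have h2 := (intervalIntegral.integral_hasDerivAt_right
        ((hcont.mono hsub).intervalIntegrable) (hcont.stronglyMeasurableAtFilter isOpen_Ioi _ hr)
        (hcont.continuousAt (isOpen_Ioi.mem_nhds hr))).const_sub (hypU n (s / 2))
      refine h2.congr_of_eventuallyEq ?_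
      filter_upwards [Ioi_mem_nhds (half_lt_self hr)] with x hx using hint x hx
    have h2 := h1.comp c (Real.hasDerivAt_arcosh hc)
    refine h2.congr_deriv ?_
    rw [Real.sinh_arcosh hc.le]
    have h3 : 0 < √(c ^ 2 - 1) := Real.sqrt_pos.2 (by nlinarith)
    obtain ⟨m, rfl⟩ : ∃ m, n = m + 1 := ⟨n - 1, by omega⟩
    rw [show (-1 : ℝ) * (1 - c ^ 2) = c ^ 2 - 1 by ring]
    simp only [Nat.add_sub_cancel]
    field_simp
    rw [pow_succ]

end Kernels

/-! ### Field and potential of the homeoidal measure -/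

section FieldAndPotential

variable {n : ℕ}

theorem fromCoords_add (R : Matrix (Fin (n + 1)) (Fin (n + 1)) ℝ) (y z : Fin (n + 1) → ℝ) :
    fromCoords R (y + z) = fromCoords R y + fromCoords R z :=
  congrArg (WithLp.toLp 2) (Matrix.mulVec_add R y z)

theorem fromCoords_sub (R : Matrix (Fin (n + 1)) (Fin (n + 1)) ℝ) (y z : Fin (n + 1) → ℝ) :
    fromCoords R (y - z) = fromCoords R y - fromCoords R z :=
  congrArg (WithLp.toLp 2) (Matrix.mulVec_sub R y z)

theorem fromCoords_smul (R : Matrix (Fin (n + 1)) (Fin (n + 1)) ℝ) (r : ℝ)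
    (y : Fin (n + 1) → ℝ) : fromCoords R (r • y) = r • fromCoords R y :=
  congrArg (WithLp.toLp 2) (Matrix.mulVec_smul R r y)

namespace IsPrincipalBasis

variable {σ b : ℝ} {a : Fin n → ℝ} {A R : Matrix (Fin (n + 1)) (Fin (n + 1)) ℝ}

theorem coords_injective (h : IsPrincipalBasis σ b a A R) : Function.Injective (coords σ R) :=
  Function.LeftInverse.injective (g := fromCoords R) h.fromCoords_coords

/-- The chart covers the half of the space form where `y₀ > 0`. -/
theorem exists_eq_chartProj (h : IsPrincipalBasis σ b a A R) {x : Amb n}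
    (hx : qf (formMatrix σ n) x = σ) (h0 : 0 < coords σ R x 0) :
    ∃ u : EuclideanSpace ℝ (Fin n), 0 < chartForm σ b a u u ∧ x = chartProj σ R b a u := by
  have hb := Real.sqrt_pos.2 h.b_pos
  set s := coords σ R x 0 / √b with hs
  have hs0 : 0 < s := div_pos h0 hb
  set u : EuclideanSpace ℝ (Fin n) :=
    WithLp.toLp 2 fun i => coords σ R x i.succ / (s * √(a i)) with hu
  have hxu : x = s • chartPoint R b a u := by
    refine h.coords_injective (funext fun i => ?_)
    rw [coords_smul, Pi.smul_apply, smul_eq_mul]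
    refine Fin.cases ?_ (fun j => ?_) i
    · rw [h.coords_chartPoint_zero, hs, div_mul_cancel₀ _ hb.ne']
    · have := Real.sqrt_pos.2 (h.a_pos j)
      rw [h.coords_chartPoint_succ, hu]
      field_simp
  have hN : s ^ 2 * chartForm σ b a u u = 1 := by
    rw [← h.qf_form_chartPoint, mul_left_comm, ← qf_smul, ← hxu, hx, h.sq_eq_one]
  have hpos : 0 < chartForm σ b a u u := by
    by_contra hcon
    nlinarith [mul_nonneg (sq_nonneg s) (sub_nonneg.2 (not_lt.1 hcon))]
  refine ⟨u, hpos, ?_⟩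
  have h1 : s * √(chartForm σ b a u u) = 1 := by
    refine (sq_eq_sq₀ (by positivity) zero_le_one).1 ?_
    rw [mul_pow, Real.sq_sqrt hpos.le, hN, one_pow]
  rw [chartProj, ← eq_one_div_of_mul_eq_one_left h1]
  exact hxu

theorem bil_chartProj (h : IsPrincipalBasis σ b a A R) (u v : EuclideanSpace ℝ (Fin n)) :
    σ * bil (formMatrix σ n) (chartProj σ R b a u) (chartProj σ R b a v) =
      chartForm σ b a u v / (√(chartForm σ b a u u) * √(chartForm σ b a v v)) := by
  rw [chartProj, chartProj, bil_smul_left, bil_smul_right, h.bil_chartPoint]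
  linear_combination (1 / √(chartForm σ b a u u) * (1 / √(chartForm σ b a v v)) *
    chartForm σ b a u v) * h.sq_eq_one

/-- For two distinct points of the chart, the (hyperbolic) cosine of the distance lies in the domain of
the kernel. -/
theorem bil_chartProj_mem (h : IsPrincipalBasis σ b a A R) {u v : EuclideanSpace ℝ (Fin n)}
    (hu : 0 < chartForm σ b a u u) (hv : 0 < chartForm σ b a v v) (huv : v ≠ u) :
    σ * bil (formMatrix σ n) (chartProj σ R b a u) (chartProj σ R b a v) ∈ kernelDomain σ := by
  rw [h.bil_chartProj]
  exact (chartForm_quotient_mem h.sign h.b_pos h.a_pos hu hv huv).2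

theorem continuous_bil_sphere (h : IsPrincipalBasis σ b a A R) (x : Amb n) :
    Continuous fun ω : Metric.sphere (0 : EuclideanSpace ℝ (Fin n)) 1 =>
      σ * bil (formMatrix σ n) x (chartProj σ R b a ω.1) :=
  continuous_const.mul ((continuous_bil_left _ x).comp h.continuous_chartProj_sphere)

/-- Away from the ellipsoid the integrand of the field is continuous on the ellipsoid. -/
theorem integrable_force (h : IsPrincipalBasis σ b a A R) {x : Amb n}
    (hx : ∀ ω : Metric.sphere (0 : EuclideanSpace ℝ (Fin n)) 1,
      σ * bil (formMatrix σ n) x (chartProj σ R b a ω.1) ∈ kernelDomain σ) :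
    Integrable (fun y => (√(σ * (1 - (σ * bil (formMatrix σ n) x y) ^ 2)) ^ n)⁻¹ •
      (y - (σ * bil (formMatrix σ n) x y) • x)) (homeoidalMeasure σ R b a) := by
  have hc := h.continuous_bil_sphere x
  refine h.integrable_homeoidalMeasure (Continuous.smul (Continuous.inv₀ (Continuous.pow
    (Continuous.sqrt (continuous_const.mul (continuous_const.sub (hc.pow 2)))) n) ?_) ?_)
  · exact fun ω => (pow_pos (Real.sqrt_pos.2 (hx ω).1) n).ne'
  · exact h.continuous_chartProj_sphere.sub (hc.smul continuous_const)

theorem integrable_potential (h : IsPrincipalBasis σ b a A R) {U : ℝ → ℝ} (hU : IsKernel σ n U)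
    {x : Amb n} (hx : ∀ ω : Metric.sphere (0 : EuclideanSpace ℝ (Fin n)) 1,
      σ * bil (formMatrix σ n) x (chartProj σ R b a ω.1) ∈ kernelDomain σ) :
    Integrable (fun y => U (σ * bil (formMatrix σ n) x y)) (homeoidalMeasure σ R b a) :=
  h.integrable_homeoidalMeasure
    (hU.continuousOn.comp_continuous (h.continuous_bil_sphere x) hx)

/-- The component of `chartPoint ω` orthogonal to `chartPoint u`, which is linear in
`ζ = ω - u`. -/
noncomputable def tangentMap (σ : ℝ) (R : Matrix (Fin (n + 1)) (Fin (n + 1)) ℝ) (b : ℝ)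
    (a : Fin n → ℝ) (u : EuclideanSpace ℝ (Fin n)) : EuclideanSpace ℝ (Fin n) →L[ℝ] Amb n :=
  LinearMap.toContinuousLinearMap
    { toFun := fun ζ => fromCoords R (Fin.cons 0 fun i => √(a i) * ζ i) -
        (σ * (∑ i, a i * u i * ζ i) / chartForm σ b a u u) • chartPoint R b a u
      map_add' := fun ζ ξ => by
        have h1 : fromCoords R (Fin.cons 0 fun i => √(a i) * (ζ + ξ) i) =
            fromCoords R (Fin.cons 0 fun i => √(a i) * ζ i) +
              fromCoords R (Fin.cons 0 fun i => √(a i) * ξ i) := by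
          rw [← fromCoords_add]
          congr 1
          ext i
          refine Fin.cases ?_ (fun j => ?_) i <;> simp [mul_add]
        rw [h1]
        simp only [PiLp.add_apply, mul_add, Finset.sum_add_distrib, add_div, add_smul]
        abel
      map_smul' := fun r ζ => by
        have h1 : fromCoords R (Fin.cons 0 fun i => √(a i) * (r • ζ) i) =
            r • fromCoords R (Fin.cons 0 fun i => √(a i) * ζ i) := by
          rw [← fromCoords_smul]
          congr 1
          ext i
          refine Fin.cases ?_ (fun j => ?_) i
          · simp
          · simp only [Fin.cons_succ, PiLp.smul_apply, Pi.smul_apply, smul_eq_mul]; ring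
        have h2 : ∑ i, a i * u i * (r • ζ) i = r * ∑ i, a i * u i * ζ i := by
          rw [Finset.mul_sum]
          refine Finset.sum_congr rfl fun i _ => ?_
          rw [PiLp.smul_apply, smul_eq_mul]; ring
        rw [h1, h2, RingHom.id_apply, smul_sub, smul_smul]
        congr 2
        ring }

theorem tangentMap_sub {u v : EuclideanSpace ℝ (Fin n)} (hu : 0 < chartForm σ b a u u) :
    tangentMap σ R b a u (v - u) = chartPoint R b a v -
      (chartForm σ b a u v / chartForm σ b a u u) • chartPoint R b a u := by
  have h1 : fromCoords R (Fin.cons 0 fun i => √(a i) * (v - u) i) =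
      chartPoint R b a v - chartPoint R b a u := by
    rw [chartPoint, chartPoint, ← fromCoords_sub]
    congr 1
    ext i
    refine Fin.cases ?_ (fun j => ?_) i <;> simp [mul_sub]
  have h2 : σ * (∑ i, a i * u i * (v - u) i) = chartForm σ b a u v - chartForm σ b a u u := by
    simp only [chartForm, PiLp.sub_apply, mul_sub, Finset.sum_sub_distrib]
    ring
  change fromCoords R (Fin.cons 0 fun i => √(a i) * (v - u) i) - (_ / _) • _ = _
  rw [h1, h2, sub_div, div_self hu.ne', sub_smul, one_smul]
  abel

/-- The field of the homeoidal measure vanishes inside the ellipsoid: the powers of `N(ω)` cancel, and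
Newton's theorem in the chart applies. -/
theorem integral_force_eq_zero (hn : 2 ≤ n) (h : IsPrincipalBasis σ b a A R)
    {u : EuclideanSpace ℝ (Fin n)} (hu : 0 < chartForm σ b a u u) (hu1 : ‖u‖ < 1) :
    ∫ y, (√(σ * (1 - (σ * bil (formMatrix σ n) (chartProj σ R b a u) y) ^ 2)) ^ n)⁻¹ •
      (y - (σ * bil (formMatrix σ n) (chartProj σ R b a u) y) • chartProj σ R b a u)
        ∂homeoidalMeasure σ R b a = 0 := by
  have h0 := integral_gramForm_eq_zero hn h.sign h.b_pos h.a_pos hu hu1 (tangentMap σ R b a u)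
  have h1 := congrArg (fun w => √(chartForm σ b a u u) ^ n • w) h0
  beta_reduce at h1
  rw [smul_zero, ← integral_smul] at h1
  rw [h.integral_homeoidalMeasure, ← h1]
  refine integral_congr_ae (Eventually.of_forall fun ω => ?_)
  beta_reduce
  have hω := h.chartForm_sphere_pos ω
  have hne : ω.1 ≠ u := by
    rintro rfl
    exact hu1.ne (norm_eq_of_mem_sphere ω)
  have hq := (chartForm_quotient_mem h.sign h.b_pos h.a_pos hu hω hne).1
  have hg := gramForm_pos h.sign h.b_pos h.a_pos hu (sub_ne_zero.2 hne)
  rw [h.bil_chartProj, hq, tangentMap_sub hu, Real.sqrt_div hg.le, Real.sqrt_mul hu.le]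
  have su := Real.sqrt_pos.2 hu
  have sω := Real.sqrt_pos.2 hω
  have sg := Real.sqrt_pos.2 hg
  have hvec : chartProj σ R b a ω.1 - (chartForm σ b a u ω.1 /
      (√(chartForm σ b a u u) * √(chartForm σ b a ω.1 ω.1))) • chartProj σ R b a u =
      (1 / √(chartForm σ b a ω.1 ω.1)) • (chartPoint R b a ω.1 -
        (chartForm σ b a u ω.1 / chartForm σ b a u u) • chartPoint R b a u) := by
    rw [chartProj, chartProj, smul_sub, smul_smul, smul_smul]
    congr 2
    rw [show chartForm σ b a u ω.1 / chartForm σ b a u u = chartForm σ b a u ω.1 /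
      (√(chartForm σ b a u u) * √(chartForm σ b a u u)) by rw [Real.mul_self_sqrt hu.le]]
    field_simp
  rw [hvec, smul_smul, smul_smul, smul_smul]
  congr 1
  obtain ⟨m, rfl⟩ : ∃ m, n = m + 1 := ⟨n - 1, by omega⟩
  simp only [Nat.add_sub_cancel, div_pow, mul_pow]
  field_simp
  ring

/-- Confocal quadrics have the same principal basis. -/
theorem isPrincipalBasis_confocal (h : IsPrincipalBasis σ b a A R) {l : ℝ} (hl : l ≤ 0)
    (hbl : 0 < b + σ * l) :
    IsPrincipalBasis σ (b + σ * l) (fun i => a i - l) (confocal (formMatrix σ n) A l) R where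
  sign := h.sign
  b_pos := hbl
  a_pos i := by linarith [h.a_pos i]
  add_pos i := by linarith [h.add_pos i]
  form := h.form
  quadric := by
    have hal : ∀ i, a i - l ≠ 0 := fun i =>
      (show 0 < a i - l by linarith [h.a_pos i]).ne'
    have hR : IsUnit R.det := (Matrix.isUnit_iff_isUnit_det _).1
      (IsUnit.of_mul_eq_one_right _ h.left_inv)
    have hRt : IsUnit Rᵀ.det := by rwa [Matrix.det_transpose]
    have key : ∀ {M D : Matrix (Fin (n + 1)) (Fin (n + 1)) ℝ}, Rᵀ * M * R = D →
        M⁻¹ = R * D⁻¹ * Rᵀ := by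
      rintro M D rfl
      rw [Matrix.mul_inv_rev, Matrix.mul_inv_rev, Matrix.mul_nonsing_inv_cancel_left _ _ hR,
        Matrix.nonsing_inv_mul_cancel_right _ _ hRt]
    have hG : (formMatrix σ n)⁻¹ = formMatrix σ n :=
      Matrix.inv_eq_right_inv (formMatrix_mul_self h.sq_eq_one)
    have hΛ : (Matrix.diagonal (Fin.cons (-(1 / b)) fun i => 1 / a i : Fin (n + 1) → ℝ))⁻¹ =
        Matrix.diagonal (Fin.cons (-b) a : Fin (n + 1) → ℝ) := by
      refine Matrix.inv_eq_right_inv ?_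
      rw [Matrix.diagonal_mul_diagonal, ← Matrix.diagonal_one]
      congr 1
      ext i
      refine Fin.cases ?_ (fun j => ?_) i
      · simp [h.b_pos.ne']
      · simp [(h.a_pos j).ne']
    have hG2 := key h.form
    rw [hG] at hG2
    have h1 : A⁻¹ - l • formMatrix σ n = R * Matrix.diagonal
        (Fin.cons (-(b + σ * l)) fun i => a i - l : Fin (n + 1) → ℝ) * Rᵀ := by
      rw [key h.quadric, hΛ]
      nth_rewrite 1 [hG2]
      rw [← Matrix.smul_mul, ← Matrix.mul_smul, ← Matrix.sub_mul, ← Matrix.mul_sub, formMatrix,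
        ← Matrix.diagonal_smul, Matrix.diagonal_sub]
      congr 3
      ext i
      refine Fin.cases ?_ (fun j => ?_) i
      · simp; ring
      · simp
    rw [confocal, h1, Matrix.mul_inv_rev, Matrix.mul_inv_rev,
      Matrix.mul_nonsing_inv_cancel_left _ _ hRt, Matrix.nonsing_inv_mul_cancel_right _ _ hR]
    refine Matrix.inv_eq_right_inv ?_
    rw [Matrix.diagonal_mul_diagonal, ← Matrix.diagonal_one]
    congr 1
    ext i
    refine Fin.cases ?_ (fun j => ?_) i
    · simp only [Fin.cons_zero]
      field_simp
    · simp only [Fin.cons_succ]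
      field_simp [hal j]

/-- Points of a confocal ellipsoid in the chart of that ellipsoid. -/
theorem exists_eq_chartProj_confocal (h : IsPrincipalBasis σ b a A R) {l : ℝ} (hl : l ≤ 0)
    (hbl : 0 < b + σ * l) {x : Amb n} (hx : qf (formMatrix σ n) x = σ)
    (h0 : 0 < coords σ R x 0) (hq : qf (confocal (formMatrix σ n) A l) x = 0) :
    ∃ η : Metric.sphere (0 : EuclideanSpace ℝ (Fin n)) 1,
      x = chartProj σ R (b + σ * l) (fun i => a i - l) η.1 := by
  have hc := h.isPrincipalBasis_confocal hl hbl
  obtain ⟨u, hu, rfl⟩ := hc.exists_eq_chartProj hx h0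
  rw [hc.qf_quadric_chartProj hu, div_eq_zero_iff, or_iff_left hu.ne', sub_eq_zero,
    pow_eq_one_iff_of_nonneg (norm_nonneg u) two_ne_zero] at hq
  exact ⟨⟨u, by simpa using hq⟩, rfl⟩

/-- The potential is constant on the confocal ellipsoids. -/
theorem integral_potential_confocal (hn : 2 ≤ n) (h : IsPrincipalBasis σ b a A R) {U : ℝ → ℝ}
    (hU : IsKernel σ n U) {l : ℝ} (hl : l < 0) (hbl : 0 < b + σ * l) {x : Amb n}
    (hx : qf (formMatrix σ n) x = σ) (h0 : 0 < coords σ R x 0)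
    (hq : qf (confocal (formMatrix σ n) A l) x = 0) :
    ∫ y, U (σ * bil (formMatrix σ n) x y) ∂homeoidalMeasure σ R b a = levelValue σ b a U l := by
  obtain ⟨η, rfl⟩ := h.exists_eq_chartProj_confocal hl.le hbl hx h0 hq
  have hc := h.isPrincipalBasis_confocal hl.le hbl
  rw [← integral_kernel_confocal hn hU h.b_pos h.a_pos h.add_pos hl hbl η,
    h.integral_homeoidalMeasure]
  refine integral_congr_ae (Eventually.of_forall fun ω => ?_)
  beta_reduce
  rw [smul_eq_mul]
  congr 2
  rw [h.bil_form, chartProj, chartProj, coords_smul, coords_smul, chartForm_confocal_self]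
  simp only [Pi.smul_apply, smul_eq_mul, h.coords_chartPoint_zero, h.coords_chartPoint_succ,
    hc.coords_chartPoint_zero, hc.coords_chartPoint_succ]
  set p := √(chartForm σ b a η.1 η.1)
  set r := √(chartForm σ b a ω.1 ω.1)
  have h1 : ∑ i, 1 / p * (√(a i - l) * η.1 i) * (1 / r * (√(a i) * ω.1 i)) =
      1 / (p * r) * ∑ i, √(a i - l) * √(a i) * η.1 i * ω.1 i := by
    rw [Finset.mul_sum]
    refine Finset.sum_congr rfl fun i _ => ?_
    rw [one_div_mul_eq_div, one_div_mul_eq_div, one_div_mul_eq_div, div_mul_div_comm]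
    ring
  rw [h1, div_eq_mul_one_div, ← one_div_mul_one_div p r]
  linear_combination (√(b + σ * l) * √b * (1 / p * (1 / r))) * h.sq_eq_one

/-- Confocal ellipsoids with negative parameter lie outside the ellipsoid. -/
theorem qf_pos_of_confocal (h : IsPrincipalBasis σ b a A R) {l : ℝ} (hl : l < 0)
    (hbl : 0 < b + σ * l) {x : Amb n} (hx : qf (formMatrix σ n) x = σ)
    (h0 : 0 < coords σ R x 0) (hq : qf (confocal (formMatrix σ n) A l) x = 0) :
    0 < qf A x := by
  obtain ⟨η, rfl⟩ := h.exists_eq_chartProj_confocal hl.le hbl hx h0 hq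
  have hc := h.isPrincipalBasis_confocal hl.le hbl
  have hN := hc.chartForm_sphere_pos η
  have hη : ∑ i, η.1 i ^ 2 = 1 := by
    rw [← EuclideanSpace.real_norm_sq_eq, norm_eq_of_mem_sphere η, one_pow]
  rw [chartProj, qf_smul, h.qf_quadric, hc.coords_chartPoint_zero, Real.sq_sqrt hbl.le]
  refine mul_pos (pow_pos (one_div_pos.2 (Real.sqrt_pos.2 hN)) 2) ?_
  have h1 : ∑ i, coords σ R (chartPoint R (b + σ * l) (fun i => a i - l) η.1) i.succ ^ 2 / a i -
      (b + σ * l) / b = ∑ i, (-l * (1 / a i + σ / b)) * η.1 i ^ 2 := by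
    have h2 : (b + σ * l) / b = ∑ i, ((b + σ * l) / b) * η.1 i ^ 2 := by
      rw [← Finset.mul_sum, hη, mul_one]
    rw [h2, ← Finset.sum_sub_distrib]
    refine Finset.sum_congr rfl fun i _ => ?_
    have ha := h.a_pos i
    have hb := h.b_pos
    rw [hc.coords_chartPoint_succ, mul_pow, Real.sq_sqrt (by linarith)]
    field_simp
    ring
  rw [h1]
  have hpos : ∀ i, 0 < -l * (1 / a i + σ / b) := fun i => by
    have ha := h.a_pos i
    have hb := h.b_pos
    have := h.add_pos i
    refine mul_pos (neg_pos.2 hl) ?_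
    rw [div_add_div _ _ ha.ne' hb.ne']
    refine div_pos (by linarith) (by positivity)
  obtain ⟨i, hi⟩ : ∃ i, η.1 i ≠ 0 := by
    by_contra hcon
    push Not at hcon
    simp [hcon] at hη
  exact Finset.sum_pos' (fun j _ => mul_nonneg (hpos j).le (sq_nonneg _))
    ⟨i, Finset.mem_univ i, mul_pos (hpos i) (by positivity)⟩

/-- Existence of the confocal ellipsoid through an outer point, by the intermediate value theorem for
`(b + σ l) q_l(x)`. -/
theorem exists_confocal (h : IsPrincipalBasis σ b a A R) {x : Amb n} (hA : 0 < qf A x) {m : ℝ}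
    (hm : m < 0) (hbm : ∀ l ∈ Ioo m 0, 0 < b + σ * l)
    (hneg : (b + σ * m) * ∑ i, coords σ R x i.succ ^ 2 / (a i - m) < coords σ R x 0 ^ 2) :
    ∃ l ∈ Ioo m 0, qf (confocal (formMatrix σ n) A l) x = 0 := by
  set g : ℝ → ℝ := fun l =>
    (b + σ * l) * (∑ i, coords σ R x i.succ ^ 2 / (a i - l)) - coords σ R x 0 ^ 2 with hg
  have hcont : ContinuousOn g (Icc m 0) := by
    refine ContinuousOn.sub (ContinuousOn.mul (by fun_prop) ?_) continuousOn_const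
    refine continuousOn_finsetSum _ fun i _ => ContinuousOn.div continuousOn_const (by fun_prop) ?_
    intro l hl
    have := h.a_pos i
    have := hl.2
    linarith
  have hg0 : 0 < g 0 := by
    have : g 0 = b * qf A x := by
      have hb := h.b_pos
      rw [h.qf_quadric, hg]
      simp only [mul_zero, add_zero, sub_zero]
      field_simp
    rw [this]
    exact mul_pos h.b_pos hA
  obtain ⟨l, hl, hgl⟩ := intermediate_value_Ioo hm.le hcont ⟨sub_neg.2 hneg, hg0⟩
  refine ⟨l, hl, ?_⟩
  have hbl := hbm l hl
  rw [(h.isPrincipalBasis_confocal hl.2.le hbl).qf_quadric]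
  have : g l = 0 := hgl
  rw [sub_eq_zero, eq_div_iff hbl.ne', mul_comm]
  exact sub_eq_zero.1 this

end IsPrincipalBasis

end FieldAndPotential

/-! ### Level sets of the potential -/

section LevelSets

variable {n : ℕ}

theorem qf_neg (M : Matrix (Fin (n + 1)) (Fin (n + 1)) ℝ) (x : Amb n) : qf M (-x) = qf M x := by
  simp [qf, bil, Matrix.mulVec_neg]

namespace IsPrincipalBasis

variable {σ b : ℝ} {a : Fin n → ℝ} {A R : Matrix (Fin (n + 1)) (Fin (n + 1)) ℝ}

theorem qf_quadric_chartProj_sphere (h : IsPrincipalBasis σ b a A R)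
    (ω : Metric.sphere (0 : EuclideanSpace ℝ (Fin n)) 1) : qf A (chartProj σ R b a ω.1) = 0 := by
  rw [h.qf_quadric_chartProj (h.chartForm_sphere_pos ω), norm_eq_of_mem_sphere ω]
  simp

theorem bil_mem_kernelDomain (h : IsPrincipalBasis σ b a A R) {x : Amb n}
    (hx : qf (formMatrix σ n) x = σ) (h0 : 0 < coords σ R x 0) (hA : qf A x ≠ 0)
    (ω : Metric.sphere (0 : EuclideanSpace ℝ (Fin n)) 1) :
    σ * bil (formMatrix σ n) x (chartProj σ R b a ω.1) ∈ kernelDomain σ := by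
  obtain ⟨u, hu, rfl⟩ := h.exists_eq_chartProj hx h0
  refine h.bil_chartProj_mem hu (h.chartForm_sphere_pos ω) ?_
  rintro rfl
  exact hA (h.qf_quadric_chartProj_sphere ω)

theorem ae_bil_mem_kernelDomain (h : IsPrincipalBasis σ b a A R) {x : Amb n}
    (hx : ∀ ω : Metric.sphere (0 : EuclideanSpace ℝ (Fin n)) 1,
      σ * bil (formMatrix σ n) x (chartProj σ R b a ω.1) ∈ kernelDomain σ) :
    ∀ᵐ y ∂homeoidalMeasure σ R b a, σ * bil (formMatrix σ n) x y ∈ kernelDomain σ :=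
  h.homeoidalMeasure_compl (S := {y | σ * bil (formMatrix σ n) x y ∈ kernelDomain σ}) hx

theorem field_eq_zero (hn : 2 ≤ n) (h : IsPrincipalBasis σ b a A R)
    {force : Amb n → Amb n → Amb n}
    (hforce : ∀ p y, σ * bil (formMatrix σ n) p y ∈ kernelDomain σ → force p y =
      -((√(σ * (1 - (σ * bil (formMatrix σ n) p y) ^ 2)) ^ n)⁻¹ •
        (y - (σ * bil (formMatrix σ n) p y) • p)))
    (κ : NNReal) {p : Amb n} (hp : qf (formMatrix σ n) p = σ) (h0 : 0 < coords σ R p 0)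
    (hA : qf A p < 0) :
    Integrable (force p) (κ • homeoidalMeasure σ R b a) ∧
      ∫ y, force p y ∂(κ • homeoidalMeasure σ R b a) = 0 := by
  have hmem := h.bil_mem_kernelDomain hp h0 hA.ne
  have hae : force p =ᵐ[homeoidalMeasure σ R b a] fun y =>
      -((√(σ * (1 - (σ * bil (formMatrix σ n) p y) ^ 2)) ^ n)⁻¹ •
        (y - (σ * bil (formMatrix σ n) p y) • p)) :=
    (h.ae_bil_mem_kernelDomain hmem).mono fun y hy => hforce p y hy
  refine ⟨((h.integrable_force hmem).neg.congr hae.symm).smul_measure_nnreal, ?_⟩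
  rw [integral_smul_nnreal_measure, integral_congr_ae hae, integral_neg]
  obtain ⟨u, hu, rfl⟩ := h.exists_eq_chartProj hp h0
  rw [h.qf_quadric_chartProj hu] at hA
  have hu1 : ‖u‖ < 1 := by
    by_contra hcon
    exact absurd hA (not_lt.2 (div_nonneg (by nlinarith) hu.le))
  rw [h.integral_force_eq_zero hn hu hu1, neg_zero, smul_zero]

/-- The levels of the potential separate the confocal ellipsoids. -/
theorem integral_potential_eq_levelValue_iff (hn : 2 ≤ n) (h : IsPrincipalBasis σ b a A R)
    {U : ℝ → ℝ} (hU : IsKernel σ n U) {x : Amb n} (hx : qf (formMatrix σ n) x = σ)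
    (h0 : 0 < coords σ R x 0)
    (hex : ∃ m < 0, 0 < b + σ * m ∧ qf (confocal (formMatrix σ n) A m) x = 0)
    {l : ℝ} (hl : l < 0) (hbl : 0 < b + σ * l) :
    ∫ y, U (σ * bil (formMatrix σ n) x y) ∂homeoidalMeasure σ R b a = levelValue σ b a U l ↔
      qf (confocal (formMatrix σ n) A l) x = 0 := by
  refine ⟨fun heq => ?_, h.integral_potential_confocal hn hU hl hbl hx h0⟩
  obtain ⟨m, hm, hbm, hqm⟩ := hex
  rw [h.integral_potential_confocal hn hU hm hbm hx h0 hqm] at heq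
  have := (levelValue_strictMonoOn hn hU h.b_pos h.a_pos h.add_pos).injOn ⟨hm, hbm⟩ ⟨hl, hbl⟩ heq
  rwa [← this]

/-- The potential vanishes on the hyperplane of symmetry if it is an odd function of `cos r`. -/
theorem integral_potential_eq_zero (h : IsPrincipalBasis σ b a A R) {U : ℝ → ℝ}
    (hU : ∀ c, U (-c) = -U c) {x : Amb n} (h0 : coords σ R x 0 = 0) :
    ∫ y, U (σ * bil (formMatrix σ n) x y) ∂homeoidalMeasure σ R b a = 0 := by
  have hN : ∀ z : EuclideanSpace ℝ (Fin n), chartForm σ b a (-z) (-z) = chartForm σ b a z z := by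
    intro z
    simp [chartForm]
  have hodd : ∀ z : EuclideanSpace ℝ (Fin n), bil (formMatrix σ n) x (chartProj σ R b a (-z)) =
      -bil (formMatrix σ n) x (chartProj σ R b a z) := by
    intro z
    rw [h.bil_form, h.bil_form, h0, chartProj, chartProj, coords_smul, coords_smul, hN]
    simp [h.coords_chartPoint_succ]
  rw [h.integral_homeoidalMeasure]
  have h1 := integral_neg_toSphere (volume : Measure (EuclideanSpace ℝ (Fin n)))
    (fun ω : Metric.sphere (0 : EuclideanSpace ℝ (Fin n)) 1 =>
      (√(chartForm σ b a ω.1 ω.1) ^ (n - 1))⁻¹ •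
        U (σ * bil (formMatrix σ n) x (chartProj σ R b a ω.1)))
  have h2 : ∀ ω : Metric.sphere (0 : EuclideanSpace ℝ (Fin n)) 1, ((-ω : Metric.sphere _ _) :
      EuclideanSpace ℝ (Fin n)) = -ω.1 := fun ω => rfl
  simp only [h2, hN, hodd, mul_neg, hU, smul_neg, integral_neg] at h1
  linarith

end IsPrincipalBasis

end LevelSets

/-! ### The sphere -/

section Sphere

variable {n : ℕ}

theorem bil_one (x y : Amb n) : bil (formMatrix 1 n) x y = inner ℝ x y := by
  rw [formMatrix_one, bil, Matrix.one_mulVec, EuclideanSpace.inner_eq_star_dotProduct,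
    dotProduct_comm]
  simp

theorem qf_one (x : Amb n) : qf (formMatrix 1 n) x = ‖x‖ ^ 2 := by
  rw [qf, bil_one, real_inner_self_eq_norm_sq]

theorem mem_sph_iff {x : Amb n} : x ∈ sph n ↔ qf (formMatrix 1 n) x = 1 := by
  rw [sph, mem_sphere_zero_iff_norm, qf_one, pow_eq_one_iff_of_nonneg (norm_nonneg x) two_ne_zero]

theorem coords_one_zero {R : Matrix (Fin (n + 1)) (Fin (n + 1)) ℝ} {e : Amb n}
    (he : R *ᵥ Pi.single 0 1 = e.ofLp) (x : Amb n) : coords 1 R x 0 = inner ℝ e x := by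
  rw [← bil_one, bil, formMatrix_one, Matrix.one_mulVec, ← he, coords, formMatrix_one,
    Matrix.one_mul, Matrix.mul_one, Matrix.mulVec_single_one]
  rfl

/-- The volume of the sphere as a measure of cones, in the same form as the volume of hyperbolic space. -/
theorem sphVol_eq : sphVol n = ((n : ENNReal) + 1) • ((volume : Measure (Amb n)).restrict
      {x | 0 < 1 * qf (formMatrix 1 n) x ∧ 1 * qf (formMatrix 1 n) x < 1}).map
        fun x => (1 / √(1 * qf (formMatrix 1 n) x)) • x := by
  have hπ : Measurable fun x : Amb n => (1 / √(1 * qf (formMatrix 1 n) x)) • x :=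
    (measurable_const.div (continuous_const.mul (continuous_qf _)).sqrt.measurable).smul
      measurable_id
  ext s hs
  rw [sphVol, Measure.map_apply measurable_subtype_coe hs,
    Measure.toSphere_apply' _ (measurable_subtype_coe hs), Measure.smul_apply,
    Measure.map_apply hπ hs, Measure.restrict_apply (hπ hs), finrank_euclideanSpace_fin,
    smul_eq_mul, Nat.cast_add, Nat.cast_one]
  congr 2
  ext x
  simp only [one_mul, qf_one, Real.sqrt_sq (norm_nonneg x), mem_inter_iff, mem_preimage,
    mem_ofPred_eq]
  constructor
  · rintro ⟨r, hr, y, ⟨ω, hω, rfl⟩, rfl⟩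
    have hω1 : ‖(ω : Amb n)‖ = 1 := norm_eq_of_mem_sphere ω
    have hr1 : ‖r • (ω : Amb n)‖ = r := by rw [norm_smul, hω1, mul_one, Real.norm_of_nonneg hr.1.le]
    beta_reduce
    rw [hr1, smul_smul, one_div_mul_cancel hr.1.ne', one_smul]
    exact ⟨hω, by have := hr.1; positivity, by nlinarith [hr.1, hr.2]⟩
  · rintro ⟨hs', h0, h1⟩
    have hx : 0 < ‖x‖ := (norm_nonneg x).lt_of_ne fun h => by simp [← h] at h0
    refine ⟨‖x‖, ⟨hx, by nlinarith⟩, (1 / ‖x‖) • x, ⟨⟨(1 / ‖x‖) • x, ?_⟩, hs', rfl⟩, ?_⟩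
    · rw [mem_sphere_zero_iff_norm, norm_smul, norm_div, norm_one, norm_norm,
        one_div_mul_cancel hx.ne']
    · beta_reduce
      rw [smul_smul, mul_one_div_cancel hx.ne', one_smul]

theorem sphU_sphDist (x y : Amb n) :
    sphU n (sphDist x y) = sphU n (Real.arccos (1 * bil (formMatrix 1 n) x y)) := by
  rw [one_mul, bil_one, sphDist]

theorem sphForce_eq (hn : 1 ≤ n) {p y : Amb n}
    (hc : 1 * bil (formMatrix 1 n) p y ∈ kernelDomain 1) : sphForce p y =
      -((√(1 * (1 - (1 * bil (formMatrix 1 n) p y) ^ 2)) ^ n)⁻¹ •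
        (y - (1 * bil (formMatrix 1 n) p y) • p)) := by
  rw [kernelDomain_one, one_mul, bil_one] at hc
  rw [sphForce, sphDist, Real.sin_arccos, Real.cos_arccos hc.1.le hc.2.le, one_mul, one_mul,
    bil_one, neg_smul, smul_smul]
  obtain ⟨m, rfl⟩ : ∃ m, n = m + 1 := ⟨n - 1, by omega⟩
  rw [Nat.add_sub_cancel, one_div_mul_one_div, ← pow_succ, one_div]

theorem sphForce_neg {p y : Amb n} : sphForce (-p) y = sphForce p y := by
  have h : sphDist (-p) y = Real.pi - sphDist p y := by
    rw [sphDist, sphDist, inner_neg_left, Real.arccos_neg]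
  rw [sphForce, sphForce, h, Real.sin_pi_sub, Real.cos_pi_sub, neg_smul_neg]

theorem sphPot_neg (o : Measure (Amb n)) (x : Amb n) : sphPot o (-x) = -sphPot o x := by
  rw [sphPot, sphPot, ← integral_neg]
  refine integral_congr_ae (Eventually.of_forall fun y => ?_)
  beta_reduce
  rw [sphDist, inner_neg_left, sphU_arccos_neg, sphDist]

theorem bil_mem_kernelDomain_one {A : Matrix (Fin (n + 1)) (Fin (n + 1)) ℝ} {x y : Amb n}
    (hx : x ∈ sph n) (hy : y ∈ sph n) (hA : qf A x ≠ 0) (hAy : qf A y = 0) :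
    1 * bil (formMatrix 1 n) x y ∈ kernelDomain 1 := by
  rw [kernelDomain_one, one_mul, bil_one]
  have hx1 : ‖x‖ = 1 := by simpa [sph] using hx
  have hy1 : ‖y‖ = 1 := by simpa [sph] using hy
  constructor
  · have := (inner_lt_one_iff_real_of_norm_eq_one (x := -x) (y := y) (by rwa [norm_neg]) hy1).2 (by
      rintro rfl
      rw [qf_neg] at hAy
      exact hA hAy)
    rw [inner_neg_left] at this
    linarith
  · exact (inner_lt_one_iff_real_of_norm_eq_one hx1 hy1).2 (by rintro rfl; exact hA hAy)

variable {b : ℝ} {a : Fin n → ℝ} {A R : Matrix (Fin (n + 1)) (Fin (n + 1)) ℝ} {e : Amb n}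

theorem isHomeoidal_sphere (hn : 2 ≤ n) (h : IsPrincipalBasis 1 b a A R)
    (he : R *ᵥ Pi.single 0 1 = e.ofLp) :
    (∃ o, IsHomeoidal (sphVol n) (sphShell A e) (sphEll A e) o) ∧
      ∀ o, IsHomeoidal (sphVol n) (sphShell A e) (sphEll A e) o →
        ∃ κ : NNReal, 0 < κ ∧ o = κ • homeoidalMeasure 1 R b a := by
  have hq : Continuous (qf A : Amb n → ℝ) := continuous_qf A
  have hi : Continuous fun x : Amb n => (inner ℝ e x : ℝ) := by fun_prop
  have hqG : Continuous fun x : Amb n => 1 * qf (formMatrix 1 n) x :=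
    continuous_const.mul (continuous_qf _)
  obtain ⟨c, hc, hvol⟩ := h.exists_restrict_eq_map
    ((measurableSet_lt measurable_const hqG.measurable).inter
      (measurableSet_lt hqG.measurable measurable_const)) sphVol_eq fun x _ => Iff.rfl
  have hmem : ∀ z : EuclideanSpace ℝ (Fin n), 0 < chartForm 1 b a z z →
      chartProj 1 R b a z ∈ sph n ∧ 0 < inner ℝ e (chartProj 1 R b a z) := fun z hz =>
    ⟨mem_sph_iff.2 (h.qf_form_chartProj hz), by
      rw [← coords_one_zero he]; exact h.coords_chartProj_zero_pos hz⟩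
  refine h.isHomeoidal_exists_and_unique hn hc hvol (fun ε => ?_) (fun ε x hx => ?_)
    (fun ε z hz => ?_) (fun ω => ?_)
  · exact Metric.isClosed_sphere.measurableSet.inter
      ((measurableSet_le measurable_const hq.measurable).inter
        ((measurableSet_le hq.measurable measurable_const).inter
          (measurableSet_lt measurable_const hi.measurable)))
  · rw [mem_ofPred_eq, coords_one_zero he]
    exact hx.2.2.2
  · have := hmem z hz
    exact ⟨fun hx => ⟨hx.2.1, hx.2.2.1⟩, fun hx => ⟨this.1, hx.1, hx.2, this.2⟩⟩
  · have := hmem ω.1 (h.chartForm_sphere_pos ω)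
    exact ⟨this.1, h.qf_quadric_chartProj_sphere ω, this.2⟩

theorem exists_confocal_sphere (h : IsPrincipalBasis 1 b a A R) {x : Amb n} (hA : 0 < qf A x)
    (h0 : 0 < coords 1 R x 0) :
    ∃ l ∈ Ioo (-b) 0, qf (confocal 1 A l) x = 0 := by
  rw [← formMatrix_one]
  have hb := h.b_pos
  refine h.exists_confocal hA (neg_lt_zero.2 hb) (fun l hl => by linarith [hl.1]) ?_
  rw [one_mul, add_neg_cancel, zero_mul]
  positivity

end Sphere

/-! ### Field and potential on the sphere -/

section SphereTheorem

variable {n : ℕ} {b : ℝ} {a : Fin n → ℝ} {A R : Matrix (Fin (n + 1)) (Fin (n + 1)) ℝ} {e : Amb n}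

theorem neg_mem_sph {x : Amb n} : -x ∈ sph n ↔ x ∈ sph n := by simp [sph]

theorem neg_mem_sphOutside {x : Amb n} : -x ∈ sphOutside A ↔ x ∈ sphOutside A := by
  rw [sphOutside, mem_ofPred_eq, mem_ofPred_eq, neg_mem_sph, qf_neg]

theorem sphPot_smul_homeoidalMeasure (κ : NNReal) (x : Amb n) :
    sphPot (κ • homeoidalMeasure 1 R b a) x = κ * ∫ y,
      sphU n (Real.arccos (1 * bil (formMatrix 1 n) x y)) ∂homeoidalMeasure 1 R b a := by
  simp only [sphPot, sphU_sphDist]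
  rw [integral_smul_nnreal_measure, NNReal.smul_def, smul_eq_mul]

theorem sphField_eq_zero (hn : 2 ≤ n) (h : IsPrincipalBasis 1 b a A R)
    (he : R *ᵥ Pi.single 0 1 = e.ofLp) (κ : NNReal) {p : Amb n}
    (hp : p ∈ sphInside A e ∪ -sphInside A e) :
    Integrable (fun y => sphForce p y) (κ • homeoidalMeasure 1 R b a) ∧
      sphField (κ • homeoidalMeasure 1 R b a) p = 0 := by
  have key : ∀ q ∈ sphInside A e, Integrable (fun y => sphForce q y)
      (κ • homeoidalMeasure 1 R b a) ∧ sphField (κ • homeoidalMeasure 1 R b a) q = 0 :=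
    fun q hq => h.field_eq_zero hn (fun p y => sphForce_eq (by omega)) κ (mem_sph_iff.1 hq.1)
      (by rw [coords_one_zero he]; exact hq.2.2) hq.2.1
  rcases hp with hp | hp
  · exact key p hp
  · have := key (-p) hp
    simpa only [sphField, sphForce_neg] using this

theorem integrable_sphU (hn : 1 ≤ n) (h : IsPrincipalBasis 1 b a A R) (κ : NNReal) {x : Amb n}
    (hx : x ∈ sphOutside A) :
    Integrable (fun y => sphU n (sphDist x y)) (κ • homeoidalMeasure 1 R b a) := by
  simp only [sphU_sphDist]
  refine (h.integrable_potential (isKernel_sphU hn) fun ω => ?_).smul_measure_nnreal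
  exact bil_mem_kernelDomain_one hx.1
    (mem_sph_iff.2 (h.qf_form_chartProj (h.chartForm_sphere_pos ω))) hx.2.ne'
    (h.qf_quadric_chartProj_sphere ω)

/-- By Ivory's theorem and the existence of confocal ellipsoids, the potential has the sign of `⟨e, x⟩`. -/
theorem sphPot_pos (hn : 2 ≤ n) (h : IsPrincipalBasis 1 b a A R)
    (he : R *ᵥ Pi.single 0 1 = e.ofLp) {κ : NNReal} (hκ : 0 < κ) {x : Amb n}
    (hx : x ∈ sphOutside A) (h0 : 0 < inner ℝ e x) :
    0 < sphPot (κ • homeoidalMeasure 1 R b a) x := by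
  rw [← coords_one_zero he] at h0
  obtain ⟨l, hl, hq⟩ := exists_confocal_sphere h hx.2 h0
  rw [← formMatrix_one] at hq
  have hbl : 0 < b + 1 * l := by linarith [hl.1]
  rw [sphPot_smul_homeoidalMeasure, h.integral_potential_confocal hn (isKernel_sphU (by omega))
    hl.2 hbl (mem_sph_iff.1 hx.1) h0 hq]
  exact mul_pos hκ (levelValue_pos hn (isKernel_sphU (by omega)) (sphU_arccos_zero n) h.b_pos
    h.a_pos hl.2 (by linarith [hl.1]))

theorem sphPot_eq_zero (h : IsPrincipalBasis 1 b a A R)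
    (he : R *ᵥ Pi.single 0 1 = e.ofLp) (κ : NNReal) {x : Amb n} (h0 : inner ℝ e x = 0) :
    sphPot (κ • homeoidalMeasure 1 R b a) x = 0 := by
  rw [← coords_one_zero he] at h0
  rw [sphPot_smul_homeoidalMeasure,
    h.integral_potential_eq_zero (U := fun c => sphU n (Real.arccos c)) (sphU_arccos_neg n) h0,
    mul_zero]

theorem sphPot_eq_zero_iff (hn : 2 ≤ n) (h : IsPrincipalBasis 1 b a A R)
    (he : R *ᵥ Pi.single 0 1 = e.ofLp) {κ : NNReal} (hκ : 0 < κ) {x : Amb n}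
    (hx : x ∈ sphOutside A) :
    sphPot (κ • homeoidalMeasure 1 R b a) x = 0 ↔ inner ℝ e x = 0 := by
  refine ⟨fun heq => ?_, sphPot_eq_zero h he κ⟩
  rcases lt_trichotomy (inner ℝ e x : ℝ) 0 with h0 | h0 | h0
  · have := sphPot_pos hn h he hκ (neg_mem_sphOutside.2 hx) (by rw [inner_neg_right]; linarith)
    rw [sphPot_neg] at this
    linarith
  · exact h0
  · exact absurd heq (sphPot_pos hn h he hκ hx h0).ne'

theorem equator_subset_sphOutside (h : IsPrincipalBasis 1 b a A R)
    (he : R *ᵥ Pi.single 0 1 = e.ofLp) {x : Amb n} (hx : x ∈ sph n) (h0 : inner ℝ e x = 0) :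
    x ∈ sphOutside A := by
  refine ⟨hx, ?_⟩
  have h1 := mem_sph_iff.1 hx
  rw [qf, h.bil_form] at h1
  rw [h.qf_quadric]
  rw [← coords_one_zero he] at h0
  rw [h0] at h1 ⊢
  obtain ⟨i, hi⟩ : ∃ i : Fin n, coords 1 R x i.succ ≠ 0 := by
    by_contra hcon
    push Not at hcon
    simp [hcon] at h1
  have : 0 < ∑ i : Fin n, coords 1 R x i.succ ^ 2 / a i :=
    Finset.sum_pos' (fun j _ => div_nonneg (sq_nonneg _) (h.a_pos j).le)
      ⟨i, Finset.mem_univ i, div_pos (by positivity) (h.a_pos i)⟩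
  simpa using this

theorem sphPot_levelSet (hn : 2 ≤ n) (h : IsPrincipalBasis 1 b a A R)
    (he : R *ᵥ Pi.single 0 1 = e.ofLp) {κ : NNReal} (hκ : 0 < κ) {l : ℝ} (hl : l ∈ Ioo (-b) 0) :
    {x ∈ sphOutside A | sphPot (κ • homeoidalMeasure 1 R b a) x =
      κ * levelValue 1 b a (fun c => sphU n (Real.arccos c)) l} = sphEll (confocal 1 A l) e := by
  have hU : IsKernel 1 n fun c => sphU n (Real.arccos c) := isKernel_sphU (by omega)
  have hbl : 0 < b + 1 * l := by linarith [hl.1]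
  have hκ' : (0 : ℝ) < κ := hκ
  have hpos : 0 < κ * levelValue 1 b a (fun c => sphU n (Real.arccos c)) l :=
    mul_pos hκ' (levelValue_pos hn hU (sphU_arccos_zero n) h.b_pos h.a_pos hl.2
      (by linarith [hl.1]))
  ext x
  constructor
  · rintro ⟨hx, hpot⟩
    have h0 : 0 < inner ℝ e x := by
      by_contra hcon
      rcases (not_lt.1 hcon).lt_or_eq with h0 | h0
      · have := sphPot_pos hn h he hκ (neg_mem_sphOutside.2 hx) (by rw [inner_neg_right]; linarith)
        rw [sphPot_neg] at this
        linarith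
      · rw [sphPot_eq_zero h he κ h0] at hpot
        exact hpos.ne hpot
    refine ⟨hx.1, ?_, h0⟩
    rw [← coords_one_zero he] at h0
    obtain ⟨m, hm, hq⟩ := exists_confocal_sphere h hx.2 h0
    rw [← formMatrix_one] at hq ⊢
    rw [sphPot_smul_homeoidalMeasure] at hpot
    exact (h.integral_potential_eq_levelValue_iff hn hU (mem_sph_iff.1 hx.1) h0
      ⟨m, hm.2, by linarith [hm.1], hq⟩ hl.2 hbl).1 (mul_left_cancel₀ hκ'.ne' hpot)
  · rintro ⟨hx, hq, h0⟩
    rw [← coords_one_zero he] at h0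
    rw [← formMatrix_one] at hq
    have hxG := mem_sph_iff.1 hx
    refine ⟨⟨hx, h.qf_pos_of_confocal hl.2 hbl hxG h0 hq⟩, ?_⟩
    rw [sphPot_smul_homeoidalMeasure, h.integral_potential_confocal hn hU hl.2 hbl hxG h0 hq]

end SphereTheorem

/-! ### Hyperbolic space -/

section Hyperbolic

variable {n : ℕ}

theorem hypU_hypDist (x y : Amb n) :
    hypU n (hypDist x y) = hypU n (Real.arcosh (-1 * bil (formMatrix (-1) n) x y)) := by
  rw [neg_one_mul, formMatrix_neg_one, hypDist]

theorem hypForce_eq (hn : 1 ≤ n) {p y : Amb n}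
    (hc : -1 * bil (formMatrix (-1) n) p y ∈ kernelDomain (-1)) : hypForce p y =
      -((√(-1 * (1 - (-1 * bil (formMatrix (-1) n) p y) ^ 2)) ^ n)⁻¹ •
        (y - (-1 * bil (formMatrix (-1) n) p y) • p)) := by
  rw [kernelDomain_neg_one, formMatrix_neg_one, neg_one_mul] at hc
  have hc : 1 ≤ -bil (mink n) p y := le_of_lt hc
  rw [hypForce, hypDist, Real.sinh_arcosh hc, Real.cosh_arcosh hc, formMatrix_neg_one,
    neg_one_mul, neg_smul, smul_smul, neg_one_mul, neg_sub]
  obtain ⟨m, rfl⟩ : ∃ m, n = m + 1 := ⟨n - 1, by omega⟩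
  rw [Nat.add_sub_cancel, one_div_mul_one_div, ← pow_succ, one_div]

theorem bil_mink (x y : Amb n) :
    bil (mink n) x y = -(x 0 * y 0) + ∑ i : Fin n, x i.succ * y i.succ := by
  rw [bil, mink, bil_diagonal_cons]
  simp

/-- Two timelike vectors in the future cone have negative Minkowski product. -/
theorem bil_mink_neg {x y : Amb n} (hx : qf (mink n) x < 0) (hy : qf (mink n) y < 0)
    (hx0 : 0 < x 0) (hy0 : 0 < y 0) : bil (mink n) x y < 0 := by
  rw [qf, bil_mink] at hx hy
  rw [bil_mink]
  simp only [← sq] at hx hy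
  have hcs := Finset.sum_mul_sq_le_sq_mul_sq Finset.univ (fun i : Fin n => x i.succ)
    fun i => y i.succ
  have hX : 0 ≤ ∑ i : Fin n, x i.succ ^ 2 := Finset.sum_nonneg fun i _ => sq_nonneg _
  have hY : 0 ≤ ∑ i : Fin n, y i.succ ^ 2 := Finset.sum_nonneg fun i _ => sq_nonneg _
  have h1 : (∑ i : Fin n, x i.succ * y i.succ) ^ 2 < (x 0 * y 0) ^ 2 := by
    refine hcs.trans_lt ?_
    rw [mul_pow]
    exact mul_lt_mul'' (by linarith) (by linarith) hX hY
  linarith [lt_of_pow_lt_pow_left₀ 2 (mul_pos hx0 hy0).le h1]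

variable {b : ℝ} {a : Fin n → ℝ} {A R : Matrix (Fin (n + 1)) (Fin (n + 1)) ℝ}

theorem coords_zero_pos_of_pos (h : IsPrincipalBasis (-1) b a A R) (hR : 0 < R 0 0) {x : Amb n}
    (hx : qf (mink n) x < 0) (hx0 : 0 < x 0) : 0 < coords (-1) R x 0 := by
  set r : Amb n := fromCoords R (Pi.single 0 1) with hr
  have hrc : coords (-1) R r = Pi.single 0 1 := h.coords_fromCoords _
  have hbil : ∀ y, bil (mink n) r y = -coords (-1) R y 0 := by
    intro y
    rw [← formMatrix_neg_one, h.bil_form, hrc]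
    simp
  have hr0 : r 0 = R 0 0 := by
    rw [hr, fromCoords, Matrix.mulVec_single_one]
    rfl
  have hrr : qf (mink n) r < 0 := by
    rw [qf, hbil, hrc]
    simp
  have := bil_mink_neg hrr hx (by rwa [hr0]) hx0
  rw [hbil] at this
  linarith

/-- In the light cone, the future is the same for the standard basis and for the principal basis. -/
theorem coords_zero_pos_iff (h : IsPrincipalBasis (-1) b a A R) (hR : 0 < R 0 0) {x : Amb n}
    (hx : qf (mink n) x < 0) : 0 < coords (-1) R x 0 ↔ 0 < x 0 := by
  refine ⟨fun hc => ?_, coords_zero_pos_of_pos h hR hx⟩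
  by_contra hcon
  rcases (not_lt.1 hcon).lt_or_eq with h0 | h0
  · have := coords_zero_pos_of_pos h hR (x := -x) (by rwa [qf_neg])
      (by rw [PiLp.neg_apply]; linarith)
    rw [← neg_one_smul ℝ x, coords_smul, Pi.smul_apply, smul_eq_mul] at this
    linarith
  · rw [qf, bil_mink, h0, mul_zero, neg_zero, zero_add] at hx
    exact absurd hx (not_lt.2 (Finset.sum_nonneg fun i _ => mul_self_nonneg _))

theorem mem_hyp_iff (h : IsPrincipalBasis (-1) b a A R) (hR : 0 < R 0 0) {x : Amb n} :
    x ∈ hyp n ↔ qf (formMatrix (-1) n) x = -1 ∧ 0 < coords (-1) R x 0 := by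
  rw [hyp, mem_ofPred_eq, formMatrix_neg_one]
  refine and_congr_right fun hx => ?_
  rw [coords_zero_pos_iff h hR (by rw [hx]; norm_num)]

theorem isHomeoidal_hyperbolic (hn : 2 ≤ n) (h : IsPrincipalBasis (-1) b a A R)
    (hR : 0 < R 0 0) :
    (∃ o, IsHomeoidal (hypVol n) (hypShell A) (hypEll A) o) ∧
      ∀ o, IsHomeoidal (hypVol n) (hypShell A) (hypEll A) o →
        ∃ κ : NNReal, 0 < κ ∧ o = κ • homeoidalMeasure (-1) R b a := by
  have hq : Continuous (qf A : Amb n → ℝ) := continuous_qf A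
  have hJ : Continuous (qf (mink n) : Amb n → ℝ) := continuous_qf _
  have hx0 : Continuous fun x : Amb n => x 0 := by fun_prop
  have hC : MeasurableSet {x : Amb n | -1 < qf (mink n) x ∧ qf (mink n) x < 0 ∧ 0 < x 0} :=
    (measurableSet_lt measurable_const hJ.measurable).inter
      ((measurableSet_lt hJ.measurable measurable_const).inter
        (measurableSet_lt measurable_const hx0.measurable))
  have hvol : hypVol n = ((n : ENNReal) + 1) • ((volume : Measure (Amb n)).restrict
      {x : Amb n | -1 < qf (mink n) x ∧ qf (mink n) x < 0 ∧ 0 < x 0}).map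
        fun x => (1 / √(-1 * qf (formMatrix (-1) n) x)) • x := by
    simp only [neg_one_mul, formMatrix_neg_one]
    rfl
  obtain ⟨c, hc, hres⟩ := h.exists_restrict_eq_map hC hvol fun x hx => by
    rw [mem_ofPred_eq, formMatrix_neg_one]
    constructor
    · rintro ⟨h1, h2, -⟩
      constructor <;> linarith
    · rintro ⟨h1, h2⟩
      have h3 : qf (mink n) x < 0 := by linarith
      exact ⟨by linarith, h3, (coords_zero_pos_iff h hR h3).1 hx⟩
  have hmem : ∀ z : EuclideanSpace ℝ (Fin n), 0 < chartForm (-1) b a z z →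
      chartProj (-1) R b a z ∈ hyp n := fun z hz =>
    (mem_hyp_iff h hR).2 ⟨h.qf_form_chartProj hz, h.coords_chartProj_zero_pos hz⟩
  refine h.isHomeoidal_exists_and_unique hn hc hres (fun ε => ?_) (fun ε x hx => ?_)
    (fun ε z hz => ?_) (fun ω => ?_)
  · exact ((measurableSet_eq_fun hJ.measurable measurable_const).inter
      (measurableSet_lt measurable_const hx0.measurable)).inter
        ((measurableSet_le measurable_const hq.measurable).inter
          (measurableSet_le hq.measurable measurable_const))
  · exact ((mem_hyp_iff h hR).1 hx.1).2
  · exact ⟨fun hx => hx.2, fun hx => ⟨hmem z hz, hx⟩⟩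
  · exact ⟨hmem ω.1 (h.chartForm_sphere_pos ω), h.qf_quadric_chartProj_sphere ω⟩

theorem hypPot_smul_homeoidalMeasure (κ : NNReal) (x : Amb n) :
    hypPot (κ • homeoidalMeasure (-1) R b a) x = κ * ∫ y,
      hypU n (Real.arcosh (-1 * bil (formMatrix (-1) n) x y)) ∂homeoidalMeasure (-1) R b a := by
  simp only [hypPot, hypU_hypDist]
  rw [integral_smul_nnreal_measure, NNReal.smul_def, smul_eq_mul]

theorem exists_confocal_hyperbolic (h : IsPrincipalBasis (-1) b a A R) {x : Amb n}
    (hx : qf (formMatrix (-1) n) x = -1) (hA : 0 < qf A x) :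
    ∃ l < 0, qf (confocal (mink n) A l) x = 0 := by
  have hb := h.b_pos
  set S := ∑ i : Fin n, coords (-1) R x i.succ ^ 2 with hS
  have hS0 : 0 ≤ S := Finset.sum_nonneg fun i _ => sq_nonneg _
  have hx0 : coords (-1) R x 0 ^ 2 = 1 + S := by
    rw [qf, h.bil_form] at hx
    simp only [← sq] at hx
    linarith
  have hbS : 0 ≤ b * S := mul_nonneg hb.le hS0
  -- as `l → -∞` the defining function tends to `S - y₀² = -1`
  obtain ⟨M, hM⟩ : ∃ M, M = b * S + 1 := ⟨_, rfl⟩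
  have hM0 : 0 < M := by linarith
  have h1 : ∑ i : Fin n, coords (-1) R x i.succ ^ 2 / (a i - -M) ≤ S / M := by
    rw [hS, Finset.sum_div]
    refine Finset.sum_le_sum fun i _ => ?_
    have := h.a_pos i
    exact div_le_div_of_nonneg_left (sq_nonneg _) hM0 (by linarith)
  have h2 : (b + -1 * -M) * ∑ i : Fin n, coords (-1) R x i.succ ^ 2 / (a i - -M) <
      coords (-1) R x 0 ^ 2 := by
    refine (mul_le_mul_of_nonneg_left h1 (by linarith)).trans_lt ?_
    rw [hx0, ← mul_div_assoc, div_lt_iff₀ hM0]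
    nlinarith
  obtain ⟨l, hl, hq⟩ := h.exists_confocal hA (neg_lt_zero.2 hM0)
    (fun l hl => by linarith [hl.2]) h2
  exact ⟨l, hl.2, hq⟩

theorem hypPot_levelSet (hn : 2 ≤ n) (h : IsPrincipalBasis (-1) b a A R) (hR : 0 < R 0 0)
    {κ : NNReal} (hκ : 0 < κ) {l : ℝ} (hl : l < 0) :
    {x ∈ hypOutside A | hypPot (κ • homeoidalMeasure (-1) R b a) x =
      κ * levelValue (-1) b a (fun c => hypU n (Real.arcosh c)) l} =
        hypEll (confocal (mink n) A l) := by
  have hκ' : (0 : ℝ) < κ := hκ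
  have hb := h.b_pos
  have hbl : ∀ m < 0, 0 < b + -1 * m := fun m hm => by linarith
  ext x
  constructor
  · rintro ⟨hx, hpot⟩
    obtain ⟨hxG, h0⟩ := (mem_hyp_iff h hR).1 hx.1
    refine ⟨hx.1, ?_⟩
    obtain ⟨m, hm, hq⟩ := exists_confocal_hyperbolic h hxG hx.2
    rw [hypPot_smul_homeoidalMeasure] at hpot
    exact (h.integral_potential_eq_levelValue_iff hn (isKernel_hypU hn) hxG h0
      ⟨m, hm, hbl m hm, hq⟩ hl (hbl l hl)).1 (mul_left_cancel₀ hκ'.ne' hpot)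
  · rintro ⟨hx, hq⟩
    obtain ⟨hxG, h0⟩ := (mem_hyp_iff h hR).1 hx
    refine ⟨⟨hx, h.qf_pos_of_confocal hl (hbl l hl) hxG h0 hq⟩, ?_⟩
    rw [hypPot_smul_homeoidalMeasure, h.integral_potential_confocal hn (isKernel_hypU hn) hl
      (hbl l hl) hxG h0 hq]

end Hyperbolic

theorem theorem4p7 (n : ℕ) (hn : 2 ≤ n)
    (A : Matrix (Fin (n + 1)) (Fin (n + 1)) ℝ) (hA : IsElliptic A) :
    -- the spherical case
    (∀ (e : Amb n) (b : ℝ), ‖e‖ = 1 → 0 < b → A *ᵥ e.ofLp = -(1 / b) • e.ofLp →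
      (∃ o : Measure (Amb n), IsHomeoidal (sphVol n) (sphShell A e) (sphEll A e) o) ∧
      ∀ o : Measure (Amb n), IsHomeoidal (sphVol n) (sphShell A e) (sphEll A e) o →
        (∀ p ∈ sphInside A e ∪ -sphInside A e,
          Integrable (fun y => sphForce p y) o ∧ sphField o p = 0) ∧
        (∀ x ∈ sphOutside A, Integrable (fun y => sphU n (sphDist x y)) o) ∧
        (∀ l ∈ Ioo (-b) 0, ∃ c : ℝ,
          {x ∈ sphOutside A | sphPot o x = c} = sphEll (confocal 1 A l) e ∧
          {x ∈ sphOutside A | sphPot o x = -c} = -sphEll (confocal 1 A l) e) ∧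
        {x ∈ sphOutside A | sphPot o x = 0} = {x ∈ sph n | inner ℝ e x = 0} ∧
        (∀ x ∈ sphOutside A, inner ℝ e x ≠ 0 → ∃ l ∈ Ioo (-b) 0,
          x ∈ sphEll (confocal 1 A l) e ∪ -sphEll (confocal 1 A l) e)) ∧
    -- the hyperbolic case
    ((∀ x : Amb n, x ≠ 0 → qf A x = 0 → qf (mink n) x < 0) →
      (∃ o : Measure (Amb n), IsHomeoidal (hypVol n) (hypShell A) (hypEll A) o) ∧
      ∀ o : Measure (Amb n), IsHomeoidal (hypVol n) (hypShell A) (hypEll A) o →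
        (∀ p ∈ hypInside A, Integrable (fun y => hypForce p y) o ∧ hypField o p = 0) ∧
        (∀ x ∈ hypOutside A, Integrable (fun y => hypU n (hypDist x y)) o) ∧
        (∀ l < 0, ∃ c : ℝ,
          {x ∈ hypOutside A | hypPot o x = c} = hypEll (confocal (mink n) A l)) ∧
        (∀ x ∈ hypOutside A, ∃ l < 0, x ∈ hypEll (confocal (mink n) A l))) := by
  constructor
  · intro e b he hb hAe
    obtain ⟨R, a, h, hRe⟩ := exists_principalBasis_sphere hA he hb hAe
    obtain ⟨hex, huniq⟩ := isHomeoidal_sphere hn h hRe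
    refine ⟨hex, fun o ho => ?_⟩
    obtain ⟨κ, hκ, rfl⟩ := huniq o ho
    refine ⟨fun p hp => sphField_eq_zero hn h hRe κ hp,
      fun x hx => integrable_sphU (by omega) h κ hx, fun l hl => ?_, ?_, fun x hx h0 => ?_⟩
    · have hlevel := sphPot_levelSet hn h hRe hκ hl
      refine ⟨_, hlevel, ?_⟩
      rw [← hlevel]
      ext x
      rw [Set.mem_neg, mem_sep_iff, mem_sep_iff, neg_mem_sphOutside, sphPot_neg, neg_eq_iff_eq_neg]
    · ext x
      exact ⟨fun hx => ⟨hx.1.1, (sphPot_eq_zero_iff hn h hRe hκ hx.1).1 hx.2⟩,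
        fun hx => ⟨equator_subset_sphOutside h hRe hx.1 hx.2, sphPot_eq_zero h hRe κ hx.2⟩⟩
    · rcases lt_or_gt_of_ne h0 with h0 | h0
      · have h1 : 0 < inner ℝ e (-x) := by rw [inner_neg_right]; linarith
        obtain ⟨l, hl, hq⟩ := exists_confocal_sphere h (neg_mem_sphOutside.2 hx).2
          (by rwa [coords_one_zero hRe])
        exact ⟨l, hl, Or.inr ⟨neg_mem_sph.2 hx.1, hq, h1⟩⟩
      · obtain ⟨l, hl, hq⟩ := exists_confocal_sphere h hx.2 (by rwa [coords_one_zero hRe])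
        exact ⟨l, hl, Or.inl ⟨hx.1, hq, h0⟩⟩
  · intro hcone
    obtain ⟨R, a, b, h, hR⟩ := exists_principalBasis_hyperbolic hn hA hcone
    obtain ⟨hex, huniq⟩ := isHomeoidal_hyperbolic hn h hR
    refine ⟨hex, fun o ho => ?_⟩
    obtain ⟨κ, hκ, rfl⟩ := huniq o ho
    refine ⟨fun p hp => ?_, fun x hx => ?_, fun l hl => ⟨_, hypPot_levelSet hn h hR hκ hl⟩,
      fun x hx => ?_⟩
    · obtain ⟨hpG, h0⟩ := (mem_hyp_iff h hR).1 hp.1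
      exact h.field_eq_zero hn (fun p y => hypForce_eq (by omega)) κ hpG h0 hp.2
    · obtain ⟨hxG, h0⟩ := (mem_hyp_iff h hR).1 hx.1
      simp only [hypU_hypDist]
      exact (h.integrable_potential (isKernel_hypU hn)
        (h.bil_mem_kernelDomain hxG h0 hx.2.ne')).smul_measure_nnreal
    · obtain ⟨l, hl, hq⟩ := exists_confocal_hyperbolic h ((mem_hyp_iff h hR).1 hx.1).1 hx.2
      exact ⟨l, hl, hx.1, hq⟩
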